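/- Setting. Let $n_e\in C^2(\mathbb R)$ with $n_e(0)=1$, $n_e'(0)=-1$, let $\alpha\in[0,1]$, and write $\xi=(\xi_1,\xi')\in\mathbb R\times\mathbb R^2$, $\mathbb R_+=(0,\infty)$, $\mathbb R^3_+=\{\xi_1>0\}$, and $\chi$ for the indicator function of $\{s>0\}$. Given $\phi_b\in\mathbb R$ and $f_b\in L^1(\mathbb R^3_+)$, $f_\infty\in L^1(\mathbb R^3)$, a *solution* is a pair $(f,\phi)$ such that (a) $f\in L^1_{loc}(\overline{\mathbb R_+}\times\mathbb R^3)\cap C(\overline{\mathbb R_+};L^1(\mathbb R^3))$ and $\phi\in C^1(\overline{\mathbb R_+})\cap C^2(\mathbb R_+)$; (b) $f(x,\cdot)\ge 0$ for every $x\ge0$, and either $\phi'(x)>0$ for all $x\ge 0$ or $\phi'(x)<0$ for all $x\ge0$ (one-sided derivative at $x=0$); (c) for every compactly supported $\psi\in C^1(\overline{\mathbb R_+}\times\mathbb R^3)$ with $\alpha\psi(0,\xi_1,\xi')=\psi(0,-\xi_1,\xi')$ for $\xi_1>0$, $$\int_{\mathbb R_+\times\mathbb R^3} f\,(\xi_1\partial_x\psi+\phi'\,\partial_{\xi_1}\psi)\,dx\,d\xi+\int_{\mathbb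 R^3_+}f_b(\xi)\,\xi_1\psi(0,\xi)\,d\xi=0,$$ and $\lim_{x\to\infty}\|f(x,\cdot)-f_\infty\|_{L^1(\mathbb R^3)}=0$; (d) $\phi''(x)=\int_{\mathbb R^3}f(x,\xi)\,d\xi-n_e(\phi(x))$ for $x>0$, $\phi(0)=\phi_b$, and $\lim_{x\to\infty}\phi(x)=0$. For $\phi\le 0$ let $$\rho_i^-(\phi)=\int_{\mathbb R^3}f_\infty(\xi)\frac{|\xi_1|}{\sqrt{\xi_1^2+2\phi}}\,\chi(\xi_1^2+2\phi)\,d\xi,\qquad V^-(\phi)=\int_0^\phi\big(\rho_i^-(\varphi)-n_e(\varphi)\big)\,d\varphi,$$ and $B^-=\{\varphi<0:\ V^-(\phi)>0\text{ for all }\phi\in[\varphi,0)\}$, with $\inf B^-\in[-\infty,0)$ when $B^-\ne\emptyset$. Theorem (repulsive boundary). Let $\phi_b<0$, let $f_b\in L^1(\mathbb R^3_+)$ and $f_\infty\in L^1(\mathbb R^3)$ be nonnegative, and suppose that for some $r\in(2,\infty)$ one has $\int_a^b\big(\int_{\mathbb R^2}|f_\infty(\xi_1,\xi')|\,d\xi'\big)^r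 d\xi_1<\infty$ for all $a<b$. Suppose that $\int_{\mathbb R^3}f_\infty\,d\xi=1$, that almost everywhere $$f_\infty(\xi)=f_b\big(\sqrt{\xi_1^2+2\phi_b},\xi'\big)+\alpha f_\infty(-\xi_1,\xi')\quad\text{for }\xi_1>\sqrt{2|\phi_b|},$$ $$f_\infty(\xi_1,\xi')=f_\infty(-\xi_1,\xi')\quad\text{for }|\xi_1|<\sqrt{2|\phi_b|},$$ and that $V^-\in C^2([\phi_b,0])$. Below, $\frac{d^2V^-}{d\phi^2}(0)$ is the one-sided second derivative on $[\phi_b,0]$. (i) If $\frac{d^2V^-}{d\phi^2}(0)>0$, then $B^-\neq\emptyset$. There is a unique solution $(f,\phi)$ if and only if $\phi_b>\inf B^-$, and there is no solution if $\phi_b\le\inf B^-$. The solution satisfies, for every $x\ge 0$ and almost every $\xi\in\mathbb R^3$, $$f(x,\xi)=f_\infty\big(-\sqrt{\xi_1^2-2\phi(x)},\xi'\big)\chi(-\xi_1)+f_\infty\big(\sqrt{\xi_1^2-2\phi(x)},\xi'\big)\chi(\xi_1),\qquad(\ast)$$ and there are constants $c,C>0$ independent of $x$ such that $|\partial_x^l\phi(x)|\le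 Ce^{-cx}$ for all $x>0$ and $l=0,1,2$. (ii) If $\frac{d^2V^-}{d\phi^2}(0)=0$ and $B^-\ne\emptyset$, then there is a unique solution $(f,\phi)$ if and only if $\phi_b>\inf B^-$, and there is no solution if $\phi_b\le\inf B^-$. The solution satisfies $(\ast)$. (iii) If $\frac{d^2V^-}{d\phi^2}(0)=0$ and $B^-=\emptyset$, then there is no solution. (iv) If $\frac{d^2V^-}{d\phi^2}(0)<0$, then there is no solution. -/

import Mathlib

open MeasureTheory Set Filter Topology

namespace Sheath

noncomputable section

/-- Velocity space `ℝ³`, a velocity being written `ξ = (ξ₁, ξ')` with `ξ₁ ∈ ℝ`, `ξ' ∈ ℝ²`.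
It carries the product Lebesgue measure. -/
abbrev Vel : Type := ℝ × (ℝ × ℝ)

/-- The indicator function of `{s > 0}`. -/
def chi (s : ℝ) : ℝ := if 0 < s then 1 else 0

/-- The space `L^r_loc(ℝ; L¹(ℝ²))`. -/
def LrLoc (r : ℝ) (g : Vel → ℝ) : Prop :=
  LocallyIntegrable g ∧
    ∀ a b : ℝ, a < b → ∫⁻ s in Ioo a b, (∫⁻ η : ℝ × ℝ, ‖g (s, η)‖ₑ) ^ r < ⊤

/-- The test functions: `C¹` functions with compact support on the closed half space
`{x ≥ 0} × ℝ³` (given as restrictions of compactly supported `C¹` functions on the whole space),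
subject to `α ψ(0, ξ₁, ξ') = ψ(0, -ξ₁, ξ')` for `ξ₁ > 0`. -/
def IsTest (α : ℝ) (ψ : ℝ × Vel → ℝ) : Prop :=
  ContDiff ℝ 1 ψ ∧ HasCompactSupport ψ ∧
    ∀ (s : ℝ) (η : ℝ × ℝ), 0 < s → α * ψ (0, (s, η)) = ψ (0, (-s, η))

/-- `(f, φ)` is a solution of the boundary value problem for the stationary Vlasov-Poisson system
on the half line. Only the values at `x ≥ 0` matter, and `f x` is understood up to null sets.
The derivative of `φ` on the closed half line is one-sided at `0`. -/
structure IsSolution (ne : ℝ → ℝ) (α : ℝ) (fb finf : Vel → ℝ) (φb : ℝ)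
    (f : ℝ → Vel → ℝ) (φ : ℝ → ℝ) : Prop where
  /-- `f ∈ L¹_loc([0,∞) × ℝ³)` -/
  locInt : LocallyIntegrableOn (fun p : ℝ × Vel => f p.1 p.2) (Ici (0 : ℝ) ×ˢ (univ : Set Vel))
  /-- `f ∈ C([0,∞); L¹(ℝ³))` -/
  slice_integrable : ∀ x, 0 ≤ x → Integrable (f x)
  slice_continuous : ∀ x₀, 0 ≤ x₀ →
    Tendsto (fun x => ∫ ξ, |f x ξ - f x₀ ξ|) (𝓝[Ici 0] x₀) (𝓝 0)
  phi_C1 : ContDiffOn ℝ 1 φ (Ici 0)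
  phi_C2 : ContDiffOn ℝ 2 φ (Ioi 0)
  nonneg : ∀ x, 0 ≤ x → ∀ᵐ ξ : Vel, 0 ≤ f x ξ
  strictly_monotone : (∀ x, 0 ≤ x → 0 < derivWithin φ (Ici 0) x) ∨
    (∀ x, 0 ≤ x → derivWithin φ (Ici 0) x < 0)
  /-- weak form of the Vlasov equation and of the boundary condition at the wall -/
  weak : ∀ ψ : ℝ × Vel → ℝ, IsTest α ψ →
    (∫ p in Ioi (0 : ℝ) ×ˢ (univ : Set Vel),
        f p.1 p.2 * (p.2.1 * fderiv ℝ ψ p (1, 0)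
          + derivWithin φ (Ici 0) p.1 * fderiv ℝ ψ p (0, (1, 0))))
      + (∫ ξ in {ξ : Vel | 0 < ξ.1}, fb ξ * (ξ.1 * ψ (0, ξ))) = 0
  limit_f : Tendsto (fun x => ∫ ξ, |f x ξ - finf ξ|) atTop (𝓝 0)
  /-- the Poisson equation -/
  poisson : ∀ x, 0 < x → iteratedDeriv 2 φ x = (∫ ξ, f x ξ) - ne (φ x)
  phi_wall : φ 0 = φb
  limit_phi : Tendsto φ atTop (𝓝 0)

def HasSolution (ne : ℝ → ℝ) (α : ℝ) (fb finf : Vel → ℝ) (φb : ℝ) : Prop :=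
  ∃ f φ, IsSolution ne α fb finf φb f φ

/-- There is exactly one solution, where two solutions are identified when the potentials agree
on `[0,∞)` and, for every `x ≥ 0`, the distributions at `x` agree in `L¹(ℝ³)`. -/
def HasUniqueSolution (ne : ℝ → ℝ) (α : ℝ) (fb finf : Vel → ℝ) (φb : ℝ) : Prop :=
  ∃ f φ, IsSolution ne α fb finf φb f φ ∧
    ∀ g θ, IsSolution ne α fb finf φb g θ →
      (∀ x, 0 ≤ x → g x =ᵐ[volume] f x) ∧ (∀ x, 0 ≤ x → θ x = φ x)

/-- The compatibility condition between `f_∞` and `f_b` for a repulsive wall, almost everywhere. -/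
def Compatible (α : ℝ) (fb finf : Vel → ℝ) (φb : ℝ) : Prop :=
  (∀ᵐ ξ : Vel, √(2 * |φb|) < ξ.1 →
    finf ξ = fb (√(ξ.1 ^ 2 + 2 * φb), ξ.2) + α * finf (-ξ.1, ξ.2)) ∧
  (∀ᵐ ξ : Vel, ξ.1 ∈ Ioo (-√(2 * |φb|)) (√(2 * |φb|)) →
    finf ξ = finf (-ξ.1, ξ.2))

/-- The ion density `ρ_i⁻` as a function of the potential `φ ≤ 0`. -/
def rhoMinus (finf : Vel → ℝ) (φ : ℝ) : ℝ :=
  ∫ ξ : Vel, finf ξ * (|ξ.1| / √(ξ.1 ^ 2 + 2 * φ)) * chi (ξ.1 ^ 2 + 2 * φ)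

/-- The function `V⁻`, considered for `φ ≤ 0`. -/
def VMinus (ne : ℝ → ℝ) (finf : Vel → ℝ) (φ : ℝ) : ℝ :=
  ∫ t in (0 : ℝ)..φ, (rhoMinus finf t - ne t)

/-- The set `B⁻`. -/
def BMinus (ne : ℝ → ℝ) (finf : Vel → ℝ) : Set ℝ :=
  {b | b < 0 ∧ ∀ φ ∈ Ico b 0, 0 < VMinus ne finf φ}

/-- The infimum of `B⁻`, in the extended reals (it may be `-∞`). -/
def infB (ne : ℝ → ℝ) (finf : Vel → ℝ) : EReal :=
  sInf ((fun b : ℝ => (b : EReal)) '' BMinus ne finf)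

/-- The second derivative of `V⁻`, as a function on `[φ_b, 0]`, at the endpoint `0`. -/
def d2VMinus (ne : ℝ → ℝ) (finf : Vel → ℝ) (φb : ℝ) : ℝ :=
  iteratedDerivWithin 2 (VMinus ne finf) (Icc φb 0) 0

/-- The explicit form of the distribution in terms of the potential. -/
def ExplicitForm (finf : Vel → ℝ) (f : ℝ → Vel → ℝ) (φ : ℝ → ℝ) : Prop :=
  ∀ x, 0 ≤ x → ∀ᵐ ξ : Vel,
    f x ξ = finf (-√(ξ.1 ^ 2 - 2 * φ x), ξ.2) * chi (-ξ.1)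
      + finf (√(ξ.1 ^ 2 - 2 * φ x), ξ.2) * chi ξ.1

/-- Exponential decay of the potential and its first two derivatives. -/
def ExpDecay (φ : ℝ → ℝ) : Prop :=
  ∃ c C : ℝ, 0 < c ∧ 0 < C ∧
    ∀ l : ℕ, l ≤ 2 → ∀ x, 0 < x → |iteratedDeriv l φ x| ≤ C * Real.exp (-c * x)

end

end Sheath

open Sheath

/-! Along a characteristic the energy `ξ₁²/2 - φ` and `ξ'` are conserved. A repulsive wall forces
`φ` to increase strictly to `0`, so a particle at `x` with `ξ₁ ≠ 0` is joined to infinity, forward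
or backward in time, and its velocity there is `shiftVel (-2 * φ x) ξ`. Testing the weak Vlasov
equation with functions `θ(x) K`, where `K` is carried by the characteristics, shows that flux
moments do not depend on `x`; comparison with the limit gives `f(x, ξ) = f_∞(shiftVel (-2 * φ x) ξ)`
(`IsSolution.ae_eq_comp_shiftVel`). Hence the ion density is `ρ_i⁻(φ)`.

The Poisson equation becomes `φ'' = (V⁻)'(φ)`, with first integral `φ'² = 2 V⁻(φ)`
(`IsSolution.derivWithin_sq`). Since `φ' > 0` and `φ` sweeps `[φ_b, 0)`, necessarily `φ_b ∈ B⁻`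
(`IsSolution.mem_BMinus`). Continuity of `V⁻` makes this the same as `φ_b > inf B⁻` (`infB_lt_iff`).

Conversely, for `φ_b ∈ B⁻` the equation `φ' = √(2 V⁻(φ))` is solved uniquely by separation of
variables. Since `V⁻` is `C²` with `V⁻(0) = (V⁻)'(0) = 0`, one has `V⁻ ≤ C φ²`, so that `0` is
reached only at infinity (`exists_potential`). The transported profile then solves the weak
equation: in the variables (position, velocity at infinity), slow particles turn back and cancel in
pairs by symmetry of `f_∞`, while fast ones reach the wall and are handled by the compatibility
condition (`integral_transport`, `integral_wall`).

The sign of the second derivative at `0` only enters near `0`: if positive, `V⁻ ≥ m φ²` there, so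
`B⁻ ≠ ∅` and `φ` decays exponentially; if negative, `V⁻ < 0` there, which excludes solutions.

Analytically, the Jacobian `|s| / √(s² + c)` of the shift degenerates at `s = 0`. The local `L^r`
bound with `r > 2` controls the slow particles uniformly in `c` (`exists_near_small`); this yields
integrability and strong continuity of the shifted profiles, hence continuity of `ρ_i⁻`. -/

namespace Sheath

/-! ### The velocity shift given by conservation of energy. -/

/-- The change of the normal velocity along a characteristic on which the potential drops by
`c / 2`. -/
noncomputable def shift (c s : ℝ) : ℝ := Real.sign s * √(s ^ 2 + c)

/-- `shift` acting on the first component of a velocity. -/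
noncomputable def shiftVel (c : ℝ) (ξ : Vel) : Vel := (shift c ξ.1, ξ.2)

/-- The derivative of `shift c` away from the origin. -/
noncomputable def shiftJac (c s : ℝ) : ℝ := |s| / √(s ^ 2 + c)

lemma shift_of_pos {c s : ℝ} (hs : 0 < s) : shift c s = √(s ^ 2 + c) := by
  simp [shift, Real.sign_of_pos hs]

lemma shift_of_neg {c s : ℝ} (hs : s < 0) : shift c s = -√(s ^ 2 + c) := by
  simp [shift, Real.sign_of_neg hs]

@[simp] lemma shift_zero_right (c : ℝ) : shift c 0 = 0 := by simp [shift]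

@[simp] lemma shift_zero_left (s : ℝ) : shift 0 s = s := by
  rcases lt_trichotomy s 0 with h | h | h
  · rw [shift_of_neg h, add_zero, Real.sqrt_sq_eq_abs, abs_of_neg h, neg_neg]
  · simp [h]
  · rw [shift_of_pos h, add_zero, Real.sqrt_sq_eq_abs, abs_of_pos h]

@[simp] lemma shiftVel_zero (ξ : Vel) : shiftVel 0 ξ = ξ := by simp [shiftVel]

lemma shift_neg (c s : ℝ) : shift c (-s) = -shift c s := by
  simp [shift, Real.sign_neg]

lemma shift_sq {c s : ℝ} (hs : s ≠ 0) (h : 0 ≤ s ^ 2 + c) : shift c s ^ 2 = s ^ 2 + c := by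
  rcases lt_or_gt_of_ne hs with h' | h'
  · rw [shift_of_neg h', neg_sq, Real.sq_sqrt h]
  · rw [shift_of_pos h', Real.sq_sqrt h]

/-- The square root of a nonpositive real is `0` by convention. So a velocity at infinity too small
to reach a given potential is sent to zero velocity, where the profiles `K` of the test functions
vanish. -/
lemma shift_eq_zero_of_nonpos {c s : ℝ} (h : s ^ 2 + c ≤ 0) : shift c s = 0 := by
  simp [shift, Real.sqrt_eq_zero'.2 h]

lemma abs_shift_of_ne {c s : ℝ} (hs : s ≠ 0) : |shift c s| = √(s ^ 2 + c) := by
  rcases lt_or_gt_of_ne hs with h' | h'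
  · rw [shift_of_neg h', abs_neg, abs_of_nonneg (Real.sqrt_nonneg _)]
  · rw [shift_of_pos h', abs_of_nonneg (Real.sqrt_nonneg _)]

lemma abs_shift_le (c s : ℝ) : |shift c s| ≤ √(s ^ 2 + c) := by
  rcases eq_or_ne s 0 with rfl | h
  · simp [Real.sqrt_nonneg]
  · rw [abs_shift_of_ne h]

lemma shift_pos {c s : ℝ} (hs : 0 < s) (h : 0 < s ^ 2 + c) : 0 < shift c s := by
  rw [shift_of_pos hs]; exact Real.sqrt_pos.2 h

lemma shift_neg_of_neg {c s : ℝ} (hs : s < 0) (h : 0 < s ^ 2 + c) : shift c s < 0 := by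
  rw [shift_of_neg hs]; linarith [Real.sqrt_pos.2 h]

/-- Composition of two shifts. -/
lemma shift_shift {c d s : ℝ} (h : 0 < s ^ 2 + c) : shift d (shift c s) = shift (c + d) s := by
  rcases lt_trichotomy s 0 with h' | h' | h'
  · rw [shift_of_neg (shift_neg_of_neg h' h), shift_sq h'.ne h.le, shift_of_neg h', add_assoc]
  · subst h'; simp
  · rw [shift_of_pos (shift_pos h' h), shift_sq h'.ne' h.le, shift_of_pos h', add_assoc]

lemma hasDerivAt_shift {c s : ℝ} (hs : s ≠ 0) (h : 0 < s ^ 2 + c) :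
    HasDerivAt (shift c) (shiftJac c s) s := by
  have h0 : HasDerivAt (fun s : ℝ => √(s ^ 2 + c)) (2 * s / (2 * √(s ^ 2 + c))) s := by
    have h1 : HasDerivAt (fun s : ℝ => s ^ 2 + c) (2 * s) s := by
      simpa using (hasDerivAt_pow 2 s).add_const c
    exact h1.sqrt h.ne'
  have hp := Real.sqrt_pos.2 h
  rcases lt_or_gt_of_ne hs with h' | h'
  · have : HasDerivAt (fun s : ℝ => -√(s ^ 2 + c)) (shiftJac c s) s := by
      refine h0.neg.congr_deriv ?_
      rw [shiftJac, abs_of_neg h']; field_simp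
    refine this.congr_of_eventuallyEq ?_
    filter_upwards [Iio_mem_nhds h'] with t ht using shift_of_neg ht
  · have : HasDerivAt (fun s : ℝ => √(s ^ 2 + c)) (shiftJac c s) s := by
      refine h0.congr_deriv ?_
      rw [shiftJac, abs_of_pos h']; field_simp
    refine this.congr_of_eventuallyEq ?_
    filter_upwards [Ioi_mem_nhds h'] with t ht using shift_of_pos ht

lemma measurable_sign : Measurable Real.sign := by
  unfold Real.sign
  exact Measurable.ite measurableSet_Iio measurable_const
    (Measurable.ite measurableSet_Ioi measurable_const measurable_const)

lemma measurable_shift_uncurry : Measurable (fun p : ℝ × ℝ => shift p.1 p.2) := by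
  unfold shift
  exact (measurable_sign.comp measurable_snd).mul (by fun_prop)

lemma measurable_shiftVel_uncurry : Measurable (fun p : ℝ × Vel => shiftVel p.1 p.2) := by
  unfold shiftVel
  exact (measurable_shift_uncurry.comp (by fun_prop : Measurable
    (fun p : ℝ × Vel => (p.1, p.2.1)))).prodMk (by fun_prop)

lemma measurable_shiftVel (c : ℝ) : Measurable (shiftVel c) :=
  measurable_shiftVel_uncurry.comp measurable_prodMk_left

lemma measurable_shiftJac (c : ℝ) : Measurable (shiftJac c) := by
  unfold shiftJac; fun_prop

lemma shiftJac_nonneg (c s : ℝ) : 0 ≤ shiftJac c s := by unfold shiftJac; positivity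

lemma shiftJac_pos {c s : ℝ} (hc : 0 ≤ c) (hs : s ≠ 0) : 0 < shiftJac c s := by
  unfold shiftJac; positivity

/-! ### Change of variables between local velocity and velocity at infinity. -/

lemma image_shift {c : ℝ} (hc : 0 ≤ c) : shift c '' {0}ᶜ = {s | c < s ^ 2} := by
  ext t
  simp only [mem_image, mem_compl_iff, mem_singleton_iff, mem_ofPred_eq]
  constructor
  · rintro ⟨s, hs, rfl⟩
    rw [shift_sq hs (by positivity)]
    have : 0 < s ^ 2 := by positivity
    linarith
  · intro ht
    have ht0 : t ≠ 0 := by rintro rfl; simp at ht; linarith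
    have h0 : 0 < t ^ 2 + -c := by linarith
    refine ⟨shift (-c) t, ?_, ?_⟩
    · intro h
      have := shift_sq ht0 h0.le
      rw [h] at this; simp at this; linarith
    · rw [shift_shift h0]; simp

lemma injOn_shift {c : ℝ} (hc : 0 ≤ c) : InjOn (shift c) {0}ᶜ := by
  intro s hs t ht h
  have h1 : 0 < s ^ 2 + c := by
    have : 0 < s ^ 2 := by have : s ≠ 0 := hs; positivity
    linarith
  have h2 : 0 < t ^ 2 + c := by
    have : 0 < t ^ 2 := by have : t ≠ 0 := ht; positivity
    linarith
  have := congrArg (shift (-c)) h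
  rwa [shift_shift h1, shift_shift h2, add_neg_cancel, shift_zero_left, shift_zero_left] at this

/-- For `c ≥ 0` the shift is injective and differentiable off the origin, and the missing point is
null. -/
lemma lintegral_shift {c : ℝ} (hc : 0 ≤ c) (g : ℝ → ENNReal) :
    ∫⁻ s, ENNReal.ofReal (shiftJac c s) * g (shift c s) = ∫⁻ s in {s | c < s ^ 2}, g s := by
  have hm : MeasurableSet ({0}ᶜ : Set ℝ) := (measurableSet_singleton 0).compl
  have h := lintegral_image_eq_lintegral_abs_deriv_mul (s := {0}ᶜ) (f := shift c)
    (f' := shiftJac c) hm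
    (fun s hs => (hasDerivAt_shift hs (by
      have : s ≠ 0 := hs
      positivity)).hasDerivWithinAt) (injOn_shift hc) g
  rw [image_shift hc] at h
  rw [h, restrict_compl_singleton]
  simp only [abs_of_nonneg (shiftJac_nonneg c _)]

/-- Lebesgue measure with the density `shiftJac c ξ₁`. -/
noncomputable def shiftMeasure (c : ℝ) : Measure Vel :=
  volume.withDensity (fun ξ : Vel => ENNReal.ofReal (shiftJac c ξ.1))

lemma measurableSet_lt_sq (c : ℝ) : MeasurableSet {ξ : Vel | c < ξ.1 ^ 2} :=
  measurableSet_lt measurable_const (by fun_prop)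

lemma lintegral_shiftVel {c : ℝ} (hc : 0 ≤ c) {g : Vel → ENNReal} (hg : Measurable g) :
    ∫⁻ ξ : Vel, ENNReal.ofReal (shiftJac c ξ.1) * g (shiftVel c ξ)
      = ∫⁻ ξ in {ξ : Vel | c < ξ.1 ^ 2}, g ξ := by
  have e : {ξ : Vel | c < ξ.1 ^ 2} = {s : ℝ | c < s ^ 2} ×ˢ (univ : Set (ℝ × ℝ)) := by
    ext; simp
  have hJ := (measurable_shiftJac c).ennreal_ofReal
  rw [Measure.volume_eq_prod, lintegral_prod _ (by
    exact ((hJ.comp measurable_fst).mul (hg.comp (measurable_shiftVel c))).aemeasurable)]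
  rw [e, ← Measure.prod_restrict, Measure.restrict_univ, lintegral_prod _ hg.aemeasurable,
    ← lintegral_shift hc]
  refine lintegral_congr fun s => ?_
  simp only [shiftVel]
  rw [lintegral_const_mul _ (by fun_prop)]

/-- Recasts the change of variables as a measure-preserving map, so that Bochner integrals and null
sets can be transported. -/
lemma measurePreserving_shiftVel {c : ℝ} (hc : 0 ≤ c) :
    MeasurePreserving (shiftVel c) (shiftMeasure c)
      (volume.restrict {ξ : Vel | c < ξ.1 ^ 2}) := by
  refine ⟨measurable_shiftVel c, ?_⟩
  ext A hA
  rw [Measure.map_apply (measurable_shiftVel c) hA, ← lintegral_indicator_one hA,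
    ← lintegral_shiftVel hc (measurable_one.indicator hA), shiftMeasure,
    withDensity_apply _ (measurable_shiftVel c hA), ← lintegral_indicator (measurable_shiftVel c hA)]
  refine lintegral_congr fun ξ => ?_
  by_cases h : shiftVel c ξ ∈ A
  · simp [h, indicator]
  · simp [h, indicator]

lemma ae_fst_ne_zero : ∀ᵐ ξ : Vel, ξ.1 ≠ 0 := by
  have h : ∀ᵐ s : ℝ, s ≠ 0 := by simp [ae_iff]
  exact (Measure.quasiMeasurePreserving_fst (μ := (volume : Measure ℝ))
    (ν := (volume : Measure (ℝ × ℝ)))).ae h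

lemma volume_ac_shiftMeasure {c : ℝ} (hc : 0 ≤ c) : (volume : Measure Vel) ≪ shiftMeasure c := by
  refine withDensity_absolutelyContinuous'
    (((measurable_shiftJac c).comp measurable_fst).ennreal_ofReal).aemeasurable ?_
  filter_upwards [ae_fst_ne_zero] with ξ hξ
  simpa using shiftJac_pos hc hξ

/-- The Jacobian is positive off `ξ₁ = 0`, so null sets pull back to null sets; only the region `c <
ξ₁²`, into which the shift maps, has to be controlled. -/
lemma ae_shiftVel {c : ℝ} (hc : 0 ≤ c) {p : Vel → Prop}
    (h : ∀ᵐ ξ : Vel, c < ξ.1 ^ 2 → p ξ) : ∀ᵐ ξ : Vel, p (shiftVel c ξ) := by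
  have h' : ∀ᵐ ξ ∂(volume.restrict {ξ : Vel | c < ξ.1 ^ 2}), p ξ :=
    (ae_restrict_iff' (measurableSet_lt_sq c)).2 h
  exact (volume_ac_shiftMeasure hc).ae_le
    ((measurePreserving_shiftVel hc).quasiMeasurePreserving.ae h')

lemma ae_shiftVel' {c : ℝ} (hc : 0 ≤ c) {p : Vel → Prop}
    (h : ∀ᵐ ξ : Vel, p ξ) : ∀ᵐ ξ : Vel, p (shiftVel c ξ) :=
  ae_shiftVel hc (h.mono fun _ h _ => h)

lemma integral_shiftVel {c : ℝ} (hc : 0 ≤ c) {g : Vel → ℝ}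
    (hg : AEStronglyMeasurable g (volume.restrict {ξ : Vel | c < ξ.1 ^ 2})) :
    ∫ ξ : Vel, shiftJac c ξ.1 * g (shiftVel c ξ) = ∫ ξ in {ξ : Vel | c < ξ.1 ^ 2}, g ξ := by
  have hp := measurePreserving_shiftVel hc
  rw [← hp.map_eq] at hg ⊢
  rw [integral_map hp.measurable.aemeasurable hg, shiftMeasure]
  have := integral_withDensity_eq_integral_smul (μ := (volume : Measure Vel))
    (f := fun ξ => (shiftJac c ξ.1).toNNReal)
    ((measurable_shiftJac c).comp measurable_fst).real_toNNReal (fun ξ => g (shiftVel c ξ))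
  rw [show (fun ξ : Vel => ENNReal.ofReal (shiftJac c ξ.1)) =
    fun ξ : Vel => (((shiftJac c ξ.1).toNNReal : NNReal) : ENNReal) from rfl, this]
  refine integral_congr_ae (Eventually.of_forall fun ξ => ?_)
  simp [NNReal.smul_def, Real.coe_toNNReal _ (shiftJac_nonneg c _)]

/-- The ion density is the integral of the shifted distribution. -/
lemma rhoMinus_eq {finf : Vel → ℝ} (hf : AEStronglyMeasurable finf) {t : ℝ} (ht : t ≤ 0) :
    rhoMinus finf t = ∫ ξ, finf (shiftVel (-2 * t) ξ) := by
  set c := -2 * t with hc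
  have hc0 : 0 ≤ c := by linarith
  have h1 : rhoMinus finf t
      = ∫ ξ in {ξ : Vel | c < ξ.1 ^ 2}, finf ξ * (|ξ.1| / √(ξ.1 ^ 2 + 2 * t)) := by
    rw [rhoMinus, ← integral_indicator (measurableSet_lt_sq c)]
    congr 1; ext ξ
    by_cases h : c < ξ.1 ^ 2
    · have : 0 < ξ.1 ^ 2 + 2 * t := by linarith
      simp [indicator, h, chi, this]
    · have : ¬ 0 < ξ.1 ^ 2 + 2 * t := by linarith
      simp [indicator, h, chi, this]
  rw [h1, ← integral_shiftVel hc0]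
  · refine integral_congr_ae ?_
    filter_upwards [ae_fst_ne_zero] with ξ hξ
    have hpos : 0 < ξ.1 ^ 2 + c := by positivity
    simp only [shiftVel, shiftJac]
    -- At the shifted velocity the weight is `√(ξ₁² + c) / |ξ₁|`, the reciprocal of the Jacobian.
    rw [abs_shift_of_ne hξ, shift_sq hξ hpos.le, show ξ.1 ^ 2 + c + 2 * t = ξ.1 ^ 2 by linarith,
      Real.sqrt_sq_eq_abs]
    have := Real.sqrt_pos.2 hpos
    have := abs_pos.2 hξ
    field_simp
  · exact (hf.restrict).mul (Measurable.aestronglyMeasurable (by fun_prop))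

/-! ### Slow and fast particles: uniform bounds for shifted profiles. -/

lemma le_rpow_mul_add_rpow_neg {r : ℝ} (hr : 1 < r) (a : ENNReal) {w : ENNReal} (hw : w ≠ 0)
    (hw' : w ≠ ⊤) : a ≤ a ^ r * w + w ^ (-(1 / (r - 1))) := by
  have hp : 0 < r - 1 := by linarith
  -- Either `a` lies below the threshold, or `a ^ (r - 1) * w ≥ 1` and the first term dominates.
  rcases le_total a (w ^ (-(1 / (r - 1)))) with h | h
  · exact h.trans le_add_self
  · have h1 : w⁻¹ ≤ a ^ (r - 1) := by
      have := ENNReal.rpow_le_rpow h hp.le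
      rw [← ENNReal.rpow_mul, show -(1 / (r - 1)) * (r - 1) = -1 by field_simp,
        ENNReal.rpow_neg_one] at this
      exact this
    have h2 : 1 ≤ a ^ (r - 1) * w := by
      calc 1 = w⁻¹ * w := (ENNReal.inv_mul_cancel hw hw').symm
        _ ≤ _ := by gcongr
    have h3 : a ^ r = a * a ^ (r - 1) := by
      conv_rhs => rw [← ENNReal.rpow_one a, ← ENNReal.rpow_mul, one_mul]
      rw [← ENNReal.rpow_add_of_nonneg _ _ zero_le_one hp.le]; congr 1; ring
    calc a = a * 1 := (mul_one a).symm
      _ ≤ a * (a ^ (r - 1) * w) := by gcongr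
      _ = a ^ r * w := by rw [h3, mul_assoc]
      _ ≤ _ := le_self_add

lemma measurableSet_abs_fst_lt (δ : ℝ) : MeasurableSet {ξ : Vel | |ξ.1| < δ} :=
  measurableSet_lt (by fun_prop) measurable_const

/-- Apply `le_rpow_mul_add_rpow_neg` with `w = l * shiftJac c s`. In the first term the Jacobian is
absorbed by the change of variables, leaving `l` times a local `L^r` integral. In the second it is
bounded below by `|s| / (U + 2)`, because `√(s² + c) < U + 2` when `|s| < 1`. -/
lemma lintegral_near_le {F : Vel → ℝ} (hm : Measurable F) {r : ℝ} (hr : 1 < r) {U : ℝ}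
    {δ : ℝ} (hδ : δ ≤ 1) {l : ℝ} (hl : 0 < l) {c : ℝ} (hc : 0 ≤ c) (hcU : c ≤ U) :
    ∫⁻ ξ in {ξ : Vel | |ξ.1| < δ}, ‖F (shiftVel c ξ)‖ₑ ≤
      ENNReal.ofReal l * (∫⁻ s in Ioo (-(U + 2)) (U + 2), (∫⁻ η : ℝ × ℝ, ‖F (s, η)‖ₑ) ^ r)
      + ∫⁻ s in {s : ℝ | |s| < δ}, ENNReal.ofReal (l * |s| / (U + 2)) ^ (-(1 / (r - 1))) := by
  have hU : 0 ≤ U := hc.trans hcU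
  have hp : 0 < r - 1 := by linarith
  set N : ℝ → ENNReal := fun s => ∫⁻ η : ℝ × ℝ, ‖F (s, η)‖ₑ with hN
  have hNm : Measurable N := Measurable.lintegral_prod_right' hm.enorm
  have e : {ξ : Vel | |ξ.1| < δ} = {s : ℝ | |s| < δ} ×ˢ (univ : Set (ℝ × ℝ)) := by
    ext; simp
  have hset : MeasurableSet {s : ℝ | |s| < δ} := measurableSet_lt (by fun_prop) measurable_const
  have h1 : ∫⁻ ξ in {ξ : Vel | |ξ.1| < δ}, ‖F (shiftVel c ξ)‖ₑ
      = ∫⁻ s in {s : ℝ | |s| < δ}, N (shift c s) := by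
    rw [e, Measure.volume_eq_prod, ← Measure.prod_restrict, Measure.restrict_univ,
      lintegral_prod (fun ξ : Vel => ‖F (shiftVel c ξ)‖ₑ)
        (hm.comp (measurable_shiftVel c)).enorm.aemeasurable]
    rfl
  have hne : ∀ᵐ s : ℝ ∂(volume.restrict {s : ℝ | |s| < δ}), s ≠ 0 ∧ |s| < δ :=
    ((ae_restrict_of_ae (by simp [ae_iff] : ∀ᵐ s : ℝ, s ≠ 0)).and (ae_restrict_mem hset))
  have hsq : ∀ s : ℝ, |s| < δ → √(s ^ 2 + c) < U + 2 := by
    intro s hs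
    rw [Real.sqrt_lt' (by linarith)]
    have : s ^ 2 < 1 := by rw [← sq_abs]; nlinarith [abs_nonneg s]
    nlinarith
  have hR : MeasurableSet (Ioo (-(U + 2)) (U + 2)) := measurableSet_Ioo
  rw [h1]
  calc ∫⁻ s in {s : ℝ | |s| < δ}, N (shift c s)
      ≤ ∫⁻ s in {s : ℝ | |s| < δ}, (ENNReal.ofReal l * (ENNReal.ofReal (shiftJac c s) *
          (Ioo (-(U + 2)) (U + 2)).indicator (fun s => N s ^ r) (shift c s))
          + ENNReal.ofReal (l * |s| / (U + 2)) ^ (-(1 / (r - 1)))) := by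
        refine lintegral_mono_ae ?_
        filter_upwards [hne] with s hs
        have hJ := shiftJac_pos hc hs.1
        have hmem : shift c s ∈ Ioo (-(U + 2)) (U + 2) := by
          rw [mem_Ioo, ← abs_lt]
          exact (abs_shift_le c s).trans_lt (hsq s hs.2)
        refine (le_rpow_mul_add_rpow_neg hr (N (shift c s))
          (w := ENNReal.ofReal (l * shiftJac c s)) (by simp; positivity) (by simp)).trans ?_
        refine add_le_add (le_of_eq ?_) ?_
        · rw [indicator_of_mem hmem, ENNReal.ofReal_mul hl.le]; ring
        · rw [ENNReal.rpow_neg, ENNReal.rpow_neg]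
          refine ENNReal.inv_le_inv.2 (ENNReal.rpow_le_rpow ?_ (by positivity))
          refine ENNReal.ofReal_le_ofReal ?_
          rw [mul_div_assoc, shiftJac]
          have hs0 := abs_pos.2 hs.1
          have h3 : 0 < √(s ^ 2 + c) := Real.sqrt_pos.2 (by have := hs.1; positivity)
          gcongr
          exact (hsq s hs.2).le
    _ = (∫⁻ s in {s : ℝ | |s| < δ}, ENNReal.ofReal l * (ENNReal.ofReal (shiftJac c s) *
          (Ioo (-(U + 2)) (U + 2)).indicator (fun s => N s ^ r) (shift c s)))
        + ∫⁻ s in {s : ℝ | |s| < δ}, ENNReal.ofReal (l * |s| / (U + 2)) ^ (-(1 / (r - 1))) := by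
        exact lintegral_add_right _ (by fun_prop)
    _ ≤ _ := by
        gcongr
        refine (setLIntegral_le_lintegral _ _).trans ?_
        rw [lintegral_const_mul']
        · refine mul_le_mul_right ?_ _
          rw [lintegral_shift hc]
          refine (setLIntegral_le_lintegral _ _).trans ?_
          rw [lintegral_indicator hR]
        · simp

/-- This is where `r > 2` is needed: it makes the exponent `-1 / (r - 1)` larger than `-1`, so the
singularity is integrable and absolute continuity of the integral applies. -/
lemma tendsto_lintegral_rpow_near {r : ℝ} (hr : 2 < r) {k : ℝ} (hk : 0 < k) :
    Tendsto (fun δ : ℝ => ∫⁻ s in {s : ℝ | |s| < δ}, ENNReal.ofReal (k * |s|) ^ (-(1 / (r - 1))))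
      (𝓝[>] 0) (𝓝 0) := by
  have hp : 1 < r - 1 := by linarith
  have hq : -1 < -(1 / (r - 1)) := by
    rw [neg_lt_neg_iff, div_lt_one (by linarith)]; exact hp
  set f : ℝ → ENNReal := fun s => ENNReal.ofReal (k * |s|) ^ (-(1 / (r - 1)))
  have h0 : IntegrableOn (fun s : ℝ => s ^ (-(1 / (r - 1)))) (Ioo 0 1) := by
    have := intervalIntegral.intervalIntegrable_rpow' (a := 0) (b := 1) hq
    rw [intervalIntegrable_iff_integrableOn_Ioo_of_le zero_le_one] at this
    exact this
  have hpos : ∀ s : ℝ, 0 < s → f s = ENNReal.ofReal (k ^ (-(1 / (r - 1)))) *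
      ENNReal.ofReal (s ^ (-(1 / (r - 1)))) := by
    intro s hs
    simp only [f]
    rw [abs_of_pos hs, ENNReal.ofReal_rpow_of_pos (by positivity),
      Real.mul_rpow hk.le hs.le, ENNReal.ofReal_mul (by positivity)]
  have hfin1 : ∫⁻ s in Ioo (0 : ℝ) 1, f s ≠ ⊤ := by
    rw [setLIntegral_congr_fun measurableSet_Ioo (fun s hs => hpos s hs.1), lintegral_const_mul']
    · refine ENNReal.mul_ne_top (by simp) ?_
      have := h0.2
      rw [hasFiniteIntegral_iff_ofReal] at this
      · exact this.ne
      · filter_upwards [ae_restrict_mem measurableSet_Ioo] with s hs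
        exact Real.rpow_nonneg hs.1.le _
    · simp
  have hfin2 : ∫⁻ s in Ioo (-1 : ℝ) 0, f s ≠ ⊤ := by
    have := (Measure.measurePreserving_neg (volume : Measure ℝ)).setLIntegral_comp_emb
      (MeasurableEquiv.neg ℝ).measurableEmbedding f (Ioo (0 : ℝ) 1)
    simp only [image_neg_eq_neg, neg_Ioo, neg_zero] at this
    rw [← this]
    have e : ∀ s, f (-s) = f s := fun s => by simp [f]
    simpa only [e] using hfin1
  set μ := (volume : Measure ℝ).restrict (Ioo (-1) 1)
  have hfin : ∫⁻ s in Ioo (-1 : ℝ) 1, f s ≠ ⊤ := by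
    have hsub : Ioo (-1 : ℝ) 1 ⊆ (Ioo (-1 : ℝ) 0 ∪ {0}) ∪ Ioo 0 1 := by
      intro s hs
      rcases lt_trichotomy s 0 with h | h | h
      · exact Or.inl (Or.inl ⟨hs.1, h⟩)
      · exact Or.inl (Or.inr h)
      · exact Or.inr ⟨h, hs.2⟩
    refine ne_top_of_le_ne_top ?_ ((lintegral_mono_set hsub).trans
      ((lintegral_union_le _ _ _).trans (add_le_add_left (lintegral_union_le _ _ _) _)))
    simp [hfin1, hfin2]
  have ht : Tendsto (fun δ : ℝ => ∫⁻ s in {s : ℝ | |s| < δ}, f s ∂μ) (𝓝[>] 0) (𝓝 0) := by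
    refine tendsto_setLIntegral_zero hfin ?_
    have hle : ∀ δ : ℝ, μ {s : ℝ | |s| < δ} ≤ ENNReal.ofReal (2 * δ) := by
      intro δ
      refine (Measure.restrict_apply_le _ _).trans ?_
      have : {s : ℝ | |s| < δ} = Ioo (-δ) δ := by ext; simp [abs_lt]
      rw [this, Real.volume_Ioo]; apply ENNReal.ofReal_le_ofReal; linarith
    refine tendsto_of_tendsto_of_tendsto_of_le_of_le tendsto_const_nhds ?_ (fun _ => zero_le)
      hle
    have : Tendsto (fun δ : ℝ => ENNReal.ofReal (2 * δ)) (𝓝 0) (𝓝 (ENNReal.ofReal (2 * 0))) :=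
      ENNReal.tendsto_ofReal (by fun_prop : Continuous fun δ : ℝ => 2 * δ).continuousAt
    simp only [mul_zero, ENNReal.ofReal_zero] at this
    exact this.mono_left nhdsWithin_le_nhds
  refine ht.congr' ?_
  filter_upwards [Ioo_mem_nhdsGT (zero_lt_one (α := ℝ))] with δ hδ
  have hset : MeasurableSet {s : ℝ | |s| < δ} := measurableSet_lt (by fun_prop) measurable_const
  rw [Measure.restrict_restrict hset, inter_eq_left.2]
  intro s hs
  rw [mem_ofPred_eq, abs_lt] at hs
  exact ⟨by linarith [hδ.2, hs.1], by linarith [hδ.2, hs.2]⟩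

/-- Slow particles contribute little to the density, uniformly in the potential. -/
lemma exists_near_small {F : Vel → ℝ} (hm : Measurable F) {r : ℝ} (hr : 2 < r)
    (hL : ∀ R : ℝ, ∫⁻ s in Ioo (-R) R, (∫⁻ η : ℝ × ℝ, ‖F (s, η)‖ₑ) ^ r ≠ ⊤)
    {U : ℝ} (hU : 0 ≤ U) {ε : ENNReal} (hε : ε ≠ 0) :
    ∃ δ : ℝ, 0 < δ ∧ ∀ c, 0 ≤ c → c ≤ U →
      ∫⁻ ξ in {ξ : Vel | |ξ.1| < δ}, ‖F (shiftVel c ξ)‖ₑ ≤ ε := by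
  set A := ∫⁻ s in Ioo (-(U + 2)) (U + 2), (∫⁻ η : ℝ × ℝ, ‖F (s, η)‖ₑ) ^ r with hA
  have hA' : A ≠ ⊤ := hL _
  have hε2 : ε / 2 ≠ 0 := by simp [hε]
  -- `l` is fixed first, by the `L^r` term; the singular term depends on `l`, and `δ` is chosen
  -- last.
  obtain ⟨l, hl, hlA⟩ : ∃ l : ℝ, 0 < l ∧ ENNReal.ofReal l * A ≤ ε / 2 := by
    have ht : Tendsto (fun l : ℝ => ENNReal.ofReal l * A) (𝓝 0) (𝓝 (ENNReal.ofReal 0 * A)) :=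
      ENNReal.Tendsto.mul_const (ENNReal.tendsto_ofReal tendsto_id) (Or.inr hA')
    simp only [ENNReal.ofReal_zero, zero_mul] at ht
    have := (ht.mono_left (nhdsWithin_le_nhds (s := Ioi 0))).eventually_le_const
      (pos_iff_ne_zero.2 hε2)
    obtain ⟨l, h1, h2⟩ := (this.and self_mem_nhdsWithin).exists
    exact ⟨l, h2, h1⟩
  have ht := tendsto_lintegral_rpow_near hr (k := l / (U + 2)) (by positivity)
  obtain ⟨δ, hδ, hδ'⟩ := ((ht.eventually_le_const (pos_iff_ne_zero.2 hε2)).and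
    (Ioo_mem_nhdsGT (zero_lt_one (α := ℝ)))).exists
  refine ⟨δ, hδ'.1, fun c hc hcU => ?_⟩
  refine (lintegral_near_le hm (by linarith : 1 < r) hδ'.2.le hl hc hcU).trans ?_
  rw [← ENNReal.add_halves ε]
  refine add_le_add hlA (le_trans (le_of_eq ?_) hδ)
  simp only [div_mul_eq_mul_div]

/-- Where `|ξ₁| ≥ δ` the Jacobian is at least `1 / √(1 + U / δ²)`, so inserting it costs only a
constant factor. -/
lemma lintegral_far_le {G : Vel → ENNReal} (hG : Measurable G) {U δ : ℝ} (hδ : 0 < δ)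
    {c : ℝ} (hc : 0 ≤ c) (hcU : c ≤ U) :
    ∫⁻ ξ in {ξ : Vel | |ξ.1| < δ}ᶜ, G (shiftVel c ξ) ≤
      ENNReal.ofReal (√(1 + U / δ ^ 2)) * ∫⁻ ξ, G ξ := by
  have hU : 0 ≤ U := hc.trans hcU
  calc ∫⁻ ξ in {ξ : Vel | |ξ.1| < δ}ᶜ, G (shiftVel c ξ)
      ≤ ∫⁻ ξ in {ξ : Vel | |ξ.1| < δ}ᶜ, ENNReal.ofReal (√(1 + U / δ ^ 2)) *
          (ENNReal.ofReal (shiftJac c ξ.1) * G (shiftVel c ξ)) := by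
        refine setLIntegral_mono' (measurableSet_abs_fst_lt δ).compl fun ξ hξ => ?_
        have hξ' : δ ≤ |ξ.1| := not_lt.1 hξ
        have hpos : 0 < |ξ.1| := hδ.trans_le hξ'
        have h0 : ξ.1 ≠ 0 := abs_pos.1 hpos
        rw [← mul_assoc, ← ENNReal.ofReal_mul (Real.sqrt_nonneg _)]
        refine le_mul_of_one_le_left zero_le ?_
        rw [ENNReal.one_le_ofReal, shiftJac, ← mul_div_assoc, one_le_div (by positivity)]
        rw [← Real.sqrt_sq_eq_abs, ← Real.sqrt_mul (by positivity)]
        refine Real.sqrt_le_sqrt ?_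
        have h1 : δ ^ 2 ≤ ξ.1 ^ 2 := by rw [← sq_abs ξ.1]; gcongr
        have h2 : U ≤ U / δ ^ 2 * ξ.1 ^ 2 := by
          rw [div_mul_eq_mul_div, le_div_iff₀ (by positivity)]; gcongr
        linarith
    _ ≤ ∫⁻ ξ, ENNReal.ofReal (√(1 + U / δ ^ 2)) *
          (ENNReal.ofReal (shiftJac c ξ.1) * G (shiftVel c ξ)) := setLIntegral_le_lintegral _ _
    _ ≤ _ := by
        rw [lintegral_const_mul' _ _ (by simp), lintegral_shiftVel hc hG]
        exact mul_le_mul_right (setLIntegral_le_lintegral _ _) _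

lemma exists_lintegral_shiftVel_le {F : Vel → ℝ} (hm : Measurable F) (hi : Integrable F)
    {r : ℝ} (hr : 2 < r)
    (hL : ∀ R : ℝ, ∫⁻ s in Ioo (-R) R, (∫⁻ η : ℝ × ℝ, ‖F (s, η)‖ₑ) ^ r ≠ ⊤)
    {U : ℝ} (hU : 0 ≤ U) :
    ∃ C : ENNReal, C ≠ ⊤ ∧ ∀ c, 0 ≤ c → c ≤ U → ∫⁻ ξ, ‖F (shiftVel c ξ)‖ₑ ≤ C := by
  obtain ⟨δ, hδ, h⟩ := exists_near_small hm hr hL hU (ε := 1) one_ne_zero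
  refine ⟨1 + ENNReal.ofReal (√(1 + U / δ ^ 2)) * ∫⁻ ξ, ‖F ξ‖ₑ, ?_, fun c hc hcU => ?_⟩
  · have := hi.2.ne
    exact ENNReal.add_ne_top.2 ⟨by simp, ENNReal.mul_ne_top (by simp) this⟩
  · rw [← lintegral_add_compl _ (measurableSet_abs_fst_lt δ)]
    exact add_le_add (h c hc hcU) (lintegral_far_le hm.enorm hδ hc hcU)

lemma integrable_comp_shiftVel {F : Vel → ℝ} (hm : Measurable F) (hi : Integrable F)
    {r : ℝ} (hr : 2 < r)
    (hL : ∀ R : ℝ, ∫⁻ s in Ioo (-R) R, (∫⁻ η : ℝ × ℝ, ‖F (s, η)‖ₑ) ^ r ≠ ⊤)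
    {c : ℝ} (hc : 0 ≤ c) : Integrable (fun ξ => F (shiftVel c ξ)) := by
  obtain ⟨C, hC, h⟩ := exists_lintegral_shiftVel_le hm hi hr hL hc
  exact ⟨(hm.comp (measurable_shiftVel c)).aestronglyMeasurable,
    (h c hc le_rfl).trans_lt (lt_top_iff_ne_top.2 hC)⟩

/-! ### Continuity of the shifts in `L¹`. -/

lemma continuous_shift_left (s : ℝ) : Continuous fun c => shift c s := by
  unfold shift; fun_prop

/-- For `c ≥ 0` the shift never decreases the speed, so up to null sets all the functions `h ∘
shiftVel c` live in one ball, and dominated convergence applies. -/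
lemma tendsto_lintegral_comp_shiftVel_of_continuous {h : Vel → ℝ} (hh : Continuous h)
    (hs : HasCompactSupport h) {c₀ : ℝ} (hc₀ : 0 ≤ c₀) :
    Tendsto (fun c => ∫⁻ ξ, ‖h (shiftVel c ξ) - h (shiftVel c₀ ξ)‖ₑ) (𝓝[Ici 0] c₀) (𝓝 0) := by
  obtain ⟨C, hC⟩ := hh.bounded_above_of_compact_support hs
  obtain ⟨R, hR⟩ := hs.isCompact.isBounded.subset_closedBall 0
  have hzero : ∀ c, 0 ≤ c → ∀ ξ : Vel, ξ.1 ≠ 0 → ξ ∉ Metric.closedBall (0 : Vel) R →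
      h (shiftVel c ξ) = 0 := by
    intro c hc ξ hξ hξR
    by_contra hne
    have := hR (subset_tsupport h hne)
    rw [mem_closedBall_zero_iff, Prod.norm_def, sup_le_iff] at this hξR
    apply hξR
    refine ⟨?_, this.2⟩
    refine le_trans ?_ this.1
    simp only [shiftVel, Real.norm_eq_abs]
    rw [abs_shift_of_ne hξ, ← Real.sqrt_sq_eq_abs]
    exact Real.sqrt_le_sqrt (by linarith)
  have h0 : (0 : ENNReal) = ∫⁻ ξ : Vel, 0 := by simp
  rw [h0]
  refine tendsto_lintegral_filter_of_dominated_convergence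
    ((Metric.closedBall (0 : Vel) R).indicator fun _ => ENNReal.ofReal (2 * C)) ?_ ?_ ?_ ?_
  · refine Eventually.of_forall fun c => ?_
    exact ((hh.measurable.comp (measurable_shiftVel c)).sub
      (hh.measurable.comp (measurable_shiftVel c₀))).enorm
  · filter_upwards [self_mem_nhdsWithin] with c hc
    filter_upwards [ae_fst_ne_zero] with ξ hξ
    by_cases hmem : ξ ∈ Metric.closedBall (0 : Vel) R
    · rw [indicator_of_mem hmem, ← ofReal_norm]
      refine ENNReal.ofReal_le_ofReal ((norm_sub_le _ _).trans ?_)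
      linarith [hC (shiftVel c ξ), hC (shiftVel c₀ ξ)]
    · simp [hzero c hc ξ hξ hmem, hzero c₀ hc₀ ξ hξ hmem]
  · rw [lintegral_indicator Metric.isClosed_closedBall.measurableSet, setLIntegral_const]
    exact ENNReal.mul_ne_top ENNReal.ofReal_ne_top (isCompact_closedBall _ _).measure_ne_top
  · refine Eventually.of_forall fun ξ => ?_
    have : Continuous fun c => ‖h (shiftVel c ξ) - h (shiftVel c₀ ξ)‖ₑ := by
      have := continuous_shift_left ξ.1
      unfold shiftVel
      fun_prop
    have := this.tendsto c₀
    simp only [sub_self, enorm_zero] at this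
    exact this.mono_left nhdsWithin_le_nhds

/-- Strong continuity in `L¹` of the family of shifts. -/
lemma tendsto_lintegral_comp_shiftVel {F : Vel → ℝ} (hm : Measurable F) (hi : Integrable F)
    {r : ℝ} (hr : 2 < r)
    (hL : ∀ R : ℝ, ∫⁻ s in Ioo (-R) R, (∫⁻ η : ℝ × ℝ, ‖F (s, η)‖ₑ) ^ r ≠ ⊤)
    {c₀ : ℝ} (hc₀ : 0 ≤ c₀) :
    Tendsto (fun c => ∫⁻ ξ, ‖F (shiftVel c ξ) - F (shiftVel c₀ ξ)‖ₑ) (𝓝[Ici 0] c₀) (𝓝 0) := by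
  rw [ENNReal.tendsto_nhds_zero]
  intro ε hε
  -- Five errors: two for slow velocities, three for fast ones, where `F` is replaced by a
  -- continuous `h` at both ends.
  have h5 : ε / 5 ≠ 0 := by simp [hε.ne']
  have hU : 0 ≤ c₀ + 1 := by linarith
  obtain ⟨δ, hδ, hnear⟩ := exists_near_small hm hr hL hU h5
  set M := √(1 + (c₀ + 1) / δ ^ 2) with hM
  have hMpos : 0 < M := Real.sqrt_pos.2 (by positivity)
  obtain ⟨e, he, heM⟩ : ∃ e : ℝ, 0 < e ∧ ENNReal.ofReal M * ENNReal.ofReal e ≤ ε / 5 := by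
    rcases eq_or_ne (ε / 5) ⊤ with h | h
    · exact ⟨1, one_pos, by simp [h]⟩
    · refine ⟨(ε / 5).toReal / M, div_pos (ENNReal.toReal_pos h5 h) hMpos, ?_⟩
      rw [← ENNReal.ofReal_mul hMpos.le, mul_div_cancel₀ _ hMpos.ne', ENNReal.ofReal_toReal h]
  obtain ⟨h, hhs, hhF, hhc, hhi⟩ := hi.exists_hasCompactSupport_integral_sub_le he
  have hFh : ∫⁻ ξ, ‖F ξ - h ξ‖ₑ ≤ ENNReal.ofReal e := by
    exact (ofReal_integral_norm_eq_lintegral_enorm (hi.sub hhi)).symm.trans_le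
      (ENNReal.ofReal_le_ofReal hhF)
  have hhm : Measurable h := hhc.measurable
  have hfar : ∀ c, 0 ≤ c → c ≤ c₀ + 1 →
      ∫⁻ ξ in {ξ : Vel | |ξ.1| < δ}ᶜ, ‖F (shiftVel c ξ) - h (shiftVel c ξ)‖ₑ ≤ ε / 5 := by
    intro c hc hc1
    refine (lintegral_far_le (G := fun ξ => ‖F ξ - h ξ‖ₑ) (hm.sub hhm).enorm hδ hc hc1).trans ?_
    exact le_trans (by gcongr) heM
  filter_upwards [self_mem_nhdsWithin,
    mem_nhdsWithin_of_mem_nhds (Iic_mem_nhds (by linarith : c₀ < c₀ + 1)),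
    (ENNReal.tendsto_nhds_zero.1 (tendsto_lintegral_comp_shiftVel_of_continuous hhc hhs hc₀))
      (ε / 5) (pos_iff_ne_zero.2 h5)] with c hc hc1 hcc
  have hmT : ∀ c, Measurable fun ξ => F (shiftVel c ξ) := fun c => hm.comp (measurable_shiftVel c)
  have hhT : ∀ c, Measurable fun ξ => h (shiftVel c ξ) := fun c => hhm.comp (measurable_shiftVel c)
  rw [← lintegral_add_compl _ (measurableSet_abs_fst_lt δ)]
  have key1 : ∫⁻ ξ in {ξ : Vel | |ξ.1| < δ}, ‖F (shiftVel c ξ) - F (shiftVel c₀ ξ)‖ₑ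
      ≤ ε / 5 + ε / 5 := by
    calc _ ≤ ∫⁻ ξ in {ξ : Vel | |ξ.1| < δ}, (‖F (shiftVel c ξ)‖ₑ + ‖F (shiftVel c₀ ξ)‖ₑ) :=
          lintegral_mono fun ξ => enorm_sub_le
      _ = _ := lintegral_add_left (hmT c).enorm _
      _ ≤ _ := add_le_add (hnear c hc hc1) (hnear c₀ hc₀ (by linarith))
  have key2 : ∫⁻ ξ in {ξ : Vel | |ξ.1| < δ}ᶜ, ‖F (shiftVel c ξ) - F (shiftVel c₀ ξ)‖ₑ
      ≤ ε / 5 + ε / 5 + ε / 5 := by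
    calc _ ≤ ∫⁻ ξ in {ξ : Vel | |ξ.1| < δ}ᶜ, (‖F (shiftVel c ξ) - h (shiftVel c ξ)‖ₑ
            + ‖h (shiftVel c ξ) - h (shiftVel c₀ ξ)‖ₑ
            + ‖F (shiftVel c₀ ξ) - h (shiftVel c₀ ξ)‖ₑ) := by
          refine lintegral_mono fun ξ => ?_
          simp only [← edist_eq_enorm_sub]
          refine (edist_triangle _ (h (shiftVel c₀ ξ)) _).trans ?_
          rw [edist_comm (h (shiftVel c₀ ξ)) (F (shiftVel c₀ ξ))]
          gcongr
          exact edist_triangle _ _ _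
      _ = (∫⁻ ξ in {ξ : Vel | |ξ.1| < δ}ᶜ, ‖F (shiftVel c ξ) - h (shiftVel c ξ)‖ₑ)
            + (∫⁻ ξ in {ξ : Vel | |ξ.1| < δ}ᶜ, ‖h (shiftVel c ξ) - h (shiftVel c₀ ξ)‖ₑ)
            + ∫⁻ ξ in {ξ : Vel | |ξ.1| < δ}ᶜ, ‖F (shiftVel c₀ ξ) - h (shiftVel c₀ ξ)‖ₑ := by
          have m1 := ((hmT c).sub (hhT c)).enorm
          have m2 := ((hhT c).sub (hhT c₀)).enorm
          exact (lintegral_add_left (m1.add m2) _).trans (congrArg (· + _) (lintegral_add_left m1 _))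
      _ ≤ _ := by
          refine add_le_add (add_le_add (hfar c hc hc1) ?_) (hfar c₀ hc₀ (by linarith))
          exact (setLIntegral_le_lintegral _ _).trans hcc
  refine (add_le_add key1 key2).trans (le_of_eq ?_)
  have : ε / 5 + ε / 5 + (ε / 5 + ε / 5 + ε / 5) = ε / 5 * 5 := by ring
  rw [this, ENNReal.div_mul_cancel (by simp) (by simp)]

/-! ### Profiles at infinity, the density `ρ_i⁻` and the function `V⁻`. -/

/-- A nonnegative, everywhere measurable distribution in `L¹(ℝ³) ∩ L^r_loc(ℝ; L¹(ℝ²))`. -/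
structure IsProfile (r : ℝ) (F : Vel → ℝ) : Prop where
  measurable : Measurable F
  nonneg : ∀ ξ, 0 ≤ F ξ
  integrable : Integrable F
  two_lt : 2 < r
  locBound : ∀ R : ℝ, ∫⁻ s in Ioo (-R) R, (∫⁻ η : ℝ × ℝ, ‖F (s, η)‖ₑ) ^ r ≠ ⊤

/-- An everywhere measurable and nonnegative representative makes compositions with the shift, also
jointly in `(x, ξ)`, measurable without further argument. -/
lemma exists_isProfile_ae_eq {r : ℝ} (hr : 2 < r) {finf : Vel → ℝ} (hf : Integrable finf)
    (hf0 : ∀ᵐ ξ : Vel, 0 ≤ finf ξ) (hLr : LrLoc r finf) :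
    ∃ F, IsProfile r F ∧ F =ᵐ[volume] finf := by
  set F : Vel → ℝ := fun ξ => |hf.1.mk finf ξ| with hF
  have hFf : F =ᵐ[volume] finf := by
    filter_upwards [hf.1.ae_eq_mk, hf0] with ξ h1 h2
    rw [hF, ← abs_of_nonneg h2, h1]
  refine ⟨F, ⟨?_, fun ξ => abs_nonneg _, hf.congr hFf.symm, hr, fun R => ?_⟩, hFf⟩
  · exact hf.1.stronglyMeasurable_mk.measurable.abs
  · rcases le_or_gt R 0 with hR | hR
    · rw [Ioo_eq_empty (by linarith)]; simp
    · have h1 : ∀ᵐ s : ℝ, ∀ᵐ η : ℝ × ℝ, F (s, η) = finf (s, η) :=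
        Measure.ae_ae_of_ae_prod hFf
      have h2 : ∫⁻ s in Ioo (-R) R, (∫⁻ η : ℝ × ℝ, ‖F (s, η)‖ₑ) ^ r
          = ∫⁻ s in Ioo (-R) R, (∫⁻ η : ℝ × ℝ, ‖finf (s, η)‖ₑ) ^ r := by
        refine lintegral_congr_ae (ae_restrict_of_ae ?_)
        filter_upwards [h1] with s hs
        congr 1
        refine lintegral_congr_ae ?_
        filter_upwards [hs] with η h
        rw [h]
      rw [h2]
      exact (hLr.2 (-R) R (by linarith)).ne

namespace IsProfile

variable {r : ℝ} {F : Vel → ℝ}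

lemma integrable_comp (hF : IsProfile r F) {c : ℝ} (hc : 0 ≤ c) :
    Integrable fun ξ => F (shiftVel c ξ) :=
  integrable_comp_shiftVel hF.measurable hF.integrable hF.two_lt hF.locBound hc

lemma tendsto_integral_abs (hF : IsProfile r F) {c₀ : ℝ} (hc₀ : 0 ≤ c₀) :
    Tendsto (fun c => ∫ ξ, |F (shiftVel c ξ) - F (shiftVel c₀ ξ)|) (𝓝[Ici 0] c₀) (𝓝 0) := by
  have h := tendsto_lintegral_comp_shiftVel hF.measurable hF.integrable hF.two_lt hF.locBound hc₀
  have h2 := (ENNReal.tendsto_toReal ENNReal.zero_ne_top).comp h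
  rw [ENNReal.toReal_zero] at h2
  refine h2.congr' ?_
  filter_upwards [self_mem_nhdsWithin] with c hc
  exact (integral_norm_eq_lintegral_enorm
    ((hF.integrable_comp hc).sub (hF.integrable_comp hc₀)).1).symm

lemma rhoMinus_eq (hF : IsProfile r F) {t : ℝ} (ht : t ≤ 0) :
    rhoMinus F t = ∫ ξ, F (shiftVel (-2 * t) ξ) :=
  Sheath.rhoMinus_eq hF.integrable.1 ht

lemma rhoMinus_zero (hF : IsProfile r F) : rhoMinus F 0 = ∫ ξ, F ξ := by
  rw [hF.rhoMinus_eq le_rfl]; simp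

lemma continuousOn_rhoMinus (hF : IsProfile r F) : ContinuousOn (rhoMinus F) (Iic 0) := by
  intro t₀ ht₀
  have ht₀' : t₀ ≤ 0 := ht₀
  have hmap : Tendsto (fun t : ℝ => -2 * t) (𝓝[Iic 0] t₀) (𝓝[Ici 0] (-2 * t₀)) := by
    refine tendsto_nhdsWithin_iff.2 ⟨?_, ?_⟩
    · exact ((by fun_prop : Continuous fun t : ℝ => -2 * t).tendsto t₀).mono_left
        nhdsWithin_le_nhds
    · filter_upwards [self_mem_nhdsWithin] with t ht
      have : t ≤ 0 := ht
      show (0 : ℝ) ≤ -2 * t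
      linarith
  have h := (hF.tendsto_integral_abs (by linarith : 0 ≤ -2 * t₀)).comp hmap
  rw [ContinuousWithinAt, tendsto_iff_norm_sub_tendsto_zero]
  refine squeeze_zero' (Eventually.of_forall fun _ => norm_nonneg _) ?_ h
  filter_upwards [self_mem_nhdsWithin] with t ht
  have ht' : t ≤ 0 := ht
  rw [hF.rhoMinus_eq ht', hF.rhoMinus_eq ht₀', ← integral_sub
    (hF.integrable_comp (by linarith)) (hF.integrable_comp (by linarith))]
  exact norm_integral_le_integral_norm _

end IsProfile

lemma VMinus_zero (ne : ℝ → ℝ) (F : Vel → ℝ) : VMinus ne F 0 = 0 := by simp [VMinus]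

lemma hasDerivWithinAt_VMinus {r : ℝ} {F : Vel → ℝ} (hF : IsProfile r F) {ne : ℝ → ℝ}
    (hne : Continuous ne) {t : ℝ} (ht : t ≤ 0) :
    HasDerivWithinAt (VMinus ne F) (rhoMinus F t - ne t) (Iic 0) t := by
  -- Freezing the integrand beyond `0` makes it continuous on the whole line, so the two-sided
  -- fundamental theorem of calculus also covers the endpoint `t = 0`.
  set g : ℝ → ℝ := fun s => rhoMinus F (min s 0) - ne (min s 0) with hg
  have hgc : Continuous g := by
    refine Continuous.sub ?_ (by fun_prop)
    exact hF.continuousOn_rhoMinus.comp_continuous (by fun_prop) fun s =>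
      mem_Iic.2 (min_le_right _ _)
  have h1 : HasDerivAt (fun u => ∫ s in (0 : ℝ)..u, g s) (g t) t :=
    intervalIntegral.integral_hasDerivAt_right (hgc.intervalIntegrable _ _)
      hgc.aestronglyMeasurable.stronglyMeasurableAtFilter hgc.continuousAt
  have hgt : g t = rhoMinus F t - ne t := by simp [hg, min_eq_left ht]
  rw [hgt] at h1
  have heq : ∀ u ≤ (0 : ℝ), VMinus ne F u = ∫ s in (0 : ℝ)..u, g s := by
    intro u hu
    refine intervalIntegral.integral_congr fun s hs => ?_
    rw [uIcc_of_ge hu] at hs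
    simp [hg, min_eq_left hs.2]
  exact h1.hasDerivWithinAt.congr (fun u hu => heq u hu) (heq t ht)

lemma continuousOn_VMinus {r : ℝ} {F : Vel → ℝ} (hF : IsProfile r F) {ne : ℝ → ℝ}
    (hne : Continuous ne) : ContinuousOn (VMinus ne F) (Iic 0) :=
  fun _ ht => (hasDerivWithinAt_VMinus hF hne ht).continuousWithinAt

/-- The defining condition passes from `b` to every larger negative number, and by continuity of
`V⁻` to slightly smaller ones; hence the infimum is never attained. -/
lemma infB_lt_iff {r : ℝ} {F : Vel → ℝ} (hF : IsProfile r F) {ne : ℝ → ℝ}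
    (hne : Continuous ne) {b : ℝ} (hb : b < 0) :
    infB ne F < (b : EReal) ↔ b ∈ BMinus ne F := by
  rw [infB, sInf_lt_iff]
  constructor
  · rintro ⟨_, ⟨a, ha, rfl⟩, hab⟩
    have hab' : a < b := EReal.coe_lt_coe_iff.1 hab
    exact ⟨hb, fun t ht => ha.2 t ⟨hab'.le.trans ht.1, ht.2⟩⟩
  · intro h
    have hc : ContinuousAt (VMinus ne F) b :=
      (continuousOn_VMinus hF hne).continuousAt (Iic_mem_nhds hb)
    have hpos : 0 < VMinus ne F b := h.2 b ⟨le_rfl, hb⟩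
    obtain ⟨ε, hε, hball⟩ := Metric.eventually_nhds_iff.1 (hc.eventually_const_lt hpos)
    refine ⟨_, ⟨b - ε / 2, ⟨by linarith, fun t ht => ?_⟩, rfl⟩, ?_⟩
    · rcases le_or_gt b t with hbt | hbt
      · exact h.2 t ⟨hbt, ht.2⟩
      · refine hball ?_
        rw [Real.dist_eq, abs_lt]
        constructor <;> linarith [ht.1]
    · exact EReal.coe_lt_coe_iff.2 (by linarith : b - ε / 2 < b)

/-- A function whose first derivative vanishes at `0` and whose one-sided second derivative there
is positive grows at least quadratically. -/
lemma exists_quadratic_le {V g : ℝ → ℝ} {b d : ℝ} (hb : b < 0) (hd : 0 < d) (hV0 : V 0 = 0)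
    (hV : ∀ t ≤ 0, HasDerivWithinAt V (g t) (Iic 0) t) (hg0 : g 0 = 0)
    (hg : HasDerivWithinAt g d (Icc b 0) 0) :
    ∃ ε, 0 < ε ∧ ε ≤ -b ∧ ∀ t ∈ Icc (-ε) 0, d / 4 * t ^ 2 ≤ V t := by
  have h1 := (hasDerivWithinAt_iff_isLittleO.1 hg).bound (half_pos hd)
  rw [eventually_nhdsWithin_iff, Metric.eventually_nhds_iff] at h1
  obtain ⟨ε₀, hε₀, h1⟩ := h1
  refine ⟨min (ε₀ / 2) (-b), lt_min (half_pos hε₀) (neg_pos.2 hb), min_le_right _ _, ?_⟩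
  set ε := min (ε₀ / 2) (-b) with hε
  have hε1 : ε ≤ ε₀ / 2 := min_le_left _ _
  have hε2 : ε ≤ -b := min_le_right _ _
  have hεp : 0 < ε := lt_min (half_pos hε₀) (neg_pos.2 hb)
  have hgle : ∀ t ∈ Icc (-ε) 0, g t ≤ d / 2 * t := by
    intro t ht
    have := h1 (y := t) (by rw [Real.dist_eq, abs_lt]; constructor <;> linarith [ht.1, ht.2])
      ⟨by linarith [ht.1], ht.2⟩
    simp only [hg0, sub_zero, smul_eq_mul, Real.norm_eq_abs] at this
    rw [abs_of_nonpos ht.2] at this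
    have := (abs_le.1 this).2
    linarith
  -- The bound `g t ≤ (d / 2) t` makes `V - (d / 4) t²` nonincreasing towards its value `0` at `t =
  -- 0`.
  have hanti : AntitoneOn (fun t => V t - d / 4 * t ^ 2) (Icc (-ε) 0) := by
    have hder : ∀ t ∈ Iic (0 : ℝ), HasDerivWithinAt (fun t => V t - d / 4 * t ^ 2)
        (g t - d / 2 * t) (Iic 0) t := by
      intro t ht
      have := (hV t ht).sub (((hasDerivAt_pow 2 t).const_mul (d / 4)).hasDerivWithinAt)
      refine this.congr_deriv ?_
      simp; ring
    refine antitoneOn_of_deriv_nonpos (convex_Icc _ _)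
      (fun t ht => ((hder t ht.2).continuousWithinAt).mono Icc_subset_Iic_self) ?_ ?_
    · intro t ht
      rw [interior_Icc] at ht
      exact ((hder t ht.2.le).hasDerivAt (Iic_mem_nhds ht.2)).differentiableAt.differentiableWithinAt
    · intro t ht
      rw [interior_Icc] at ht
      rw [((hder t ht.2.le).hasDerivAt (Iic_mem_nhds ht.2)).deriv]
      linarith [hgle t ⟨ht.1.le, ht.2.le⟩]
  intro t ht
  have := hanti ht ⟨by linarith, le_rfl⟩ ht.2
  simp only [hV0] at this
  linarith

section Regularity

variable {r : ℝ} {F : Vel → ℝ} {ne : ℝ → ℝ} {b : ℝ}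

lemma contDiffOn_rhoMinus_sub (hF : IsProfile r F) (hne : Continuous ne) (hb : b < 0)
    (hV : ContDiffOn ℝ 2 (VMinus ne F) (Icc b 0)) :
    ContDiffOn ℝ 1 (fun t => rhoMinus F t - ne t) (Icc b 0) := by
  have hu := uniqueDiffOn_Icc hb
  have h := hV.derivWithin (m := 1) hu (by norm_num)
  refine h.congr fun t ht => ?_
  exact (((hasDerivWithinAt_VMinus hF hne ht.2).mono Icc_subset_Iic_self).derivWithin
    (hu t ht)).symm

lemma hasDerivWithinAt_rhoMinus_sub (hF : IsProfile r F) (hne : Continuous ne) (hb : b < 0)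
    (hV : ContDiffOn ℝ 2 (VMinus ne F) (Icc b 0)) :
    HasDerivWithinAt (fun t => rhoMinus F t - ne t) (d2VMinus ne F b) (Icc b 0) 0 := by
  have hu := uniqueDiffOn_Icc hb
  have h0 : (0 : ℝ) ∈ Icc b 0 := ⟨hb.le, le_rfl⟩
  have h := ((contDiffOn_rhoMinus_sub hF hne hb hV).differentiableOn (by norm_num) 0
    h0).hasDerivWithinAt
  suffices e : d2VMinus ne F b = derivWithin (fun t => rhoMinus F t - ne t) (Icc b 0) 0 by
    rwa [e]
  rw [d2VMinus, show (2 : ℕ) = 1 + 1 from rfl, iteratedDerivWithin_succ]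
  refine derivWithin_congr (fun t ht => ?_) ?_
  · rw [iteratedDerivWithin_one]
    exact ((hasDerivWithinAt_VMinus hF hne ht.2).mono Icc_subset_Iic_self).derivWithin (hu t ht)
  · rw [iteratedDerivWithin_one]
    exact ((hasDerivWithinAt_VMinus hF hne le_rfl).mono Icc_subset_Iic_self).derivWithin (hu 0 h0)

lemma exists_abs_rhoMinus_sub_le (hF : IsProfile r F) (hne : Continuous ne) (hb : b < 0)
    (hV : ContDiffOn ℝ 2 (VMinus ne F) (Icc b 0)) (h0 : rhoMinus F 0 - ne 0 = 0) :
    ∃ C, 0 < C ∧ ∀ t ∈ Icc b 0, |rhoMinus F t - ne t| ≤ C * |t| := by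
  obtain ⟨K, hK⟩ := (contDiffOn_rhoMinus_sub hF hne hb hV).exists_lipschitzOnWith
    one_ne_zero (convex_Icc b 0) isCompact_Icc
  refine ⟨K + 1, by positivity, fun t ht => ?_⟩
  have := hK.dist_le_mul t ht 0 ⟨hb.le, le_rfl⟩
  simp only [h0, dist_zero_right, Real.norm_eq_abs] at this
  nlinarith [abs_nonneg t]

end Regularity

lemma abs_le_mul_sq {V g : ℝ → ℝ} {b C : ℝ} (hC : 0 < C) (hV0 : V 0 = 0)
    (hV : ∀ t ≤ 0, HasDerivWithinAt V (g t) (Iic 0) t) (hg : ∀ t ∈ Icc b 0, |g t| ≤ C * |t|)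
    {t : ℝ} (ht : t ∈ Icc b 0) : |V t| ≤ C * t ^ 2 := by
  have h := (convex_Icc t 0).norm_image_sub_le_of_norm_hasDerivWithin_le (f := V) (f' := g)
    (C := C * |t|) (fun s hs => (hV s hs.2).mono Icc_subset_Iic_self)
    (fun s hs => (hg s ⟨ht.1.trans hs.1, hs.2⟩).trans (by
      rw [abs_of_nonpos hs.2, abs_of_nonpos ht.2]
      have := hs.1
      gcongr)) (right_mem_Icc.2 ht.2) (left_mem_Icc.2 ht.2)
  simp only [hV0, sub_zero, Real.norm_eq_abs] at h
  rwa [mul_assoc, ← sq, sq_abs] at h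

/-! ### Weak transport: test functions constant along characteristics. -/

/-- A continuous function on a half line which is orthogonal to all derivatives of test functions
is constant. -/
lemma eq_of_integral_deriv_mul_eq_zero {G : ℝ → ℝ} {x₀ : ℝ} (hG : ContinuousOn G (Ici x₀))
    (h : ∀ θ : ℝ → ℝ, ContDiff ℝ 1 θ → HasCompactSupport θ → tsupport θ ⊆ Ioi x₀ →
      ∫ x in Ioi x₀, deriv θ x * G x = 0) :
    ∃ m, ∀ x ∈ Ioi x₀, G x = m := by
  -- A continuous compactly supported function of mean zero is the derivative of an admissible test
  -- function, namely its primitive.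
  have key : ∀ e : ℝ → ℝ, Continuous e → HasCompactSupport e → tsupport e ⊆ Ioi x₀ →
      ∫ x, e x = 0 → ∫ x in Ioi x₀, e x * G x = 0 := by
    intro e he hes hex h0
    rcases (tsupport e).eq_empty_or_nonempty with hemp | hnon
    · have : e = 0 := by rwa [tsupport_eq_empty_iff] at hemp
      simp [this]
    obtain ⟨a, ha, hmin⟩ := hes.isCompact.exists_isMinOn hnon continuousOn_id
    obtain ⟨b, hb, hmax⟩ := hes.isCompact.exists_isMaxOn hnon continuousOn_id
    have hsub : tsupport e ⊆ Icc a b := fun x hx => ⟨hmin hx, hmax hx⟩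
    have hax : x₀ < a := hex ha
    have hz : ∀ x, x ∉ Icc a b → e x = 0 := fun x hx =>
      image_eq_zero_of_notMem_tsupport fun hx' => hx (hsub hx')
    set θ : ℝ → ℝ := fun x => ∫ t in x₀..x, e t with hθ
    have hd : ∀ x, HasDerivAt θ (e x) x := fun x =>
      intervalIntegral.integral_hasDerivAt_right (he.intervalIntegrable _ _)
        he.aestronglyMeasurable.stronglyMeasurableAtFilter he.continuousAt
    have hderiv : deriv θ = e := funext fun x => (hd x).deriv
    have hlow : ∀ x < a, θ x = 0 := by
      intro x hx
      rw [hθ]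
      refine intervalIntegral.integral_zero_ae (Eventually.of_forall fun t ht => hz t fun ht' => ?_)
      have := (mem_uIoc.1 ht)
      rcases this with h1 | h1 <;> linarith [h1.1, h1.2, ht'.1]
    have hhigh : ∀ x, b < x → θ x = 0 := by
      intro x hx
      have hab : a ≤ b := hmin hb
      rw [hθ, ← h0]
      refine intervalIntegral.integral_eq_integral_of_support_subset ?_
      intro t ht
      have := hsub (subset_tsupport e ht)
      exact ⟨hax.trans_le this.1, this.2.trans hx.le⟩
    have hts : tsupport θ ⊆ Icc a b := by
      refine closure_minimal ?_ isClosed_Icc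
      intro x hx
      by_contra hx'
      rcases not_and_or.1 hx' with h1 | h1
      · exact hx (hlow x (not_le.1 h1))
      · exact hx (hhigh x (not_le.1 h1))
    have := h θ ?_ ?_ ?_
    · rwa [hderiv] at this
    · rw [contDiff_one_iff_deriv]
      exact ⟨fun x => (hd x).differentiableAt, by rwa [hderiv]⟩
    · exact HasCompactSupport.of_support_subset_isCompact isCompact_Icc
        ((subset_tsupport θ).trans hts)
    · exact hts.trans fun x hx => hax.trans_le hx.1
  -- Centre and outer radius keep the support inside `[x₀ + 1, x₀ + 3]`, away from `x₀`.
  let B : ContDiffBump (x₀ + 2) := ⟨1 / 2, 1, by norm_num, by norm_num⟩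
  set η : ℝ → ℝ := B.normed volume with hη
  have hη1 : ∫ x, η x = 1 := B.integral_normed
  have hηc : Continuous η := B.continuous_normed
  have hηs : HasCompactSupport η := B.hasCompactSupport_normed
  have hηx : tsupport η ⊆ Ioi x₀ := by
    rw [hη, ContDiffBump.tsupport_normed_eq]
    intro x hx
    have hx' : dist x (x₀ + 2) ≤ 1 := hx
    rw [Real.dist_eq, abs_le] at hx'
    have : x₀ < x := by linarith [hx'.1]
    exact this
  have hint : ∀ e : ℝ → ℝ, Continuous e → HasCompactSupport e → tsupport e ⊆ Ioi x₀ →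
      IntegrableOn (fun x => e x * G x) (Ioi x₀) := by
    intro e he hes hex
    have h1 : IntegrableOn (fun x => e x * G x) (tsupport e) :=
      ContinuousOn.integrableOn_compact hes.isCompact
        (he.continuousOn.mul (hG.mono (hex.trans Ioi_subset_Ici_self)))
    have h2 : Integrable (fun x => e x * G x) := by
      rwa [integrableOn_iff_integrable_of_support_subset] at h1
      intro x hx
      exact subset_tsupport e (left_ne_zero_of_mul hx)
    exact h2.integrableOn
  set m := ∫ x in Ioi x₀, η x * G x with hm
  refine ⟨m, ?_⟩
  have hGm : ContinuousOn (fun x => G x - m) (Ioi x₀) :=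
    (hG.mono Ioi_subset_Ici_self).sub continuousOn_const
  have hae : ∀ᵐ x, x ∈ Ioi x₀ → G x - m = 0 := by
    refine isOpen_Ioi.ae_eq_zero_of_integral_contDiff_smul_eq_zero
      (hGm.locallyIntegrableOn measurableSet_Ioi) ?_
    intro g hg hgs hgx
    have hgc := hg.continuous
    have hI : ∀ e : ℝ → ℝ, tsupport e ⊆ Ioi x₀ → ∫ x in Ioi x₀, e x = ∫ x, e x := by
      intro e hex
      exact setIntegral_eq_integral_of_forall_compl_eq_zero fun x hx =>
        image_eq_zero_of_notMem_tsupport fun hx' => hx (hex hx')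
    have hei : ∀ e : ℝ → ℝ, Continuous e → HasCompactSupport e → Integrable e :=
      fun e he hes => he.integrable_of_hasCompactSupport hes
    -- Subtracting the right multiple of `η` brings the mean of `g` to zero.
    have hk := key (fun x => g x - (∫ t, g t) * η x) (by fun_prop)
      (hgs.sub (hηs.mul_left)) ?_ ?_
    · have e1 : ∫ x, g x • (G x - m) = ∫ x in Ioi x₀, (g x * G x - m * g x) := by
        rw [← hI]
        · refine integral_congr_ae (Eventually.of_forall fun x => ?_)
          simp only [smul_eq_mul]; ring
        · exact (tsupport_smul_subset_left g _).trans hgx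
      rw [e1, integral_sub (hint g hgc hgs hgx) ((hei g hgc hgs).integrableOn.const_mul m),
        integral_const_mul, hI g hgx]
      have e2 : ∫ x in Ioi x₀, (g x - (∫ t, g t) * η x) * G x
          = (∫ x in Ioi x₀, g x * G x) - (∫ t, g t) * m := by
        rw [hm, ← integral_const_mul, ← integral_sub (hint g hgc hgs hgx)
          ((hint η hηc hηs hηx).const_mul _)]
        refine integral_congr_ae (Eventually.of_forall fun x => ?_)
        simp only; ring
      linarith
    · exact (tsupport_sub _ _).trans (union_subset hgx ((tsupport_mul_subset_right).trans hηx))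
    · rw [integral_sub (hei g hgc hgs) ((hei η hηc hηs).const_mul _), integral_const_mul, hη1]
      ring
  have hres : EqOn (fun x => G x - m) 0 (Ioi x₀) := by
    refine Measure.eqOn_open_of_ae_eq (μ := volume) ?_ isOpen_Ioi hGm continuousOn_const
    rw [EventuallyEq, ae_restrict_iff' measurableSet_Ioi]
    exact hae
  intro x hx
  have := hres hx
  simp only [Pi.zero_apply] at this
  linarith

/-- Strong `L¹` convergence times bounded pointwise convergence: `(f - f₀) w` is small in norm, and
`f₀ w` converges by domination. -/
lemma tendsto_integral_mul_of_tendsto {l : Filter ℝ} [l.IsCountablyGenerated]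
    {f : ℝ → Vel → ℝ} {f₀ : Vel → ℝ} {w : ℝ → Vel → ℝ} {w₀ : Vel → ℝ} {B : ℝ}
    (hf : ∀ᶠ x in l, Integrable (f x)) (hf₀ : Integrable f₀)
    (hlim : Tendsto (fun x => ∫ ξ, |f x ξ - f₀ ξ|) l (𝓝 0))
    (hwm : ∀ x, Measurable (w x)) (hB : ∀ᶠ x in l, ∀ ξ, |w x ξ| ≤ B)
    (hw : ∀ ξ, Tendsto (fun x => w x ξ) l (𝓝 (w₀ ξ))) :
    Tendsto (fun x => ∫ ξ, f x ξ * w x ξ) l (𝓝 (∫ ξ, f₀ ξ * w₀ ξ)) := by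
  have h1 : Tendsto (fun x => ∫ ξ, f₀ ξ * w x ξ) l (𝓝 (∫ ξ, f₀ ξ * w₀ ξ)) := by
    refine tendsto_integral_filter_of_dominated_convergence (fun ξ => |f₀ ξ| * B) ?_ ?_
      (hf₀.abs.mul_const B) ?_
    · exact Eventually.of_forall fun x => hf₀.1.mul (hwm x).aestronglyMeasurable
    · filter_upwards [hB] with x hx
      refine Eventually.of_forall fun ξ => ?_
      rw [Real.norm_eq_abs, abs_mul]
      gcongr
      exact hx ξ
    · exact Eventually.of_forall fun ξ => (hw ξ).const_mul _
  have h2 : Tendsto (fun x => ∫ ξ, (f x ξ - f₀ ξ) * w x ξ) l (𝓝 0) := by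
    have hlimB := hlim.mul_const B
    rw [zero_mul] at hlimB
    refine squeeze_zero_norm' ?_ hlimB
    filter_upwards [hf, hB] with x hx hBx
    rw [← integral_mul_const]
    refine norm_integral_le_of_norm_le ((hx.sub hf₀).abs.mul_const B) ?_
    refine Eventually.of_forall fun ξ => ?_
    rw [Real.norm_eq_abs, abs_mul]
    gcongr
    exact hBx ξ
  have h3 := h2.add h1
  rw [zero_add] at h3
  refine h3.congr' ?_
  filter_upwards [hf, hB] with x hx hBx
  have hb : ∀ᵐ ξ : Vel, ‖w x ξ‖ ≤ B := Eventually.of_forall hBx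
  rw [← integral_add]
  · refine integral_congr_ae (Eventually.of_forall fun ξ => ?_)
    simp only; ring
  · exact (hx.sub hf₀).mul_bdd (hwm x).aestronglyMeasurable hb
  · exact hf₀.mul_bdd (hwm x).aestronglyMeasurable hb

section Transport

variable {K : Vel → ℝ} {ε : ℝ} {c : ℝ → ℝ} {x : ℝ} {ξ : Vel}

/-- Near a turning point, or beyond it, the shifted speed is below `ε`, so the singularity of the
square root is hidden where `K` vanishes. -/
lemma eventually_comp_shiftVel_eq_zero (hε : 0 < ε) (hK : ∀ ξ : Vel, |ξ.1| < ε → K ξ = 0)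
    (hc : ContinuousAt c x) (h : ξ.1 ^ 2 + c x ≤ 0) :
    ∀ᶠ p : ℝ × Vel in 𝓝 (x, ξ), K (shiftVel (c p.1) p.2) = 0 := by
  have h1 : ContinuousAt (fun p : ℝ × Vel => √(p.2.1 ^ 2 + c p.1)) (x, ξ) := by
    have : ContinuousAt (fun p : ℝ × Vel => c p.1) (x, ξ) :=
      ContinuousAt.comp (f := fun p : ℝ × Vel => p.1) (g := c) (x := (x, ξ)) hc continuousAt_fst
    have h2 : ContinuousAt (fun p : ℝ × Vel => p.2.1 ^ 2 + c p.1) (x, ξ) :=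
      ContinuousAt.add (by fun_prop) this
    exact h2.sqrt
  have h2 : √((x, ξ).2.1 ^ 2 + c (x, ξ).1) < ε := by rw [Real.sqrt_eq_zero'.2 h]; exact hε
  filter_upwards [h1.eventually_lt_const h2] with p hp
  exact hK _ ((abs_shift_le _ _).trans_lt hp)

lemma eventually_shift_eq (c : ℝ → ℝ) (x : ℝ) (h : ξ.1 ≠ 0) :
    ∀ᶠ p : ℝ × Vel in 𝓝 (x, ξ), shiftVel (c p.1) p.2
      = (Real.sign ξ.1 * √(p.2.1 ^ 2 + c p.1), p.2.2) := by
  have hcont : ContinuousAt (fun p : ℝ × Vel => p.2.1) (x, ξ) := by fun_prop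
  rcases lt_or_gt_of_ne h with h' | h'
  · filter_upwards [hcont.eventually_lt_const h'] with p hp
    simp [shiftVel, shift, Real.sign_of_neg h', Real.sign_of_neg hp]
  · filter_upwards [hcont.eventually_const_lt h'] with p hp
    simp [shiftVel, shift, Real.sign_of_pos h', Real.sign_of_pos hp]

lemma contDiffAt_comp_shiftVel (hε : 0 < ε) (hKd : ContDiff ℝ 1 K)
    (hK : ∀ ξ : Vel, |ξ.1| < ε → K ξ = 0) (hc : ContDiffAt ℝ 1 c x) (hcx : c x ≤ 0) :
    ContDiffAt ℝ 1 (fun p : ℝ × Vel => K (shiftVel (c p.1) p.2)) (x, ξ) := by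
  rcases le_or_gt (ξ.1 ^ 2 + c x) 0 with h | h
  · exact contDiffAt_const.congr_of_eventuallyEq
      (eventually_comp_shiftVel_eq_zero hε hK hc.continuousAt h)
  · have h0 : ξ.1 ≠ 0 := by rintro h0; rw [h0] at h; simp at h; linarith
    have e : (fun p : ℝ × Vel => K (shiftVel (c p.1) p.2)) =ᶠ[𝓝 (x, ξ)]
        fun p => K (Real.sign ξ.1 * √(p.2.1 ^ 2 + c p.1), p.2.2) := by
      filter_upwards [eventually_shift_eq c x h0] with p hp
      rw [hp]
    refine ContDiffAt.congr_of_eventuallyEq ?_ e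
    have hc' : ContDiffAt ℝ 1 (fun p : ℝ × Vel => c p.1) (x, ξ) :=
      ContDiffAt.comp (x, ξ) (f := fun p : ℝ × Vel => p.1) (g := c) hc contDiffAt_fst
    have hq : ContDiffAt ℝ 1 (fun p : ℝ × Vel => p.2.1 ^ 2 + c p.1) (x, ξ) :=
      ContDiffAt.add (by fun_prop) hc'
    have hs : ContDiffAt ℝ 1 (fun p : ℝ × Vel => √(p.2.1 ^ 2 + c p.1)) (x, ξ) := hq.sqrt h.ne'
    exact hKd.contDiffAt.comp (x, ξ)
      ((contDiffAt_const.mul hs).prodMk (by fun_prop))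

/-- Functions of the shifted velocity are constant along characteristics. -/
lemma hasDerivAt_comp_shiftVel_line (hε : 0 < ε) (hKd : ContDiff ℝ 1 K)
    (hK : ∀ ξ : Vel, |ξ.1| < ε → K ξ = 0) {D : ℝ} (hc : HasDerivAt c (-2 * D) x) (hcx : c x ≤ 0) :
    HasDerivAt (fun t : ℝ => K (shiftVel (c (x + t * ξ.1)) (ξ.1 + t * D, ξ.2))) 0 0 := by
  have hline : Tendsto (fun t : ℝ => ((x + t * ξ.1, (ξ.1 + t * D, ξ.2)) : ℝ × Vel)) (𝓝 0)
      (𝓝 (x, ξ)) := by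
    have : Continuous (fun t : ℝ => ((x + t * ξ.1, (ξ.1 + t * D, ξ.2)) : ℝ × Vel)) := by fun_prop
    have := this.tendsto 0
    simpa using this
  rcases le_or_gt (ξ.1 ^ 2 + c x) 0 with h | h
  · refine (hasDerivAt_const (0 : ℝ) (0 : ℝ)).congr_of_eventuallyEq ?_
    exact hline.eventually (eventually_comp_shiftVel_eq_zero hε hK hc.continuousAt h)
  · have h0 : ξ.1 ≠ 0 := by rintro h0; rw [h0] at h; simp at h; linarith
    have e := hline.eventually (eventually_shift_eq c x h0)
    have hl1 : HasDerivAt (fun t : ℝ => x + t * ξ.1) ξ.1 0 := by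
      simpa using ((hasDerivAt_id (0 : ℝ)).mul_const ξ.1).const_add x
    have hl2 : HasDerivAt (fun t : ℝ => ξ.1 + t * D) D 0 := by
      simpa using ((hasDerivAt_id (0 : ℝ)).mul_const D).const_add ξ.1
    -- Conservation of energy: the kinetic term contributes `2 ξ₁ D`, the potential term `-2 D ξ₁`.
    have hq : HasDerivAt (fun t : ℝ => (ξ.1 + t * D) ^ 2 + c (x + t * ξ.1)) 0 0 := by
      have h1 := hl2.pow 2
      have hc' : HasDerivAt c (-2 * D) (x + 0 * ξ.1) := by simpa using hc
      have h2 := hc'.comp (0 : ℝ) hl1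
      refine (h1.add h2).congr_deriv ?_
      simp; ring
    have hs := (hq.sqrt (by simpa using h.ne')).const_mul (Real.sign ξ.1)
    have hA : HasDerivAt (fun t : ℝ => ((Real.sign ξ.1 * √((ξ.1 + t * D) ^ 2 + c (x + t * ξ.1)),
        ξ.2) : Vel)) 0 0 := by
      refine (hs.prodMk (hasDerivAt_const (0 : ℝ) ξ.2)).congr_deriv ?_
      simp
    have hK' := (hKd.differentiable (by norm_num)
      ((Real.sign ξ.1 * √((ξ.1 + 0 * D) ^ 2 + c (x + 0 * ξ.1)), ξ.2) : Vel)).hasFDerivAt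
    have := hK'.comp_hasDerivAt (0 : ℝ) hA
    rw [map_zero] at this
    refine this.congr_of_eventuallyEq ?_
    filter_upwards [e] with t ht
    simp only [Function.comp, ht]

end Transport

/-- The test function `θ(x) K(shiftVel (c x) ξ)`. -/
noncomputable def charTest (θ : ℝ → ℝ) (K : Vel → ℝ) (c : ℝ → ℝ) (p : ℝ × Vel) : ℝ :=
  θ p.1 * K (shiftVel (c p.1) p.2)

section CharTest

variable {K : Vel → ℝ} {ε : ℝ} {c : ℝ → ℝ} {θ D : ℝ → ℝ} {x₀ : ℝ}

lemma charTest_eventually_zero {x : ℝ} (hx : x ∉ tsupport θ) (ξ : Vel) :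
    ∀ᶠ p : ℝ × Vel in 𝓝 (x, ξ), charTest θ K c p = 0 := by
  have h := notMem_tsupport_iff_eventuallyEq.1 hx
  have : Tendsto (fun p : ℝ × Vel => p.1) (𝓝 (x, ξ)) (𝓝 x) := continuousAt_fst
  filter_upwards [this.eventually h] with p hp
  simp [charTest, hp]

lemma contDiff_charTest (hε : 0 < ε) (hKd : ContDiff ℝ 1 K)
    (hK : ∀ ξ : Vel, |ξ.1| < ε → K ξ = 0) (hθ : ContDiff ℝ 1 θ) (hθx : tsupport θ ⊆ Ioi x₀)
    (hc : ∀ x > x₀, ContDiffAt ℝ 1 c x) (hcx : ∀ x > x₀, c x ≤ 0) :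
    ContDiff ℝ 1 (charTest θ K c) := by
  rw [contDiff_iff_contDiffAt]
  rintro ⟨x, ξ⟩
  by_cases hx : x ∈ tsupport θ
  · have hx' : x₀ < x := hθx hx
    exact ContDiffAt.mul (by fun_prop) (contDiffAt_comp_shiftVel hε hKd hK (hc x hx') (hcx x hx'))
  · exact contDiffAt_const.congr_of_eventuallyEq (charTest_eventually_zero hx ξ)

lemma abs_fst_le_of_shift_le {c s R M : ℝ} (hs : s ≠ 0) (hM : -M ≤ c)
    (hR : |shift c s| ≤ R) : |s| ≤ √(R ^ 2 + M) := by
  rw [abs_shift_of_ne hs] at hR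
  have hR0 : 0 ≤ R := (Real.sqrt_nonneg _).trans hR
  rw [← Real.sqrt_sq_eq_abs]
  refine Real.sqrt_le_sqrt ?_
  rw [Real.sqrt_le_left hR0] at hR
  linarith

lemma exists_bound_of_comp_shiftVel_ne_zero (hKs : HasCompactSupport K) (hK0 : 0 < ε)
    (hK : ∀ ξ : Vel, |ξ.1| < ε → K ξ = 0) {M : ℝ} :
    ∃ R : ℝ, ∀ d, -M ≤ d → ∀ ξ : Vel, K (shiftVel d ξ) ≠ 0 → ξ ∈ Metric.closedBall (0 : Vel) R := by
  obtain ⟨R, hR⟩ := hKs.isCompact.isBounded.subset_closedBall 0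
  refine ⟨max (√(R ^ 2 + M)) R, fun d hd ξ hξ => ?_⟩
  have h1 := hR (subset_tsupport K hξ)
  rw [mem_closedBall_zero_iff, Prod.norm_def, sup_le_iff] at h1 ⊢
  have h0 : ξ.1 ≠ 0 := by
    intro h
    apply hξ
    apply hK
    simp [shiftVel, h, hK0]
  exact ⟨(abs_fst_le_of_shift_le h0 hd h1.1).trans (le_max_left _ _),
    h1.2.trans (le_max_right _ _)⟩

lemma hasCompactSupport_charTest (hKs : HasCompactSupport K) (hε : 0 < ε)
    (hK : ∀ ξ : Vel, |ξ.1| < ε → K ξ = 0) (hθs : HasCompactSupport θ) {M : ℝ}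
    (hM : ∀ x, -M ≤ c x) : HasCompactSupport (charTest θ K c) := by
  obtain ⟨R, hR⟩ := exists_bound_of_comp_shiftVel_ne_zero hKs hε hK (M := M)
  refine HasCompactSupport.of_support_subset_isCompact
    (hθs.isCompact.prod (isCompact_closedBall (0 : Vel) R)) fun p hp => ?_
  exact ⟨subset_tsupport θ (left_ne_zero_of_mul hp), hR _ (hM _) _ (right_ne_zero_of_mul hp)⟩

/-- The left side is a directional derivative along the characteristic. The factor `K` is constant
in that direction, so only `θ` is differentiated. -/
lemma fderiv_charTest (hε : 0 < ε) (hKd : ContDiff ℝ 1 K)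
    (hK : ∀ ξ : Vel, |ξ.1| < ε → K ξ = 0) (hθ : ContDiff ℝ 1 θ) (hθx : tsupport θ ⊆ Ioi x₀)
    (hc : ∀ x > x₀, ContDiffAt ℝ 1 c x) (hcx : ∀ x > x₀, c x ≤ 0)
    (hcd : ∀ x > x₀, HasDerivAt c (-2 * D x) x) (x : ℝ) (ξ : Vel) :
    ξ.1 * fderiv ℝ (charTest θ K c) (x, ξ) (1, 0)
      + D x * fderiv ℝ (charTest θ K c) (x, ξ) (0, (1, 0))
      = deriv θ x * (ξ.1 * K (shiftVel (c x) ξ)) := by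
  by_cases hx : x ∈ tsupport θ
  · have hx' : x₀ < x := hθx hx
    have hd := (contDiff_charTest hε hKd hK hθ hθx hc hcx).differentiable (by norm_num) (x, ξ)
    have e : ξ.1 * fderiv ℝ (charTest θ K c) (x, ξ) (1, 0)
      + D x * fderiv ℝ (charTest θ K c) (x, ξ) (0, (1, 0))
      = fderiv ℝ (charTest θ K c) (x, ξ) (ξ.1, (D x, 0)) := by
      rw [← smul_eq_mul, ← smul_eq_mul, ← map_smul, ← map_smul, ← map_add]
      congr 1
      simp
    rw [e, ← hd.lineDeriv_eq_fderiv, lineDeriv]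
    refine HasDerivAt.deriv ?_
    have h1 : HasDerivAt (fun t : ℝ => θ (x + t * ξ.1)) (deriv θ x * ξ.1) 0 := by
      have hl1 : HasDerivAt (fun t : ℝ => x + t * ξ.1) ξ.1 0 := by
        simpa using ((hasDerivAt_id (0 : ℝ)).mul_const ξ.1).const_add x
      have hθ' : HasDerivAt θ (deriv θ x) (x + 0 * ξ.1) := by
        simpa using (hθ.differentiable (by norm_num) x).hasDerivAt
      exact hθ'.comp (0 : ℝ) hl1
    have h2 := h1.mul (hasDerivAt_comp_shiftVel_line (ξ := ξ) hε hKd hK (hcd x hx') (hcx x hx'))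
    refine (h2.congr_deriv ?_).congr_of_eventuallyEq (Eventually.of_forall fun t => ?_)
    · simp [shiftVel]; ring
    · simp [charTest, shiftVel]
  · have h0 : fderiv ℝ (charTest θ K c) (x, ξ) = 0 := by
      have e : charTest θ K c =ᶠ[𝓝 (x, ξ)] fun _ => (0 : ℝ) := charTest_eventually_zero hx ξ
      rw [e.fderiv_eq]; simp
    have h1 : deriv θ x = 0 := by
      have := notMem_tsupport_iff_eventuallyEq.1 hx
      rw [this.deriv_eq]; simp
    simp [h0, h1]

end CharTest

lemma shiftJac_mul_shift {c s : ℝ} (hs : s ≠ 0) (h : 0 < s ^ 2 + c) :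
    shiftJac c s * shift c s = s := by
  have hp := Real.sqrt_pos.2 h
  rcases lt_or_gt_of_ne hs with h' | h'
  · rw [shift_of_neg h', shiftJac, abs_of_neg h']; field_simp
  · rw [shift_of_pos h', shiftJac, abs_of_pos h']; field_simp

/-! ### Any solution is its profile at infinity, carried along characteristics. -/

namespace IsSolution

variable {ne : ℝ → ℝ} {α : ℝ} {fb F : Vel → ℝ} {φb : ℝ} {f : ℝ → Vel → ℝ} {φ : ℝ → ℝ}

lemma hasDerivWithinAt (h : IsSolution ne α fb F φb f φ) {x : ℝ} (hx : 0 ≤ x) :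
    HasDerivWithinAt φ (derivWithin φ (Ici 0) x) (Ici 0) x :=
  (h.phi_C1.differentiableOn (by norm_num) x hx).hasDerivWithinAt

lemma hasDerivAt (h : IsSolution ne α fb F φb f φ) {x : ℝ} (hx : 0 < x) :
    HasDerivAt φ (derivWithin φ (Ici 0) x) x :=
  (h.hasDerivWithinAt hx.le).hasDerivAt (Ici_mem_nhds hx)

lemma continuousOn_derivWithin (h : IsSolution ne α fb F φb f φ) :
    ContinuousOn (derivWithin φ (Ici 0)) (Ici 0) :=
  h.phi_C1.continuousOn_derivWithin (uniqueDiffOn_Ici 0) le_rfl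

/-- A decreasing potential with limit `0` would start from a nonnegative value. -/
lemma derivWithin_pos (h : IsSolution ne α fb F φb f φ) (hφb : φb < 0) {x : ℝ} (hx : 0 ≤ x) :
    0 < derivWithin φ (Ici 0) x := by
  rcases h.strictly_monotone with hm | hm
  · exact hm x hx
  exfalso
  have hanti : StrictAntiOn φ (Ici 0) := by
    refine strictAntiOn_of_deriv_neg (convex_Ici 0) h.phi_C1.continuousOn fun y hy => ?_
    rw [interior_Ici] at hy
    rw [(h.hasDerivAt hy).deriv]
    exact hm y (le_of_lt hy)
  have : (0 : ℝ) ≤ φb := by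
    refine le_of_tendsto h.limit_phi ?_
    filter_upwards [eventually_ge_atTop 0] with y hy
    rw [← h.phi_wall]
    exact hanti.antitoneOn self_mem_Ici hy hy
  linarith

lemma strictMonoOn (h : IsSolution ne α fb F φb f φ) (hφb : φb < 0) : StrictMonoOn φ (Ici 0) := by
  refine strictMonoOn_of_deriv_pos (convex_Ici 0) h.phi_C1.continuousOn fun y hy => ?_
  rw [interior_Ici] at hy
  rw [(h.hasDerivAt hy).deriv]
  exact h.derivWithin_pos hφb (le_of_lt hy)

lemma phi_neg (h : IsSolution ne α fb F φb f φ) (hφb : φb < 0) {x : ℝ} (hx : 0 ≤ x) :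
    φ x < 0 := by
  have hm := h.strictMonoOn hφb
  have hx1 : (0 : ℝ) ≤ x + 1 := by linarith
  refine (hm hx hx1 (by linarith)).trans_le (ge_of_tendsto h.limit_phi ?_)
  filter_upwards [eventually_ge_atTop (x + 1)] with y hy
  exact hm.monotoneOn hx1 (hx1.trans hy) hy

lemma wall_le_phi (h : IsSolution ne α fb F φb f φ) (hφb : φb < 0) {x : ℝ} (hx : 0 ≤ x) :
    φb ≤ φ x := by
  rw [← h.phi_wall]
  exact (h.strictMonoOn hφb).monotoneOn self_mem_Ici hx hx

/-- A moment of the distribution along characteristics does not depend on the position. -/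
lemma integral_eq_limit (h : IsSolution ne α fb F φb f φ) (hφb : φb < 0) (hFi : Integrable F)
    {K : Vel → ℝ} {ε : ℝ} (hε : 0 < ε) (hKd : ContDiff ℝ 1 K) (hKs : HasCompactSupport K)
    (hK : ∀ ξ : Vel, |ξ.1| < ε → K ξ = 0) {x₀ : ℝ} (hx₀ : 0 ≤ x₀) :
    ∫ ξ, f x₀ ξ * (ξ.1 * K ξ) = ∫ ξ, F ξ * (ξ.1 * K (shiftVel (2 * φ x₀) ξ)) := by
  -- This `c` carries velocities at `x` back to `x₀`: it vanishes at `x₀`, is nonpositive beyond it,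
  -- and tends to `2 φ(x₀)` at infinity. The truncation is needed because nothing is known of `φ` at
  -- negative positions.
  set c : ℝ → ℝ := fun x => 2 * φ x₀ - 2 * φ (max x 0) with hc
  have hcx : ∀ x, 0 ≤ x → c x = 2 * φ x₀ - 2 * φ x := fun x hx => by simp [hc, max_eq_left hx]
  have hcm : ∀ x, -(-2 * φ x₀) ≤ c x := fun x => by
    have := h.phi_neg hφb (le_max_right x 0)
    simp only [hc]; linarith
  have hcle : ∀ x ≥ x₀, c x ≤ 0 := fun x hx => by
    have := (h.strictMonoOn hφb).monotoneOn hx₀ (hx₀.trans hx) hx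
    rw [hcx x (hx₀.trans hx)]; linarith
  have hcc : Continuous c := by
    have : Continuous fun x => φ (max x 0) :=
      h.phi_C1.continuousOn.comp_continuous (by fun_prop) fun x => mem_Ici.2 (le_max_right x 0)
    exact continuous_const.sub (continuous_const.mul this)
  have hev : ∀ x > x₀, c =ᶠ[𝓝 x] fun y => 2 * φ x₀ - 2 * φ y := fun x hx => by
    filter_upwards [Ioi_mem_nhds (hx₀.trans_lt hx)] with y hy using hcx y (le_of_lt hy)
  have hcd1 : ∀ x > x₀, ContDiffAt ℝ 1 c x := fun x hx => by
    have := h.phi_C1.contDiffAt (Ici_mem_nhds (hx₀.trans_lt hx))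
    exact ContDiffAt.congr_of_eventuallyEq (by fun_prop) (hev x hx)
  have hcd : ∀ x > x₀, HasDerivAt c (-2 * derivWithin φ (Ici 0) x) x := fun x hx => by
    have := ((h.hasDerivAt (hx₀.trans_lt hx)).const_mul 2).const_sub (2 * φ x₀)
    refine (this.congr_deriv ?_).congr_of_eventuallyEq (hev x hx)
    ring
  obtain ⟨R, hR⟩ := exists_bound_of_comp_shiftVel_ne_zero hKs hε hK (M := -2 * φ x₀)
  obtain ⟨B, hB⟩ := hKd.continuous.bounded_above_of_compact_support hKs
  have hB0 : 0 ≤ B := (norm_nonneg _).trans (hB 0)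
  have hbd : ∀ d, -(-2 * φ x₀) ≤ d → ∀ ξ : Vel, |ξ.1 * K (shiftVel d ξ)| ≤ |R| * B := by
    intro d hd ξ
    by_cases h0 : K (shiftVel d ξ) = 0
    · simp only [h0, mul_zero, abs_zero]; positivity
    · have := hR d hd ξ h0
      rw [mem_closedBall_zero_iff, Prod.norm_def, sup_le_iff] at this
      rw [abs_mul]
      exact mul_le_mul (this.1.trans (le_abs_self R)) (hB _) (abs_nonneg _) (abs_nonneg _)
  have hKm := hKd.continuous.measurable
  have hwm : ∀ d, Measurable fun ξ : Vel => ξ.1 * K (shiftVel d ξ) := fun d =>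
    measurable_fst.mul (hKm.comp (measurable_shiftVel d))
  have hwc : ∀ ξ : Vel, Continuous fun d => ξ.1 * K (shiftVel d ξ) := fun ξ => by
    have h1 := continuous_shift_left ξ.1
    have h2 := hKd.continuous
    unfold shiftVel
    fun_prop
  set G : ℝ → ℝ := fun x => ∫ ξ, f x ξ * (ξ.1 * K (shiftVel (c x) ξ)) with hG
  have hGc : ContinuousOn G (Ici x₀) := by
    intro x hx
    have hx0 : 0 ≤ x := hx₀.trans hx
    have hsub : Ici x₀ ⊆ Ici 0 := Ici_subset_Ici.2 hx₀
    refine tendsto_integral_mul_of_tendsto (B := |R| * B) ?_ (h.slice_integrable x hx0)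
      ((h.slice_continuous x hx0).mono_left (nhdsWithin_mono _ hsub)) (fun y => hwm (c y))
      (Eventually.of_forall fun y => hbd _ (hcm y)) ?_
    · filter_upwards [self_mem_nhdsWithin] with y hy using h.slice_integrable y (hsub hy)
    · exact fun ξ => (((hwc ξ).comp hcc).tendsto x).mono_left nhdsWithin_le_nhds
  have hGlim : Tendsto G atTop (𝓝 (∫ ξ, F ξ * (ξ.1 * K (shiftVel (2 * φ x₀) ξ)))) := by
    refine tendsto_integral_mul_of_tendsto (B := |R| * B) ?_ hFi h.limit_f (fun y => hwm (c y))
      (Eventually.of_forall fun y => hbd _ (hcm y)) ?_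
    · filter_upwards [eventually_ge_atTop 0] with y hy using h.slice_integrable y hy
    · intro ξ
      have h1 : Tendsto c atTop (𝓝 (2 * φ x₀)) := by
        have := (h.limit_phi.const_mul 2).const_sub (2 * φ x₀)
        rw [mul_zero, sub_zero] at this
        refine this.congr' ?_
        filter_upwards [eventually_ge_atTop 0] with y hy using (hcx y hy).symm
      exact ((hwc ξ).tendsto _).comp h1
  -- The weak equation says that the moment `G` has zero distributional derivative. Since `θ` is
  -- supported in `x > x₀ ≥ 0`, the wall condition on test functions and the wall term are void.
  obtain ⟨m, hm⟩ := eq_of_integral_deriv_mul_eq_zero hGc fun θ hθ hθs hθx => by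
    have hsupp0 : ∀ x, x ≤ x₀ → x ∉ tsupport θ := fun x hx hx' => absurd (hθx hx') (not_lt.2 hx)
    have htest : IsTest α (charTest θ K c) := by
      refine ⟨contDiff_charTest hε hKd hK hθ hθx hcd1 fun x hx => hcle x (le_of_lt hx),
        hasCompactSupport_charTest hKs hε hK hθs hcm, fun s η _ => ?_⟩
      simp [charTest, image_eq_zero_of_notMem_tsupport (hsupp0 0 hx₀)]
    have hweak := h.weak _ htest
    have hz : ∀ ξ : Vel, charTest θ K c (0, ξ) = 0 := fun ξ => by
      simp [charTest, image_eq_zero_of_notMem_tsupport (hsupp0 0 hx₀)]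
    simp only [hz, mul_zero, integral_zero, add_zero] at hweak
    have e1 : ∀ p : ℝ × Vel, f p.1 p.2 * (p.2.1 * fderiv ℝ (charTest θ K c) p (1, 0)
          + derivWithin φ (Ici 0) p.1 * fderiv ℝ (charTest θ K c) p (0, (1, 0)))
        = f p.1 p.2 * (deriv θ p.1 * (p.2.1 * K (shiftVel (c p.1) p.2))) := fun p => by
      rw [fderiv_charTest hε hKd hK hθ hθx hcd1 (fun x hx => hcle x (le_of_lt hx)) hcd p.1 p.2]
    simp only [e1] at hweak
    have hθ'c : Continuous (deriv θ) := hθ.continuous_deriv le_rfl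
    obtain ⟨B₁, hB₁⟩ := hθ'c.bounded_above_of_compact_support hθs.deriv
    have hint : Integrable
        (fun p : ℝ × Vel => f p.1 p.2 * (deriv θ p.1 * (p.2.1 * K (shiftVel (c p.1) p.2)))) := by
      have hQ : IsCompact (tsupport θ ×ˢ Metric.closedBall (0 : Vel) R) :=
        hθs.isCompact.prod (isCompact_closedBall _ _)
      have hf : IntegrableOn (fun p : ℝ × Vel => f p.1 p.2)
          (tsupport θ ×ˢ Metric.closedBall (0 : Vel) R) :=
        h.locInt.integrableOn_compact_subset
          (prod_mono (hθx.trans ((Ioi_subset_Ioi hx₀).trans Ioi_subset_Ici_self)) (subset_univ _))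
          hQ
      rw [← integrableOn_iff_integrable_of_support_subset
        (s := tsupport θ ×ˢ Metric.closedBall (0 : Vel) R)]
      · refine hf.mul_bdd (c := B₁ * (|R| * B)) (Measurable.aestronglyMeasurable ?_)
          (Eventually.of_forall fun p => ?_)
        · have h1 : Measurable fun p : ℝ × Vel => shiftVel (c p.1) p.2 :=
            measurable_shiftVel_uncurry.comp
              (((hcc.measurable.comp measurable_fst)).prodMk measurable_snd)
          exact (hθ'c.measurable.comp measurable_fst).mul
            ((measurable_fst.comp measurable_snd).mul (hKm.comp h1))
        · rw [norm_mul]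
          exact mul_le_mul (hB₁ _) (hbd _ (hcm _) _) (norm_nonneg _)
            ((norm_nonneg _).trans (hB₁ 0))
      · intro p hp
        have hp2 := right_ne_zero_of_mul hp
        refine ⟨?_, hR _ (hcm _) _ (right_ne_zero_of_mul (right_ne_zero_of_mul hp2))⟩
        exact support_deriv_subset (left_ne_zero_of_mul hp2)
    rw [Measure.volume_eq_prod, setIntegral_prod _ hint.integrableOn] at hweak
    have e2 : ∀ x, ∫ ξ in (univ : Set Vel), f x ξ * (deriv θ x * (ξ.1 * K (shiftVel (c x) ξ)))
        = deriv θ x * G x := fun x => by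
      rw [Measure.restrict_univ, hG, ← integral_const_mul]
      congr 1; ext ξ; ring
    simp only [e2] at hweak
    rw [← hweak]
    refine (setIntegral_eq_of_subset_of_forall_sdiff_eq_zero measurableSet_Ioi
      (Ioi_subset_Ioi hx₀) fun x hx => ?_).symm
    have : deriv θ x = 0 := by
      by_contra h0
      exact hsupp0 x (not_lt.1 hx.2) (support_deriv_subset h0)
    simp [this]
  have hm1 : m = ∫ ξ, F ξ * (ξ.1 * K (shiftVel (2 * φ x₀) ξ)) := by
    refine tendsto_nhds_unique ?_ hGlim
    refine tendsto_const_nhds.congr' ?_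
    filter_upwards [eventually_gt_atTop x₀] with x hx using (hm x hx).symm
  have hm2 : G x₀ = m := by
    have h1 : Tendsto G (𝓝[>] x₀) (𝓝 (G x₀)) :=
      (hGc x₀ self_mem_Ici).mono_left (nhdsWithin_mono _ Ioi_subset_Ici_self)
    refine tendsto_nhds_unique h1 ?_
    refine tendsto_const_nhds.congr' ?_
    filter_upwards [self_mem_nhdsWithin] with x hx using (hm x hx).symm
  rw [← hm1, ← hm2, hG]
  have : c x₀ = 0 := by rw [hcx x₀ hx₀]; ring
  simp [this]

/-- The distribution of a solution is transported along characteristics from infinity. -/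
lemma ae_eq_comp_shiftVel {r : ℝ} (h : IsSolution ne α fb F φb f φ) (hφb : φb < 0)
    (hF : IsProfile r F) {x : ℝ} (hx : 0 ≤ x) :
    f x =ᵐ[volume] fun ξ => F (shiftVel (-2 * φ x) ξ) := by
  have hφx := h.phi_neg hφb hx
  have hc : 0 ≤ -2 * φ x := by linarith
  have hfi := h.slice_integrable x hx
  have hgi := hF.integrable_comp hc
  have hopen : IsOpen {ξ : Vel | ξ.1 ≠ 0} := isOpen_ne_fun (by fun_prop) (by fun_prop)
  have hae : ∀ᵐ ξ : Vel, ξ ∈ {ξ : Vel | ξ.1 ≠ 0} → f x ξ - F (shiftVel (-2 * φ x) ξ) = 0 := by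
    refine hopen.ae_eq_zero_of_integral_contDiff_smul_eq_zero
      ((hfi.sub hgi).locallyIntegrable.locallyIntegrableOn _) ?_
    intro k hk hks hkx
    obtain ⟨ε, hε, hεk⟩ : ∃ ε : ℝ, 0 < ε ∧ ∀ ξ ∈ tsupport k, ε ≤ |ξ.1| :=
      hks.isCompact.exists_forall_le' (f := fun ξ : Vel => |ξ.1|) (by fun_prop)
        fun ξ hξ => abs_pos.2 (hkx hξ)
    have hk0 : ∀ ξ : Vel, |ξ.1| < ε → k ξ = 0 := fun ξ hξ =>
      image_eq_zero_of_notMem_tsupport fun hξ' => absurd (hεk ξ hξ') (not_le.2 hξ)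
    -- Dividing by `ξ₁` turns a plain moment into a flux moment; it is harmless because `k` vanishes
    -- near `ξ₁ = 0`.
    set K : Vel → ℝ := fun ξ => k ξ / ξ.1 with hKdef
    have hK0 : ∀ ξ : Vel, |ξ.1| < ε → K ξ = 0 := fun ξ hξ => by simp [hKdef, hk0 ξ hξ]
    have hKk : ∀ ξ : Vel, ξ.1 * K ξ = k ξ := fun ξ => by
      by_cases h0 : ξ.1 = 0
      · rw [h0, zero_mul, hk0 ξ (by simpa [h0] using hε)]
      · simp only [hKdef]; field_simp
    have hKd : ContDiff ℝ 1 K := by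
      rw [contDiff_iff_contDiffAt]
      intro ξ
      by_cases h0 : ξ.1 = 0
      · refine contDiffAt_const (c := (0 : ℝ)).congr_of_eventuallyEq ?_
        have : ∀ᶠ ζ : Vel in 𝓝 ξ, |ζ.1| < ε :=
          (by fun_prop : ContinuousAt (fun ζ : Vel => |ζ.1|) ξ).eventually_lt_const
            (by simpa [h0] using hε)
        filter_upwards [this] with ζ hζ using hK0 ζ hζ
      · exact ((hk.of_le (by simp)).contDiffAt).div (by fun_prop) h0
    have hKs : HasCompactSupport K := by
      refine HasCompactSupport.of_support_subset_isCompact hks.isCompact fun ξ hξ => ?_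
      refine subset_tsupport k ?_
      intro h0
      exact hξ (by simp [hKdef, h0])
    have key := h.integral_eq_limit hφb hF.integrable hε hKd hKs hK0 hx
    simp only [hKk] at key
    -- Pass from the velocity at infinity to the velocity at `x`. Velocities that do not reach `x`
    -- contribute nothing, as `K` vanishes at zero normal velocity.
    have hchange := integral_shiftVel hc
      (g := fun ξ : Vel => F ξ * (ξ.1 * K (shiftVel (2 * φ x) ξ)))
      (hF.measurable.mul (measurable_fst.mul
        (hKd.continuous.measurable.comp (measurable_shiftVel _)))).aestronglyMeasurable
    have e1 : ∫ ξ in {ξ : Vel | -2 * φ x < ξ.1 ^ 2}, F ξ * (ξ.1 * K (shiftVel (2 * φ x) ξ))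
        = ∫ ξ, F ξ * (ξ.1 * K (shiftVel (2 * φ x) ξ)) := by
      refine setIntegral_eq_integral_of_forall_compl_eq_zero fun ξ hξ => ?_
      have h1 : ξ.1 ^ 2 + 2 * φ x ≤ 0 := by
        have : ξ.1 ^ 2 ≤ -2 * φ x := not_lt.1 hξ
        linarith
      rw [hK0 _ (by simpa [shiftVel, shift_eq_zero_of_nonpos h1] using hε)]
      ring
    have e2 : ∫ ξ : Vel, shiftJac (-2 * φ x) ξ.1 * (F (shiftVel (-2 * φ x) ξ) *
          ((shiftVel (-2 * φ x) ξ).1 * K (shiftVel (2 * φ x) (shiftVel (-2 * φ x) ξ))))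
        = ∫ ξ, F (shiftVel (-2 * φ x) ξ) * k ξ := by
      refine integral_congr_ae ?_
      filter_upwards [ae_fst_ne_zero] with ξ hξ
      have hp : 0 < ξ.1 ^ 2 + -2 * φ x := by positivity
      have hs : shiftVel (2 * φ x) (shiftVel (-2 * φ x) ξ) = ξ := by
        simp only [shiftVel]
        rw [shift_shift hp]
        simp
      have hJ : shiftJac (-2 * φ x) ξ.1 * shift (-2 * φ x) ξ.1 = ξ.1 :=
        shiftJac_mul_shift hξ hp
      rw [hs, ← hKk ξ]
      calc _ = F (shiftVel (-2 * φ x) ξ) *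
            ((shiftJac (-2 * φ x) ξ.1 * shift (-2 * φ x) ξ.1) * K ξ) := by
              simp only [shiftVel]; ring
        _ = _ := by rw [hJ]
    obtain ⟨B, hB⟩ := hk.continuous.bounded_above_of_compact_support hks
    have hkb : ∀ᵐ ξ : Vel, ‖k ξ‖ ≤ B := Eventually.of_forall hB
    have hkm : AEStronglyMeasurable k := hk.continuous.aestronglyMeasurable
    have e3 : ∫ ξ, k ξ • (f x ξ - F (shiftVel (-2 * φ x) ξ))
        = (∫ ξ, f x ξ * k ξ) - ∫ ξ, F (shiftVel (-2 * φ x) ξ) * k ξ := by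
      rw [← integral_sub (hfi.mul_bdd hkm hkb) (hgi.mul_bdd hkm hkb)]
      congr 1; ext ξ; simp only [smul_eq_mul]; ring
    rw [e3, key, ← e1, ← hchange, e2, sub_self]
  filter_upwards [hae, ae_fst_ne_zero] with ξ h1 h2
  exact sub_eq_zero.1 (h1 h2)

end IsSolution

/-! ### Separation of variables for the potential. -/

lemma eq_of_hasDerivAt_zero {g : ℝ → ℝ} (hg : ContinuousOn g (Ici 0))
    (hd : ∀ x > 0, HasDerivAt g 0 x) {x : ℝ} (hx : 0 ≤ x) : g x = g 0 := by
  have hdiff : DifferentiableOn ℝ g (interior (Ici 0)) := by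
    rw [interior_Ici]
    exact fun y hy => (hd y hy).differentiableAt.differentiableWithinAt
  have hd0 : ∀ y ∈ interior (Ici (0 : ℝ)), deriv g y = 0 := by
    rw [interior_Ici]
    exact fun y hy => (hd y hy).deriv
  have h1 := monotoneOn_of_deriv_nonneg (convex_Ici 0) hg hdiff fun y hy => (hd0 y hy).ge
  have h2 := antitoneOn_of_deriv_nonpos (convex_Ici 0) hg hdiff fun y hy => (hd0 y hy).le
  exact le_antisymm (h2 self_mem_Ici hx hx) (h1 self_mem_Ici hx hx)

section FirstIntegral

/-! ### The first order equation `φ' = √(2 V(φ))`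

It is solved by separation of variables, in the coordinate `u = -log (-φ)`. -/

variable (V : ℝ → ℝ) (b : ℝ)

/-- The slope `dx/du` of the position as a function of `u = -log (-φ)`; the potential is cut off
at the value `b`. -/
noncomputable def invSlope (u : ℝ) : ℝ :=
  Real.exp (-u) / √(2 * V (max (-Real.exp (-u)) b))

/-- The position as a function of `u = -log (-φ)`, up to an additive constant. -/
noncomputable def invPos (u : ℝ) : ℝ := ∫ v in (0 : ℝ)..u, invSlope V b v

variable {V : ℝ → ℝ} {b C : ℝ}

lemma max_neg_exp_mem (hb : b < 0) (u : ℝ) : max (-Real.exp (-u)) b ∈ Ico b 0 :=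
  ⟨le_max_right _ _, max_lt (neg_neg_of_pos (Real.exp_pos _)) hb⟩

lemma continuous_invSlope (hb : b < 0) (hV : ContinuousOn V (Iic 0)) (hpos : ∀ t ∈ Ico b 0, 0 < V t) :
    Continuous (invSlope V b) := by
  have h1 : Continuous fun u : ℝ => V (max (-Real.exp (-u)) b) :=
    hV.comp_continuous (by fun_prop) fun u => (max_neg_exp_mem hb u).2.le
  refine Continuous.div (by fun_prop) (continuous_const.mul h1).sqrt fun u => ?_
  have := hpos _ (max_neg_exp_mem hb u)
  positivity

lemma hasDerivAt_invPos (hb : b < 0) (hV : ContinuousOn V (Iic 0)) (hpos : ∀ t ∈ Ico b 0, 0 < V t)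
    (u : ℝ) : HasDerivAt (invPos V b) (invSlope V b u) u := by
  have h := continuous_invSlope hb hV hpos
  exact intervalIntegral.integral_hasDerivAt_right (h.intervalIntegrable _ _)
    h.aestronglyMeasurable.stronglyMeasurableAtFilter h.continuousAt

lemma invSlope_pos (hb : b < 0) (hpos : ∀ t ∈ Ico b 0, 0 < V t) (u : ℝ) : 0 < invSlope V b u := by
  have := hpos _ (max_neg_exp_mem hb u)
  unfold invSlope
  positivity

/-- A bound `V ≤ C φ²` says that `-φ` decays at most exponentially in `x`, that is, `x` grows at
least linearly in `u`. Truncation at `b` only decreases the square of the argument. -/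
lemma le_invSlope (hb : b < 0) (hpos : ∀ t ∈ Ico b 0, 0 < V t) (hC : 0 < C)
    (hVC : ∀ t ∈ Icc b 0, V t ≤ C * t ^ 2) (u : ℝ) : 1 / √(2 * C) ≤ invSlope V b u := by
  have hm := max_neg_exp_mem hb u
  have := hpos _ hm
  have hle := hVC _ ⟨hm.1, hm.2.le⟩
  have hsq : max (-Real.exp (-u)) b ^ 2 ≤ Real.exp (-u) ^ 2 := by
    rw [← neg_sq, sq_le_sq₀ (by linarith [hm.2]) (Real.exp_pos _).le]
    linarith [le_max_left (-Real.exp (-u)) b]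
  unfold invSlope
  rw [div_le_div_iff₀ (by positivity) (by positivity), one_mul]
  rw [Real.sqrt_le_left (by positivity), mul_pow, Real.sq_sqrt (by positivity)]
  nlinarith

lemma strictMono_invPos (hb : b < 0) (hV : ContinuousOn V (Iic 0))
    (hpos : ∀ t ∈ Ico b 0, 0 < V t) : StrictMono (invPos V b) :=
  strictMono_of_deriv_pos fun u => by
    rw [(hasDerivAt_invPos hb hV hpos u).deriv]
    exact invSlope_pos hb hpos u

/-- Linear growth in both directions means that `u` runs to infinity only as `x` does: the potential
neither reaches `0` at a finite position nor ceases to exist. -/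
lemma surjective_invPos (hb : b < 0) (hV : ContinuousOn V (Iic 0))
    (hpos : ∀ t ∈ Ico b 0, 0 < V t) (hC : 0 < C) (hVC : ∀ t ∈ Icc b 0, V t ≤ C * t ^ 2) :
    Function.Surjective (invPos V b) := by
  set k := 1 / √(2 * C) with hk
  have hk0 : 0 < k := by positivity
  have hmono : Monotone fun u => invPos V b u - k * u := by
    have hd : ∀ u, HasDerivAt (fun u => invPos V b u - k * u) (invSlope V b u - k) u := fun u => by
      simpa [Pi.sub_def] using (hasDerivAt_invPos hb hV hpos u).sub ((hasDerivAt_id u).const_mul k)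
    refine monotone_of_deriv_nonneg (fun u => (hd u).differentiableAt) fun u => ?_
    rw [(hd u).deriv, sub_nonneg]
    exact le_invSlope hb hpos hC hVC u
  have h0 : invPos V b 0 = 0 := by simp [invPos]
  have hcont : Continuous (invPos V b) := continuous_iff_continuousAt.2 fun u =>
    (hasDerivAt_invPos hb hV hpos u).continuousAt
  refine hcont.surjective ?_ ?_
  · refine tendsto_atTop_mono' atTop ?_ (tendsto_id.const_mul_atTop hk0)
    filter_upwards [eventually_ge_atTop 0] with u hu
    have := hmono hu
    simp only [h0] at this
    simp only [id]; linarith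
  · refine tendsto_atBot_mono' atBot ?_ (tendsto_id.const_mul_atBot hk0)
    filter_upwards [eventually_le_atBot 0] with u hu
    have := hmono hu
    simp only [h0] at this
    simp only [id]; linarith

/-- A solution of the first order equation is determined by its initial value. -/
lemma invPos_eq (hb : b < 0) (hV : ContinuousOn V (Iic 0)) (hpos : ∀ t ∈ Ico b 0, 0 < V t)
    {φ : ℝ → ℝ} (hφc : ContinuousOn φ (Ici 0)) (hφ : ∀ x, 0 ≤ x → φ x ∈ Ico b 0) (hφ0 : φ 0 = b)
    (hd : ∀ x > 0, HasDerivAt φ (√(2 * V (φ x))) x) {x : ℝ} (hx : 0 ≤ x) :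
    invPos V b (-Real.log (-φ x)) = invPos V b (-Real.log (-b)) + x := by
  have hmono : Continuous (invPos V b) := continuous_iff_continuousAt.2 fun u =>
    (hasDerivAt_invPos hb hV hpos u).continuousAt
  have key := eq_of_hasDerivAt_zero (g := fun x => invPos V b (-Real.log (-φ x)) - x) ?_ ?_ hx
  · simp only [hφ0] at key
    linarith
  · refine ContinuousOn.sub (hmono.comp_continuousOn ?_) continuousOn_id
    exact (hφc.neg.log fun y hy => neg_ne_zero.2 (hφ y hy).2.ne).neg
  · intro y hy
    have hφy := hφ y (le_of_lt hy)
    have hneg : 0 < -φ y := by linarith [hφy.2]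
    have h1 := ((hd y hy).neg.log hneg.ne').neg
    have h2 := (hasDerivAt_invPos hb hV hpos (-Real.log (-φ y))).comp y h1
    have h3 := h2.sub (hasDerivAt_id y)
    refine h3.congr_deriv ?_
    have hVp := hpos _ hφy
    have hs : 0 < √(2 * V (φ y)) := by positivity
    rw [invSlope, neg_neg, Real.exp_log hneg, neg_neg, max_eq_left hφy.1]
    have hne : φ y ≠ 0 := by linarith
    simp only [Pi.neg_apply]
    field_simp
    simp

/-- Existence for the first order equation. -/
lemma exists_potential (hb : b < 0) (hV : ContinuousOn V (Iic 0)) (hpos : ∀ t ∈ Ico b 0, 0 < V t)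
    (hC : 0 < C) (hVC : ∀ t ∈ Icc b 0, V t ≤ C * t ^ 2) :
    ∃ φ : ℝ → ℝ, φ 0 = b ∧ (∀ x, φ x < 0) ∧ Tendsto φ atTop (𝓝 0) ∧
      ∀ x, HasDerivAt φ (√(2 * V (max (φ x) b))) x := by
  -- The potential is `-exp(-u)` with `u` the inverse of the position map, translated by `x₀` so
  -- that `x = 0` corresponds to the value `b`.
  set e : ℝ ≃o ℝ := (strictMono_invPos hb hV hpos).orderIsoOfSurjective _
    (surjective_invPos hb hV hpos hC hVC) with he
  have hee : ∀ u, e u = invPos V b u := fun u => rfl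
  set x₀ := invPos V b (-Real.log (-b)) with hx₀
  have hd : ∀ x, HasDerivAt (fun x => e.symm (x + x₀)) (invSlope V b (e.symm (x + x₀)))⁻¹ x := by
    intro x
    have h1 : HasDerivAt e.symm (invSlope V b (e.symm (x + x₀)))⁻¹ (x + x₀) := by
      refine HasDerivAt.of_local_left_inverse (f := invPos V b) e.symm.continuous.continuousAt
        (hasDerivAt_invPos hb hV hpos _) (invSlope_pos hb hpos _).ne' ?_
      exact Eventually.of_forall fun y => by rw [← hee, OrderIso.apply_symm_apply]
    exact h1.comp_add_const x x₀
  refine ⟨fun x => -Real.exp (-e.symm (x + x₀)), ?_, fun x => neg_neg_of_pos (Real.exp_pos _),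
    ?_, fun x => ?_⟩
  · simp only [zero_add]
    rw [hx₀, ← hee, OrderIso.symm_apply_apply, neg_neg, Real.exp_log (by linarith), neg_neg]
  · have h1 : Tendsto (fun x => e.symm (x + x₀)) atTop atTop :=
      e.symm.tendsto_atTop.comp (tendsto_atTop_add_const_right _ _ tendsto_id)
    have := (Real.tendsto_exp_neg_atTop_nhds_zero.comp h1).neg
    rwa [neg_zero] at this
  · have h1 := (hd x).neg.exp.neg
    refine h1.congr_deriv ?_
    have hp := hpos _ (max_neg_exp_mem hb (e.symm (x + x₀)))
    rw [invSlope, inv_div]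
    have := Real.exp_pos (-e.symm (x + x₀))
    simp only [Pi.neg_apply]
    field_simp

end FirstIntegral

/-! ### Energy, uniqueness and decay of the potential. -/

namespace IsSolution

variable {ne : ℝ → ℝ} {α : ℝ} {fb F : Vel → ℝ} {φb : ℝ} {f : ℝ → Vel → ℝ} {φ : ℝ → ℝ} {r : ℝ}

lemma deriv_eventuallyEq (h : IsSolution ne α fb F φb f φ) {x : ℝ} (hx : 0 < x) :
    deriv φ =ᶠ[𝓝 x] derivWithin φ (Ici 0) := by
  filter_upwards [Ioi_mem_nhds hx] with y hy using (h.hasDerivAt hy).deriv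

lemma iteratedDeriv_two (h : IsSolution ne α fb F φb f φ) (hφb : φb < 0) (hF : IsProfile r F)
    {x : ℝ} (hx : 0 < x) : iteratedDeriv 2 φ x = rhoMinus F (φ x) - ne (φ x) := by
  rw [h.poisson x hx, hF.rhoMinus_eq (h.phi_neg hφb hx.le).le]
  congr 1
  exact integral_congr_ae (h.ae_eq_comp_shiftVel hφb hF hx.le)

lemma hasDerivAt_derivWithin (h : IsSolution ne α fb F φb f φ) (hφb : φb < 0)
    (hF : IsProfile r F) {x : ℝ} (hx : 0 < x) :
    HasDerivAt (derivWithin φ (Ici 0)) (rhoMinus F (φ x) - ne (φ x)) x := by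
  have h1 : ContDiffAt ℝ 1 (deriv φ) x :=
    (h.phi_C2.deriv_of_isOpen isOpen_Ioi (by norm_num)).contDiffAt (Ioi_mem_nhds hx)
  have h3 : HasDerivAt (deriv φ) (iteratedDeriv 2 φ x) x := by
    have := (h1.differentiableAt (by norm_num)).hasDerivAt
    rwa [iteratedDeriv_succ, iteratedDeriv_one]
  rw [← h.iteratedDeriv_two hφb hF hx]
  exact h3.congr_of_eventuallyEq (h.deriv_eventuallyEq hx).symm

/-- Conservation of energy. -/
lemma derivWithin_sq (h : IsSolution ne α fb F φb f φ) (hφb : φb < 0) (hF : IsProfile r F)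
    (hne : Continuous ne) {x : ℝ} (hx : 0 ≤ x) :
    derivWithin φ (Ici 0) x ^ 2 = 2 * VMinus ne F (φ x) := by
  set D := derivWithin φ (Ici 0) with hD
  have hVc := continuousOn_VMinus hF hne
  have hc : ContinuousOn (fun x => D x ^ 2 - 2 * VMinus ne F (φ x)) (Ici 0) :=
    (h.continuousOn_derivWithin.pow 2).sub (continuousOn_const.mul
      (hVc.comp h.phi_C1.continuousOn fun y hy => (h.phi_neg hφb hy).le))
  have hconst : ∀ y, 0 ≤ y → D y ^ 2 - 2 * VMinus ne F (φ y) = D 0 ^ 2 - 2 * VMinus ne F (φ 0) := by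
    intro y hy
    refine eq_of_hasDerivAt_zero hc (fun z hz => ?_) hy
    have hz' : 0 < z := hz
    have hneg := h.phi_neg hφb hz'.le
    have h1 := (h.hasDerivAt_derivWithin hφb hF hz').pow 2
    have h2 := ((hasDerivWithinAt_VMinus hF hne hneg.le).hasDerivAt
      (Iic_mem_nhds hneg)).comp z (h.hasDerivAt hz')
    refine (h1.sub (h2.const_mul 2)).congr_deriv ?_
    simp; ring
  set E := D 0 ^ 2 - 2 * VMinus ne F (φ 0) with hE
  have hVlim : Tendsto (fun y => VMinus ne F (φ y)) atTop (𝓝 0) := by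
    have h1 : Tendsto φ atTop (𝓝[Iic 0] 0) := by
      refine tendsto_nhdsWithin_iff.2 ⟨h.limit_phi, ?_⟩
      filter_upwards [eventually_ge_atTop 0] with y hy using (h.phi_neg hφb hy).le
    have := (hVc 0 (mem_Iic.2 le_rfl)).tendsto.comp h1
    rwa [VMinus_zero] at this
  have hDlim : Tendsto (fun y => D y ^ 2) atTop (𝓝 E) := by
    have := (hVlim.const_mul 2).const_add E
    rw [mul_zero, add_zero] at this
    refine this.congr' ?_
    filter_upwards [eventually_ge_atTop 0] with y hy
    linarith [hconst y hy]
  have hE0 : 0 ≤ E := ge_of_tendsto' hDlim fun y => sq_nonneg _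
  -- A positive limit `E` of `φ'²` would force linear growth of `φ`, contradicting `φ < 0`.
  have hE1 : E = 0 := by
    by_contra hne0
    have hEpos : 0 < E := lt_of_le_of_ne hE0 (Ne.symm hne0)
    have ha : 0 < √(E / 2) := Real.sqrt_pos.2 (half_pos hEpos)
    obtain ⟨X, hX⟩ := ((hDlim.eventually_const_lt (half_lt_self hEpos)).and
      (eventually_ge_atTop 0)).exists_forall_of_atTop
    have hX0 : 0 ≤ X := (hX X le_rfl).2
    have hgrow : ∀ y ≥ X, √(E / 2) * (y - X) ≤ φ y - φ X := by
      intro y hy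
      refine (convex_Ici X).mul_sub_le_image_sub_of_le_deriv
        (h.phi_C1.continuousOn.mono (Ici_subset_Ici.2 hX0)) ?_ ?_ X self_mem_Ici y hy hy
      · rw [interior_Ici]
        exact fun z hz => (h.hasDerivAt (hX0.trans_lt hz)).differentiableAt.differentiableWithinAt
      · rw [interior_Ici]
        intro z hz
        have hz0 : 0 < z := hX0.trans_lt hz
        rw [(h.hasDerivAt hz0).deriv]
        exact Real.sqrt_le_iff.2 ⟨(h.derivWithin_pos hφb hz0.le).le, (hX z (le_of_lt hz)).1.le⟩
    -- At this position the linear lower bound for `φ` reaches `0`.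
    have hy := hgrow (X + (-φ X) / √(E / 2)) (by
      have := h.phi_neg hφb hX0
      have : 0 ≤ -φ X / √(E / 2) := div_nonneg (by linarith) ha.le
      linarith)
    have hneg := h.phi_neg hφb (x := X + (-φ X) / √(E / 2)) (by
      have := h.phi_neg hφb hX0
      have : 0 ≤ -φ X / √(E / 2) := div_nonneg (by linarith) ha.le
      linarith)
    rw [add_sub_cancel_left, mul_div_cancel₀ _ ha.ne'] at hy
    linarith
  linarith [hconst x hx]

lemma VMinus_pos (h : IsSolution ne α fb F φb f φ) (hφb : φb < 0) (hF : IsProfile r F)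
    (hne : Continuous ne) {x : ℝ} (hx : 0 ≤ x) : 0 < VMinus ne F (φ x) := by
  have h1 := h.derivWithin_sq hφb hF hne hx
  have h2 := h.derivWithin_pos hφb hx
  have : 0 < derivWithin φ (Ici 0) x ^ 2 := by positivity
  linarith

lemma derivWithin_eq (h : IsSolution ne α fb F φb f φ) (hφb : φb < 0) (hF : IsProfile r F)
    (hne : Continuous ne) {x : ℝ} (hx : 0 ≤ x) :
    derivWithin φ (Ici 0) x = √(2 * VMinus ne F (φ x)) := by
  rw [← h.derivWithin_sq hφb hF hne hx, Real.sqrt_sq (h.derivWithin_pos hφb hx).le]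

/-- By the intermediate value theorem `φ` attains every value in `[φ_b, 0)`, and there `2 V⁻ = φ'² >
0`. -/
lemma mem_BMinus (h : IsSolution ne α fb F φb f φ) (hφb : φb < 0) (hF : IsProfile r F)
    (hne : Continuous ne) : φb ∈ BMinus ne F := by
  refine ⟨hφb, fun t ht => ?_⟩
  obtain ⟨X, hX0, hX⟩ := ((eventually_ge_atTop (0 : ℝ)).and
    (h.limit_phi.eventually_const_lt ht.2)).exists
  obtain ⟨x, hx, rfl⟩ := intermediate_value_Icc hX0
    (h.phi_C1.continuousOn.mono Icc_subset_Ici_self) ⟨h.phi_wall ▸ ht.1, hX.le⟩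
  exact h.VMinus_pos hφb hF hne hx.1

/-- Both potentials satisfy the same implicit relation `invPos(u) = const + x`, and `invPos` is
injective. -/
lemma phi_unique (h : IsSolution ne α fb F φb f φ) {g : ℝ → Vel → ℝ} {θ : ℝ → ℝ}
    (h' : IsSolution ne α fb F φb g θ) (hφb : φb < 0) (hF : IsProfile r F)
    (hne : Continuous ne) {x : ℝ} (hx : 0 ≤ x) : θ x = φ x := by
  have hpos := (h.mem_BMinus hφb hF hne).2
  have hVc := continuousOn_VMinus hF hne
  have key : ∀ {f φ}, IsSolution ne α fb F φb f φ →
      invPos (VMinus ne F) φb (-Real.log (-φ x)) = invPos (VMinus ne F) φb (-Real.log (-φb)) + x :=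
    fun {f φ} h => invPos_eq hφb hVc hpos h.phi_C1.continuousOn
      (fun y hy => ⟨h.wall_le_phi hφb hy, h.phi_neg hφb hy⟩) h.phi_wall
      (fun y hy => h.derivWithin_eq hφb hF hne (le_of_lt hy) ▸ h.hasDerivAt hy) hx
  have h1 := (strictMono_invPos hφb hVc hpos).injective ((key h').trans (key h).symm)
  have h2 := Real.log_injOn_pos (mem_Ioi.2 (neg_pos.2 (h'.phi_neg hφb hx)))
    (mem_Ioi.2 (neg_pos.2 (h.phi_neg hφb hx))) (neg_injective h1)
  exact neg_injective h2

lemma explicitForm (h : IsSolution ne α fb F φb f φ) (hφb : φb < 0) (hF : IsProfile r F) :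
    ExplicitForm F f φ := by
  intro x hx
  filter_upwards [h.ae_eq_comp_shiftVel hφb hF hx, ae_fst_ne_zero] with ξ hξ h0
  rw [hξ, shiftVel, show ξ.1 ^ 2 - 2 * φ x = ξ.1 ^ 2 + -2 * φ x by ring]
  rcases lt_or_gt_of_ne h0 with h' | h'
  · simp [chi, h', h'.le, shift_of_neg h']
  · simp [chi, h', h'.le, shift_of_pos h']

/-- Once `φ > -ε`, the energy identity gives `φ' ≥ -√(2 m) φ`, so `-φ exp(√(2 m) x)` is
nonincreasing. The derivatives inherit the decay from `φ' = √(2 V⁻(φ))` and `φ'' = ρ_i⁻(φ) -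
n_e(φ)`, both bounded by multiples of `|φ|`. -/
lemma expDecay (h : IsSolution ne α fb F φb f φ) (hφb : φb < 0) (hF : IsProfile r F)
    (hne : Continuous ne) {C m ε : ℝ} (hC : 0 < C)
    (hg : ∀ t ∈ Icc φb 0, |rhoMinus F t - ne t| ≤ C * |t|)
    (hVC : ∀ t ∈ Icc φb 0, |VMinus ne F t| ≤ C * t ^ 2) (hm : 0 < m) (hε : 0 < ε)
    (hVm : ∀ t ∈ Icc (-ε) 0, m * t ^ 2 ≤ VMinus ne F t) : ExpDecay φ := by
  set a := √(2 * m) with ha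
  have ha0 : 0 < a := by positivity
  obtain ⟨X, hX⟩ := ((h.limit_phi.eventually_const_lt (neg_neg_of_pos hε)).and
    (eventually_ge_atTop 0)).exists_forall_of_atTop
  have hX0 : 0 ≤ X := (hX X le_rfl).2
  have hsq : ∀ t : ℝ, ∀ k : ℝ, t < 0 → √(2 * (k * t ^ 2)) = √(2 * k) * -t := by
    intro t k ht
    rw [← mul_assoc, mul_comm, Real.sqrt_mul (sq_nonneg t), Real.sqrt_sq_eq_abs, abs_of_neg ht,
      mul_comm]
  have hanti : AntitoneOn (fun x => -φ x * Real.exp (a * x)) (Ici X) := by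
    have hd : ∀ x > X, HasDerivAt (fun x => -φ x * Real.exp (a * x))
        (-derivWithin φ (Ici 0) x * Real.exp (a * x) + -φ x * (Real.exp (a * x) * a)) x := by
      intro x hx
      have h1 := (h.hasDerivAt (hX0.trans_lt hx)).neg
      have h2 : HasDerivAt (fun x => Real.exp (a * x)) (Real.exp (a * x) * a) x := by
        simpa using ((hasDerivAt_id x).const_mul a).exp
      exact h1.mul h2
    refine antitoneOn_of_deriv_nonpos (convex_Ici X) ?_ ?_ ?_
    · exact ((h.phi_C1.continuousOn.mono (Ici_subset_Ici.2 hX0)).neg).mul (by fun_prop)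
    · rw [interior_Ici]
      exact fun x hx => (hd x hx).differentiableAt.differentiableWithinAt
    · rw [interior_Ici]
      intro x hx
      rw [(hd x hx).deriv]
      have hx0 : 0 ≤ x := hX0.trans (le_of_lt hx)
      have hneg := h.phi_neg hφb hx0
      have hle : a * -φ x ≤ derivWithin φ (Ici 0) x := by
        rw [h.derivWithin_eq hφb hF hne hx0, ha, ← hsq _ _ hneg]
        refine Real.sqrt_le_sqrt ?_
        have := hVm (φ x) ⟨(hX x (le_of_lt hx)).1.le, hneg.le⟩
        linarith
      have := Real.exp_pos (a * x)
      nlinarith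
  -- The factor `exp(a X)` absorbs the initial stretch `[0, X]`, where only `-φ ≤ -φ_b` is known.
  have hmain : ∀ x, 0 ≤ x → -φ x ≤ -φb * Real.exp (a * X) * Real.exp (-a * x) := by
    intro x hx
    have hw := h.wall_le_phi hφb hx
    have hmul : -φ x * Real.exp (a * x) ≤ -φb * Real.exp (a * X) := by
      rcases le_total x X with hxX | hxX
      · have h1 : Real.exp (a * x) ≤ Real.exp (a * X) := by gcongr
        exact mul_le_mul (by linarith) h1 (Real.exp_pos _).le (by linarith)
      · refine (hanti self_mem_Ici hxX hxX).trans ?_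
        have := h.wall_le_phi hφb hX0
        simp only
        gcongr
    calc -φ x = -φ x * Real.exp (a * x) * Real.exp (-a * x) := by
          rw [mul_assoc, ← Real.exp_add]; simp
      _ ≤ _ := by gcongr
  set C₀ := -φb * Real.exp (a * X) with hC₀
  have hC₀p : 0 < C₀ := mul_pos (neg_pos.2 hφb) (Real.exp_pos _)
  refine ⟨a, C₀ * (1 + √(2 * C) + C), ha0, by positivity, fun l hl x hx => ?_⟩
  have hneg := h.phi_neg hφb hx.le
  have hmem : φ x ∈ Icc φb 0 := ⟨h.wall_le_phi hφb hx.le, hneg.le⟩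
  have hx1 := hmain x hx.le
  have hE := Real.exp_pos (-a * x)
  have hsC : 0 ≤ √(2 * C) := Real.sqrt_nonneg _
  have hbound : ∀ k, 0 ≤ k → k ≤ 1 + √(2 * C) + C → k * -φ x ≤
      C₀ * (1 + √(2 * C) + C) * Real.exp (-a * x) := by
    intro k hk hk'
    calc k * -φ x ≤ (1 + √(2 * C) + C) * (C₀ * Real.exp (-a * x)) := by
          exact mul_le_mul hk' hx1 (by linarith) (by positivity)
      _ = _ := by ring
  interval_cases l
  · rw [iteratedDeriv_zero, abs_of_neg hneg]
    simpa using hbound 1 zero_le_one (by linarith)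
  · rw [iteratedDeriv_one, (h.hasDerivAt hx).deriv, abs_of_pos (h.derivWithin_pos hφb hx.le),
      h.derivWithin_eq hφb hF hne hx.le]
    refine le_trans ?_ (hbound (√(2 * C)) hsC (by linarith))
    rw [← hsq _ _ hneg]
    refine Real.sqrt_le_sqrt ?_
    have := (le_abs_self _).trans (hVC _ hmem)
    linarith
  · rw [h.iteratedDeriv_two hφb hF hx]
    refine (hg _ hmem).trans ?_
    rw [abs_of_neg hneg]
    exact hbound C hC.le (by linarith)

end IsSolution

/-! ### The transported profile solves the weak Vlasov equation. -/

/-- Reflection of the normal velocity. -/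
def reflect : Vel ≃ᵐ Vel := (MeasurableEquiv.neg ℝ).prodCongr (MeasurableEquiv.refl (ℝ × ℝ))

@[simp] lemma reflect_apply (ξ : Vel) : reflect ξ = (-ξ.1, ξ.2) := rfl

lemma measurePreserving_reflect : MeasurePreserving reflect (volume : Measure Vel) volume :=
  (Measure.measurePreserving_neg (volume : Measure ℝ)).prod (MeasurePreserving.id _)

lemma shiftVel_reflect (c : ℝ) (ξ : Vel) : shiftVel c (-ξ.1, ξ.2) = reflect (shiftVel c ξ) := by
  simp [shiftVel, shift_neg]

namespace IsProfile

variable {r : ℝ} {F : Vel → ℝ} {φ : ℝ → ℝ}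

lemma measurable_comp_uncurry (hF : IsProfile r F) (hφ : Continuous φ) :
    Measurable fun p : ℝ × Vel => F (shiftVel (-2 * φ p.1) p.2) :=
  hF.measurable.comp (measurable_shiftVel_uncurry.comp
    ((by fun_prop : Measurable fun p : ℝ × Vel => (-2 * φ p.1, p.2))))

/-- Since `φ` increases, `-2 φ(x)` stays in the fixed bounded interval `[0, -2 φ(0)]` for `x ≥ 0`,
where the `L¹` bound on shifted profiles is uniform. -/
lemma integrableOn_strip (hF : IsProfile r F) (hφ : Continuous φ) (hm : StrictMono φ)
    (hneg : ∀ x, φ x < 0) (R : ℝ) :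
    IntegrableOn (fun p : ℝ × Vel => F (shiftVel (-2 * φ p.1) p.2)) (Icc 0 R ×ˢ univ) := by
  obtain ⟨C, hC, hb⟩ := exists_lintegral_shiftVel_le hF.measurable hF.integrable hF.two_lt
    hF.locBound (U := -2 * φ 0) (by linarith [hneg 0])
  have hmeas := hF.measurable_comp_uncurry hφ
  refine ⟨hmeas.aestronglyMeasurable, ?_⟩
  rw [HasFiniteIntegral, Measure.volume_eq_prod, ← Measure.prod_restrict, Measure.restrict_univ,
    lintegral_prod _ hmeas.enorm.aemeasurable]
  calc ∫⁻ x in Icc 0 R, ∫⁻ ξ, ‖F (shiftVel (-2 * φ x) ξ)‖ₑ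
      ≤ ∫⁻ _ in Icc 0 R, C := by
        refine setLIntegral_mono' measurableSet_Icc fun x hx => ?_
        have := hm.monotone hx.1
        exact hb _ (by linarith [hneg x]) (by linarith)
    _ = C * volume (Icc 0 R) := setLIntegral_const _ _
    _ < ⊤ := ENNReal.mul_lt_top (lt_top_iff_ne_top.2 hC) (by simp)

lemma locallyIntegrableOn (hF : IsProfile r F) (hφ : Continuous φ) (hm : StrictMono φ)
    (hneg : ∀ x, φ x < 0) :
    LocallyIntegrableOn (fun p : ℝ × Vel => F (shiftVel (-2 * φ p.1) p.2))
      (Ici (0 : ℝ) ×ˢ (univ : Set Vel)) := by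
  rintro ⟨x, ξ⟩ -
  refine ⟨Icc 0 (x + 1) ×ˢ univ, ?_, hF.integrableOn_strip hφ hm hneg _⟩
  have h1 : Iic (x + 1) ×ˢ (univ : Set Vel) ∈ 𝓝 (x, ξ) :=
    prod_mem_nhds (Iic_mem_nhds (by linarith)) univ_mem
  filter_upwards [self_mem_nhdsWithin, mem_nhdsWithin_of_mem_nhds h1] with p hp hp'
  exact ⟨⟨hp.1, hp'.1⟩, trivial⟩

end IsProfile

/-- The derivative of a test function along a characteristic, as a function of the position. -/
noncomputable def charDeriv (φ D : ℝ → ℝ) (ψ : ℝ × Vel → ℝ) (x : ℝ) (η : Vel) : ℝ :=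
  fderiv ℝ ψ (x, shiftVel (2 * φ x) η) (1, 0)
    + D x / shift (2 * φ x) η.1 * fderiv ℝ ψ (x, shiftVel (2 * φ x) η) (0, (1, 0))

section CharDeriv

variable {φ D : ℝ → ℝ} {ψ : ℝ × Vel → ℝ}

lemma hasDerivAt_char (hψ : ContDiff ℝ 1 ψ) {x : ℝ} (hd : HasDerivAt φ (D x) x) {η : Vel}
    (hη : η.1 ≠ 0) (hx : 0 < η.1 ^ 2 + 2 * φ x) :
    HasDerivAt (fun x => ψ (x, shiftVel (2 * φ x) η)) (charDeriv φ D ψ x η) x := by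
  have h1 : HasDerivAt (fun x => shift (2 * φ x) η.1) (D x / shift (2 * φ x) η.1) x := by
    have hq := (((hd.const_mul 2).const_add (η.1 ^ 2)).sqrt hx.ne').const_mul (Real.sign η.1)
    have hs := Real.sqrt_pos.2 hx
    refine hq.congr_deriv ?_
    rcases lt_or_gt_of_ne hη with h | h
    · rw [shift_of_neg h, Real.sign_of_neg h]; field_simp
    · rw [shift_of_pos h, Real.sign_of_pos h]; field_simp
  have h2 := (hasDerivAt_id x).prodMk (h1.prodMk (hasDerivAt_const x η.2))
  have h3 := ((hψ.differentiable (by norm_num)) (x, shiftVel (2 * φ x) η)).hasFDerivAt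
  have h4 := h3.comp_hasDerivAt x h2
  refine h4.congr_deriv ?_
  rw [charDeriv, ← smul_eq_mul (D x / _), ← map_smul, ← map_add]
  congr 1
  simp

/-- Fundamental theorem of calculus along a characteristic. Integrability is a hypothesis because
the integrand may blow up at the turning point; it will come from Fubini. -/
lemma integral_charDeriv (hψ : ContDiff ℝ 1 ψ) (hψs : HasCompactSupport ψ)
    (hd : ∀ x, HasDerivAt φ (D x) x) {η : Vel} (hη : η.1 ≠ 0) {a : ℝ}
    (ha : ∀ x > a, 0 < η.1 ^ 2 + 2 * φ x)
    (hi : IntegrableOn (fun x => charDeriv φ D ψ x η) (Ioi a)) :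
    ∫ x in Ioi a, charDeriv φ D ψ x η = -ψ (a, shiftVel (2 * φ a) η) := by
  have hφc : Continuous φ := continuous_iff_continuousAt.2 fun x => (hd x).continuousAt
  have hcont : Continuous fun x => ψ (x, shiftVel (2 * φ x) η) := by
    have := hψ.continuous
    unfold shiftVel shift
    fun_prop
  have hlim : Tendsto (fun x => ψ (x, shiftVel (2 * φ x) η)) atTop (𝓝 0) := by
    obtain ⟨R, hR⟩ := hψs.isCompact.isBounded.subset_closedBall 0
    refine tendsto_const_nhds.congr' ?_
    filter_upwards [eventually_gt_atTop R] with x hx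
    refine (image_eq_zero_of_notMem_tsupport fun hmem => ?_).symm
    have := hR hmem
    rw [mem_closedBall_zero_iff, Prod.norm_def, sup_le_iff] at this
    exact absurd ((le_abs_self x).trans this.1) (not_le.2 hx)
  rw [integral_Ioi_of_hasDerivAt_of_tendsto hcont.continuousWithinAt
    (fun x hx => hasDerivAt_char hψ (hd x) hη (ha x hx)) hi hlim, zero_sub]

lemma measurable_charDeriv (hψ : ContDiff ℝ 1 ψ) (hφ : Continuous φ) (hD : Continuous D) :
    Measurable fun p : ℝ × Vel => charDeriv φ D ψ p.1 p.2 := by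
  have h1 : Measurable fun p : ℝ × Vel => (p.1, shiftVel (2 * φ p.1) p.2) :=
    measurable_fst.prodMk (measurable_shiftVel_uncurry.comp
      ((by fun_prop : Measurable fun p : ℝ × Vel => (2 * φ p.1, p.2))))
  have h2 : Measurable fun p : ℝ × Vel => shift (2 * φ p.1) p.2.1 :=
    measurable_shift_uncurry.comp
      ((by fun_prop : Measurable fun p : ℝ × Vel => (2 * φ p.1, p.2.1)))
  have h3 : ∀ v : ℝ × Vel, Measurable fun p => fderiv ℝ ψ p v := fun v =>
    ((hψ.continuous_fderiv (by norm_num)).clm_apply continuous_const).measurable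
  unfold charDeriv
  exact ((h3 _).comp h1).add (((hD.measurable.comp measurable_fst).div h2).mul ((h3 _).comp h1))

/-- With `η` the velocity at infinity, `η₁ dη₁ = ξ₁ dξ₁` at fixed position; this converts the
transport operator into a derivative in `x` alone. -/
lemma shiftJac_mul_charDeriv {F : Vel → ℝ} {x : ℝ} (hx : φ x < 0) {ξ : Vel} (hξ : ξ.1 ≠ 0) :
    shiftJac (-2 * φ x) ξ.1 * (F (shiftVel (-2 * φ x) ξ) *
      ((shiftVel (-2 * φ x) ξ).1 * charDeriv φ D ψ x (shiftVel (-2 * φ x) ξ)))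
    = F (shiftVel (-2 * φ x) ξ) *
      (ξ.1 * fderiv ℝ ψ (x, ξ) (1, 0) + D x * fderiv ℝ ψ (x, ξ) (0, (1, 0))) := by
  have hp : 0 < ξ.1 ^ 2 + -2 * φ x := by
    have : 0 < ξ.1 ^ 2 := by positivity
    linarith
  have hs1 : shift (2 * φ x) (shift (-2 * φ x) ξ.1) = ξ.1 := by rw [shift_shift hp]; simp
  have hs : shiftVel (2 * φ x) (shiftVel (-2 * φ x) ξ) = ξ := by simp only [shiftVel, hs1]
  have hJ := shiftJac_mul_shift hξ hp
  rw [charDeriv, hs]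
  simp only [shiftVel, hs1]
  rw [show ∀ A B X Y : ℝ, A * (B * (X * Y)) = B * ((A * X) * Y) by intros; ring, hJ]
  congr 1
  field_simp

end CharDeriv

section Weak

variable {r α φb : ℝ} {F fb : Vel → ℝ} {φ D : ℝ → ℝ} {ψ : ℝ × Vel → ℝ}

/-- The set of positions reached by the characteristic through infinity with velocity `η`. -/
lemma setOf_reached (hm : StrictMono φ) {η : Vel} {a : ℝ} (ha0 : 0 ≤ a)
    (h : a = 0 ∧ -2 * φ 0 ≤ η.1 ^ 2 ∨ η.1 ^ 2 = -2 * φ a) :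
    Ioi (0 : ℝ) ∩ {x | -2 * φ x < η.1 ^ 2} = Ioi a := by
  ext x
  simp only [mem_inter_iff, mem_Ioi, mem_ofPred_eq]
  -- Either the particle has enough energy to come down to the wall, or it turns at `a`, where its
  -- normal velocity vanishes.
  rcases h with ⟨rfl, h⟩ | h
  · refine ⟨fun hx => hx.1, fun hx => ⟨hx, ?_⟩⟩
    have := hm hx
    linarith
  · rw [h]
    constructor
    · rintro ⟨_, hx⟩
      exact hm.lt_iff_lt.1 (by linarith)
    · intro hx
      have := hm hx
      exact ⟨ha0.trans_lt hx, by linarith⟩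

/-- The integral of the transport derivative reduces to a boundary term. -/
lemma integral_transport (hF : IsProfile r F) (hd : ∀ x, HasDerivAt φ (D x) x) (hD : Continuous D)
    (hm : StrictMono φ) (hneg : ∀ x, φ x < 0) (hlim : Tendsto φ atTop (𝓝 0))
    (hsym : ∀ᵐ ξ : Vel, ξ.1 ^ 2 < -2 * φ 0 → F ξ = F (-ξ.1, ξ.2))
    (hψ : ContDiff ℝ 1 ψ) (hψs : HasCompactSupport ψ) :
    ∫ p in Ioi (0 : ℝ) ×ˢ (univ : Set Vel), F (shiftVel (-2 * φ p.1) p.2) *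
        (p.2.1 * fderiv ℝ ψ p (1, 0) + D p.1 * fderiv ℝ ψ p (0, (1, 0)))
      = -∫ ξ, F (shiftVel (-2 * φ 0) ξ) * (ξ.1 * ψ (0, ξ)) := by
  have hφc : Continuous φ := continuous_iff_continuousAt.2 fun x => (hd x).continuousAt
  have hFd : ∀ v : ℝ × Vel, Continuous fun p => fderiv ℝ ψ p v := fun v =>
    (hψ.continuous_fderiv (by norm_num)).clm_apply continuous_const
  have hFds : ∀ v : ℝ × Vel, HasCompactSupport fun p => fderiv ℝ ψ p v := fun v =>
    (hψs.fderiv (𝕜 := ℝ)).comp_left (g := fun L : ℝ × Vel →L[ℝ] ℝ => L v) (by simp)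
  set h : ℝ × Vel → ℝ := fun p =>
    p.2.1 * fderiv ℝ ψ p (1, 0) + D p.1 * fderiv ℝ ψ p (0, (1, 0)) with hh
  have hhc : Continuous h := by
    have h1 := hFd (1, 0)
    have h2 := hFd (0, (1, 0))
    fun_prop
  have hhs : HasCompactSupport h := ((hFds (1, 0)).mul_left).add ((hFds (0, (1, 0))).mul_left)
  have hmeas := hF.measurable_comp_uncurry hφc
  have hint : IntegrableOn (fun p : ℝ × Vel => F (shiftVel (-2 * φ p.1) p.2) * h p)
      (Ioi (0 : ℝ) ×ˢ (univ : Set Vel)) := by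
    obtain ⟨R, hR⟩ := hhs.isCompact.isBounded.subset_closedBall 0
    obtain ⟨B, hB⟩ := hhc.bounded_above_of_compact_support hhs
    have h1 : IntegrableOn (fun p : ℝ × Vel => F (shiftVel (-2 * φ p.1) p.2) * h p)
        (Icc 0 R ×ˢ univ) := (hF.integrableOn_strip hφc hm hneg R).mul_bdd (c := B)
          hhc.aestronglyMeasurable (Eventually.of_forall hB)
    refine h1.of_forall_sdiff_eq_zero (measurableSet_Ioi.prod MeasurableSet.univ) ?_
    rintro ⟨x, ξ⟩ ⟨hx, hx'⟩
    have hx0 : 0 < x := hx.1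
    have : h (x, ξ) = 0 := by
      refine image_eq_zero_of_notMem_tsupport fun hmem => hx' ⟨⟨hx0.le, ?_⟩, trivial⟩
      have := hR hmem
      rw [mem_closedBall_zero_iff, Prod.norm_def, sup_le_iff] at this
      exact (le_abs_self x).trans this.1
    simp [this]
  set k := charDeriv φ D ψ with hk
  have hkm : Measurable fun p : ℝ × Vel => k p.1 p.2 := measurable_charDeriv hψ hφc hD
  -- The integrand in the variables (position, velocity at infinity), cut off to the positions that
  -- the particle reaches. For each position it has the same integral and `L¹` norm over velocities
  -- as the original, so the order of integration can be exchanged.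
  set N : ℝ × Vel → ℝ := indicator {p : ℝ × Vel | -2 * φ p.1 < p.2.1 ^ 2}
    (fun p => F p.2 * (p.2.1 * k p.1 p.2)) with hN
  have hNm : Measurable N := by
    refine Measurable.indicator ?_ (measurableSet_lt (by fun_prop) (by fun_prop))
    exact (hF.measurable.comp measurable_snd).mul ((by fun_prop : Measurable
      fun p : ℝ × Vel => p.2.1).mul hkm)
  have hNx : ∀ x η, N (x, η) = indicator {η : Vel | -2 * φ x < η.1 ^ 2}
      (fun η => F η * (η.1 * k x η)) η := fun x η => rfl
  have hgm : ∀ x, Measurable fun η : Vel => F η * (η.1 * k x η) := fun x =>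
    hF.measurable.mul (measurable_fst.mul (hkm.comp measurable_prodMk_left))
  have hfiber : ∀ x, ∫ ξ, F (shiftVel (-2 * φ x) ξ) * h (x, ξ) = ∫ η, N (x, η) := fun x => by
    simp only [hNx]
    rw [integral_indicator (measurableSet_lt_sq _),
      ← integral_shiftVel (by linarith [hneg x]) (hgm x).aestronglyMeasurable]
    refine integral_congr_ae ?_
    filter_upwards [ae_fst_ne_zero] with ξ hξ
    exact (shiftJac_mul_charDeriv (hneg x) hξ).symm
  have hfiber' : ∀ x, ∫⁻ η, ‖N (x, η)‖ₑ = ∫⁻ ξ, ‖F (shiftVel (-2 * φ x) ξ) * h (x, ξ)‖ₑ := fun x => by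
    simp only [hNx, enorm_indicator_eq_indicator_enorm]
    rw [lintegral_indicator (measurableSet_lt_sq _),
      ← lintegral_shiftVel (by linarith [hneg x]) (hgm x).enorm]
    refine lintegral_congr_ae ?_
    filter_upwards [ae_fst_ne_zero] with ξ hξ
    rw [← Real.enorm_of_nonneg (shiftJac_nonneg _ _), ← enorm_mul,
      shiftJac_mul_charDeriv (hneg x) hξ]
  have hNint : Integrable N ((volume.restrict (Ioi (0 : ℝ))).prod volume) := by
    refine ⟨hNm.aestronglyMeasurable, ?_⟩
    have h2 := hint.2
    rw [HasFiniteIntegral, Measure.volume_eq_prod, ← Measure.prod_restrict, Measure.restrict_univ,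
      lintegral_prod (fun p : ℝ × Vel => ‖F (shiftVel (-2 * φ p.1) p.2) * h p‖ₑ)
        (hmeas.mul hhc.measurable).enorm.aemeasurable] at h2
    rw [HasFiniteIntegral, lintegral_prod _ hNm.enorm.aemeasurable]
    simp only [hfiber']
    exact h2
  set M : Vel → ℝ := fun η => ∫ x in Ioi (0 : ℝ), N (x, η) with hM
  have hMint : Integrable M := hNint.integral_prod_right
  have hstep : ∫ p in Ioi (0 : ℝ) ×ˢ (univ : Set Vel), F (shiftVel (-2 * φ p.1) p.2) * h p
      = ∫ η, M η := by
    rw [Measure.volume_eq_prod, setIntegral_prod _ hint]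
    simp only [Measure.restrict_univ, hfiber]
    rw [← integral_prod _ hNint, integral_prod_symm _ hNint]
  have hMval : ∀ᵐ η : Vel, ∀ a, 0 ≤ a → (a = 0 ∧ -2 * φ 0 ≤ η.1 ^ 2 ∨ η.1 ^ 2 = -2 * φ a) →
      M η = -(F η * (η.1 * ψ (a, shiftVel (2 * φ a) η))) := by
    filter_upwards [hNint.prod_left_ae, ae_fst_ne_zero] with η hη hη0 a ha0 ha
    -- Integrability is known only for the product with `F η`, so this factor must be nonzero to be
    -- divided out.
    by_cases hF0 : F η = 0
    · have : ∀ x, N (x, η) = 0 := fun x => by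
        rw [hNx]; simp [indicator, hF0]
      simp [hM, this, hF0]
    have hset := setOf_reached hm ha0 ha
    have hms : MeasurableSet {x : ℝ | -2 * φ x < η.1 ^ 2} :=
      measurableSet_lt (by fun_prop) measurable_const
    have hNe : (fun x => N (x, η)) = indicator {x : ℝ | -2 * φ x < η.1 ^ 2}
        (fun x => F η * (η.1 * k x η)) := rfl
    have hk1 : IntegrableOn (fun x => F η * (η.1 * k x η)) (Ioi a) := by
      rw [hNe, integrable_indicator_iff hms, IntegrableOn, Measure.restrict_restrict hms,
        inter_comm, hset] at hη
      exact hη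
    have hk2 : IntegrableOn (fun x => k x η) (Ioi a) := by
      have := (hk1.const_mul (F η * η.1)⁻¹)
      refine this.congr (Eventually.of_forall fun x => ?_)
      have : F η * η.1 ≠ 0 := mul_ne_zero hF0 hη0
      simp only
      field_simp
    have hpos : ∀ x > a, 0 < η.1 ^ 2 + 2 * φ x := fun x hx => by
      have : x ∈ Ioi (0 : ℝ) ∩ {x | -2 * φ x < η.1 ^ 2} := by rw [hset]; exact hx
      have : -2 * φ x < η.1 ^ 2 := this.2
      linarith
    rw [hM]
    simp only
    rw [hNe, integral_indicator hms, Measure.restrict_restrict hms, inter_comm, hset,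
      integral_const_mul, integral_const_mul, hk, integral_charDeriv hψ hψs hd hη0 hpos hk2]
    ring
  set A : Set Vel := {η : Vel | -2 * φ 0 < η.1 ^ 2} with hA
  have hAm : MeasurableSet A := measurableSet_lt_sq _
  -- Slow particles turn back before the wall. The velocities `η` and its reflection meet at the
  -- same turning point with zero normal velocity and `F` is symmetric there, so the factor `η₁`
  -- makes `M` odd.
  have hodd : ∫ η in Aᶜ, M η = 0 := by
    have h1 : ∫ η in Aᶜ, M (reflect η) = ∫ η in Aᶜ, M η := by
      have := measurePreserving_reflect.setIntegral_preimage_emb reflect.measurableEmbedding M Aᶜ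
      rw [← this]
      congr 2
      ext η; simp [hA]
    have h2 : ∫ η in Aᶜ, M (reflect η) = -∫ η in Aᶜ, M η := by
      rw [← integral_neg]
      refine setIntegral_congr_ae hAm.compl ?_
      -- The symmetry is assumed only for strictly smaller energies; the grazing energy is a null
      -- set.
      have hne : ∀ᵐ η : Vel, η.1 ^ 2 ≠ -2 * φ 0 := by
        have h0 : ∀ᵐ s : ℝ, s ^ 2 ≠ -2 * φ 0 := by
          rw [ae_iff]
          refine Set.Finite.measure_zero (Set.Finite.subset
            (Set.toFinite {√(-2 * φ 0), -√(-2 * φ 0)}) fun s hs => ?_) _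
          have hs' : s ^ 2 = -2 * φ 0 := by simpa using hs
          have := Real.sqrt_sq_eq_abs s
          rw [hs'] at this
          rcases abs_choice s with h | h
          · left; rw [this, h]
          · right; rw [mem_singleton_iff, this, h, neg_neg]
        exact (Measure.quasiMeasurePreserving_fst (μ := (volume : Measure ℝ))
          (ν := (volume : Measure (ℝ × ℝ)))).ae h0
      filter_upwards [hMval, measurePreserving_reflect.quasiMeasurePreserving.ae hMval, hsym, hne,
        ae_fst_ne_zero] with η h1 h2 h3 h4 h5 hη
      have hle : η.1 ^ 2 ≤ -2 * φ 0 := not_lt.1 hη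
      obtain ⟨a, ha0, ha⟩ : ∃ a, 0 ≤ a ∧ φ a = -η.1 ^ 2 / 2 := by
        have hsq : 0 < η.1 ^ 2 := by positivity
        obtain ⟨X, hX0, hX⟩ := ((eventually_ge_atTop (0 : ℝ)).and
          (hlim.eventually_const_lt (by linarith : -η.1 ^ 2 / 2 < 0))).exists
        obtain ⟨a, ha, ha'⟩ := intermediate_value_Icc hX0 hφc.continuousOn
          (⟨by linarith, hX.le⟩ : -η.1 ^ 2 / 2 ∈ Icc (φ 0) (φ X))
        exact ⟨a, ha.1, ha'⟩
      have ha' : η.1 ^ 2 = -2 * φ a := by rw [ha]; ring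
      rw [h1 a ha0 (Or.inr ha'), h2 a ha0 (Or.inr (by simpa using ha')), reflect_apply,
        ← h3 (lt_of_le_of_ne hle h4)]
      have e1 : shiftVel (2 * φ a) η = (0, η.2) := by
        rw [shiftVel, shift_eq_zero_of_nonpos (by rw [ha']; linarith)]
      have e2 : shiftVel (2 * φ a) (-η.1, η.2) = (0, η.2) := by
        rw [shiftVel, shift_eq_zero_of_nonpos (by simp only [neg_sq]; rw [ha']; linarith)]
      rw [e1, e2]; ring
    linarith
  have hc0 : 0 ≤ -2 * φ 0 := by linarith [hneg 0]
  -- Fast particles end at the wall, with boundary value at `a = 0`; changing back to the velocity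
  -- at the wall gives the boundary term.
  have heven : ∫ η in A, M η = -∫ ξ, F (shiftVel (-2 * φ 0) ξ) * (ξ.1 * ψ (0, ξ)) := by
    have h1 : ∫ η in A, M η = -∫ η in A, F η * (η.1 * ψ (0, shiftVel (2 * φ 0) η)) := by
      rw [← integral_neg]
      refine setIntegral_congr_ae hAm ?_
      filter_upwards [hMval] with η h1 hη
      exact h1 0 le_rfl (Or.inl ⟨rfl, le_of_lt hη⟩)
    rw [h1, hA, ← integral_shiftVel hc0]
    · congr 1
      refine integral_congr_ae ?_
      filter_upwards [ae_fst_ne_zero] with ξ hξ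
      have hp : 0 < ξ.1 ^ 2 + -2 * φ 0 := by positivity
      have hs : shiftVel (2 * φ 0) (shiftVel (-2 * φ 0) ξ) = ξ := by
        simp only [shiftVel]; rw [shift_shift hp]; simp
      rw [hs]
      have hJ := shiftJac_mul_shift hξ hp
      calc _ = F (shiftVel (-2 * φ 0) ξ) *
            ((shiftJac (-2 * φ 0) ξ.1 * shift (-2 * φ 0) ξ.1) * ψ (0, ξ)) := by
              simp only [shiftVel]; ring
        _ = _ := by rw [hJ]
    · exact (hF.measurable.mul (measurable_fst.mul (hψ.continuous.measurable.comp
        (measurable_const.prodMk (measurable_shiftVel _))))).aestronglyMeasurable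
  rw [hstep, ← integral_add_compl hAm hMint, hodd, heven, add_zero]

/-- The boundary term is absorbed by the boundary condition at the wall. -/
lemma integral_wall (hF : IsProfile r F) (hφb : φb < 0) (hcomp : Compatible α fb F φb)
    (hψ : IsTest α ψ) :
    ∫ ξ, F (shiftVel (-2 * φb) ξ) * (ξ.1 * ψ (0, ξ))
      = ∫ ξ in {ξ : Vel | 0 < ξ.1}, fb ξ * (ξ.1 * ψ (0, ξ)) := by
  have hc0 : 0 ≤ -2 * φb := by linarith
  set g : Vel → ℝ := fun ξ => F (shiftVel (-2 * φb) ξ) * (ξ.1 * ψ (0, ξ)) with hg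
  have hwc : Continuous fun ξ : Vel => ξ.1 * ψ (0, ξ) := by
    have := hψ.1.continuous
    fun_prop
  have hws : HasCompactSupport fun ξ : Vel => ξ.1 * ψ (0, ξ) := by
    refine HasCompactSupport.mul_left (HasCompactSupport.of_support_subset_isCompact
      (hψ.2.1.isCompact.image continuous_snd) fun ξ hξ => ?_)
    exact ⟨(0, ξ), subset_tsupport ψ hξ, rfl⟩
  obtain ⟨B, hB⟩ := hwc.bounded_above_of_compact_support hws
  have hgi : Integrable g := (hF.integrable_comp hc0).mul_bdd hwc.aestronglyMeasurable
    (Eventually.of_forall hB)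
  set P : Set Vel := {ξ : Vel | 0 < ξ.1} with hP
  have hPm : MeasurableSet P := measurableSet_lt measurable_const measurable_fst
  -- The half space of particles moving towards the wall is folded onto `ξ₁ > 0`.
  have hPc : ∫ ξ in Pᶜ, g ξ = ∫ ξ in P, g (reflect ξ) := by
    have h1 := measurePreserving_reflect.setIntegral_preimage_emb reflect.measurableEmbedding g Pᶜ
    rw [← h1]
    refine setIntegral_congr_set ?_
    filter_upwards [ae_fst_ne_zero] with ξ hξ
    refine propext ?_
    change reflect ξ ∈ Pᶜ ↔ ξ ∈ P
    simp only [reflect_apply, hP, mem_compl_iff, mem_ofPred_eq, not_lt, Left.neg_nonpos_iff]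
    exact ⟨fun h => lt_of_le_of_ne h (Ne.symm hξ), le_of_lt⟩
  have hgi' : Integrable fun ξ => g (reflect ξ) :=
    (measurePreserving_reflect.integrable_comp_emb reflect.measurableEmbedding).2 hgi
  rw [← integral_add_compl hPm hgi, hPc, ← integral_add hgi.integrableOn hgi'.integrableOn]
  refine setIntegral_congr_ae hPm ?_
  have hcm := ae_shiftVel' hc0 hcomp.1
  filter_upwards [hcm] with ξ hξ hpos
  have hpos' : 0 < ξ.1 := hpos
  have hp : 0 < ξ.1 ^ 2 + -2 * φb := by positivity
  have hs : shift (-2 * φb) ξ.1 = √(ξ.1 ^ 2 + -2 * φb) := shift_of_pos hpos'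
  have h1 := hξ (by
    simp only [shiftVel, hs]
    refine Real.sqrt_lt_sqrt (by positivity) ?_
    rw [abs_of_neg hφb]
    have : 0 < ξ.1 ^ 2 := by positivity
    linarith)
  have h2 : √((shiftVel (-2 * φb) ξ).1 ^ 2 + 2 * φb) = ξ.1 := by
    simp only [shiftVel, hs]
    rw [Real.sq_sqrt hp.le, show ξ.1 ^ 2 + -2 * φb + 2 * φb = ξ.1 ^ 2 by ring,
      Real.sqrt_sq hpos'.le]
  rw [h2] at h1
  have h3 : ((ξ.1, (shiftVel (-2 * φb) ξ).2) : Vel) = ξ := rfl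
  rw [h3] at h1
  have h4 := hψ.2.2 ξ.1 ξ.2 hpos'
  have h5 : ((-(shiftVel (-2 * φb) ξ).1, (shiftVel (-2 * φb) ξ).2) : Vel)
      = shiftVel (-2 * φb) (-ξ.1, ξ.2) := by rw [shiftVel_reflect]; rfl
  rw [h5] at h1
  simp only [hg, reflect_apply]
  -- The condition on `ψ` turns the folded part into `-α F(shiftVel (-2 * φb) (-ξ₁, ξ')) ξ₁ ψ(0,
  -- ξ)`, which cancels the reflected part of `F` and leaves `fb`.
  rw [← h4, h1]
  ring

end Weak

/-! ### Existence and uniqueness when `φ_b ∈ B⁻`. -/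

section Existence

variable {r α φb C : ℝ} {F fb : Vel → ℝ} {ne : ℝ → ℝ}

/-- The potential comes from the first-order equation and the distribution from the shift.
Differentiating `φ' = √(2 V⁻(φ))` recovers the Poisson equation, as `(V⁻)' = ρ_i⁻ - n_e`. -/
lemma exists_isSolution (hF : IsProfile r F) (hne : Continuous ne) (hφb : φb < 0)
    (hcomp : Compatible α fb F φb) (hC : 0 < C)
    (hVC : ∀ t ∈ Icc φb 0, |VMinus ne F t| ≤ C * t ^ 2) (hB : φb ∈ BMinus ne F) :
    HasSolution ne α fb F φb := by
  have hVc := continuousOn_VMinus hF hne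
  obtain ⟨φ, hφ0, hneg, hlim, hd⟩ := exists_potential hφb hVc hB.2 hC
    fun t ht => (le_abs_self _).trans (hVC t ht)
  set D : ℝ → ℝ := fun x => √(2 * VMinus ne F (max (φ x) φb)) with hDdef
  have hφc : Continuous φ := continuous_iff_continuousAt.2 fun x => (hd x).continuousAt
  have hDc : Continuous D := by
    have : Continuous fun x => VMinus ne F (max (φ x) φb) :=
      hVc.comp_continuous (by fun_prop) fun x => mem_Iic.2 (max_le (hneg x).le hφb.le)
    exact (continuous_const.mul this).sqrt
  have hDpos : ∀ x, 0 < D x := fun x => by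
    have := hB.2 (max (φ x) φb) ⟨le_max_right _ _, max_lt (hneg x) hφb⟩
    simp only [hDdef]; positivity
  have hderiv : deriv φ = D := funext fun x => (hd x).deriv
  have hm : StrictMono φ := strictMono_of_deriv_pos fun x => by rw [hderiv]; exact hDpos x
  have hdW : ∀ x, 0 ≤ x → derivWithin φ (Ici 0) x = D x := fun x hx =>
    (hd x).hasDerivWithinAt.derivWithin (uniqueDiffOn_Ici 0 x hx)
  have hφC1 : ContDiff ℝ 1 φ := by
    rw [contDiff_one_iff_deriv, hderiv]
    exact ⟨fun x => (hd x).differentiableAt, hDc⟩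
  -- Restricted to `x > 0`, where `φ > φ_b` and the truncation at `φ_b` is inactive.
  have hDd : ∀ x, 0 < x → HasDerivAt D (rhoMinus F (φ x) - ne (φ x)) x := fun x hx => by
    have hlt : φb < φ x := hφ0 ▸ hm hx
    have hVp := hB.2 (φ x) ⟨hlt.le, hneg x⟩
    have h1 := ((hasDerivWithinAt_VMinus hF hne (hneg x).le).hasDerivAt
      (Iic_mem_nhds (hneg x))).comp x (hd x)
    have h2 := (h1.const_mul 2).sqrt (by simp only [Function.comp]; positivity)
    have h3 : D =ᶠ[𝓝 x] fun y => √(2 * (VMinus ne F ∘ φ) y) := by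
      filter_upwards [Ioi_mem_nhds hx] with y hy
      have : φb ≤ φ y := hφ0 ▸ hm.monotone (le_of_lt hy)
      simp [hDdef, max_eq_left this]
    refine (h2.congr_of_eventuallyEq h3).congr_deriv ?_
    simp only [Function.comp, max_eq_left hlt.le]
    have : 0 < √(2 * VMinus ne F (φ x)) := by positivity
    field_simp
  have hgc : Continuous fun x => rhoMinus F (φ x) - ne (φ x) :=
    (hF.continuousOn_rhoMinus.comp_continuous hφc fun x => (hneg x).le).sub (hne.comp hφc)
  have hφC2 : ContDiffOn ℝ 2 φ (Ioi 0) := by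
    have hD1 : ContDiffOn ℝ 1 D (Ioi 0) := by
      rw [show (1 : WithTop ℕ∞) = 0 + 1 by norm_num,
        contDiffOn_succ_iff_deriv_of_isOpen isOpen_Ioi]
      refine ⟨fun x hx => (hDd x hx).differentiableAt.differentiableWithinAt, by simp, ?_⟩
      rw [contDiffOn_zero]
      exact hgc.continuousOn.congr fun x hx => (hDd x hx).deriv
    rw [show (2 : WithTop ℕ∞) = 1 + 1 by norm_num,
      contDiffOn_succ_iff_deriv_of_isOpen isOpen_Ioi, hderiv]
    exact ⟨fun x _ => (hd x).differentiableAt.differentiableWithinAt, by simp, hD1⟩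
  have hc : ∀ x, 0 ≤ -2 * φ x := fun x => by linarith [hneg x]
  have htend : ∀ (l : Filter ℝ) (t : ℝ), t ≤ 0 → Tendsto φ l (𝓝 t) →
      Tendsto (fun x => -2 * φ x) l (𝓝[Ici 0] (-2 * t)) := fun l t ht h =>
    tendsto_nhdsWithin_iff.2 ⟨h.const_mul (-2), Eventually.of_forall hc⟩
  refine ⟨fun x ξ => F (shiftVel (-2 * φ x) ξ), φ, ?_⟩
  exact
    { locInt := hF.locallyIntegrableOn hφc hm hneg
      slice_integrable := fun x _ => hF.integrable_comp (hc x)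
      slice_continuous := fun x _ => (hF.tendsto_integral_abs (hc x)).comp
        (htend _ _ (hneg x).le ((hφc.tendsto x).mono_left nhdsWithin_le_nhds))
      phi_C1 := hφC1.contDiffOn
      phi_C2 := hφC2
      nonneg := fun x _ => Eventually.of_forall fun ξ => hF.nonneg _
      strictly_monotone := Or.inl fun x hx => by rw [hdW x hx]; exact hDpos x
      weak := by
        intro ψ hψ
        have hsym : ∀ᵐ ξ : Vel, ξ.1 ^ 2 < -2 * φ 0 → F ξ = F (-ξ.1, ξ.2) := by
          filter_upwards [hcomp.2] with ξ h hξ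
          apply h
          rw [hφ0] at hξ
          rw [abs_of_neg hφb, show 2 * -φb = -2 * φb by ring]
          exact Real.sq_lt.1 hξ
        have h1 := integral_transport hF hd hDc hm hneg hlim hsym hψ.1 hψ.2.1
        rw [hφ0, integral_wall hF hφb hcomp hψ] at h1
        refine eq_neg_iff_add_eq_zero.1 (Eq.trans ?_ h1)
        refine setIntegral_congr_fun (measurableSet_Ioi.prod MeasurableSet.univ) fun p hp => ?_
        rw [hdW p.1 (le_of_lt hp.1)]
      limit_f := by
        have := (hF.tendsto_integral_abs le_rfl).comp
          (by simpa using htend atTop 0 le_rfl hlim)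
        simpa [Function.comp_def] using this
      poisson := fun x hx => by
        rw [iteratedDeriv_succ, iteratedDeriv_one, hderiv, (hDd x hx).deriv,
          hF.rhoMinus_eq (hneg x).le]
      phi_wall := hφ0
      limit_phi := hlim }

lemma HasSolution.hasUniqueSolution (h : HasSolution ne α fb F φb) (hF : IsProfile r F)
    (hne : Continuous ne) (hφb : φb < 0) : HasUniqueSolution ne α fb F φb := by
  obtain ⟨f, φ, h⟩ := h
  refine ⟨f, φ, h, fun g θ h' => ?_⟩
  have hθ : ∀ x, 0 ≤ x → θ x = φ x := fun x hx => h.phi_unique h' hφb hF hne hx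
  refine ⟨fun x hx => ?_, hθ⟩
  have h1 := h'.ae_eq_comp_shiftVel hφb hF hx
  rw [hθ x hx] at h1
  exact h1.trans (h.ae_eq_comp_shiftVel hφb hF hx).symm

lemma HasUniqueSolution.hasSolution {finf : Vel → ℝ} (h : HasUniqueSolution ne α fb finf φb) :
    HasSolution ne α fb finf φb := by
  obtain ⟨f, φ, h, -⟩ := h
  exact ⟨f, φ, h⟩

end Existence

/-! ### Independence of the representative of `f_∞`, and the four cases. -/

/-- Distributions at infinity which agree almost everywhere have the same solutions. -/
lemma IsSolution.congr {ne : ℝ → ℝ} {α φb : ℝ} {fb F G : Vel → ℝ} {f : ℝ → Vel → ℝ} {φ : ℝ → ℝ}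
    (h : IsSolution ne α fb F φb f φ) (hFG : F =ᵐ[volume] G) : IsSolution ne α fb G φb f φ :=
  { h with
    limit_f := h.limit_f.congr fun x => integral_congr_ae (by
      filter_upwards [hFG] with ξ hξ
      rw [hξ]) }

lemma isSolution_congr {ne : ℝ → ℝ} {α φb : ℝ} {fb F G : Vel → ℝ} (hFG : F =ᵐ[volume] G) :
    IsSolution ne α fb F φb = IsSolution ne α fb G φb := by
  ext f φ
  exact ⟨fun h => h.congr hFG, fun h => h.congr hFG.symm⟩

lemma rhoMinus_congr {F G : Vel → ℝ} (hFG : F =ᵐ[volume] G) : rhoMinus F = rhoMinus G := by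
  ext t
  refine integral_congr_ae ?_
  filter_upwards [hFG] with ξ hξ
  rw [hξ]

lemma VMinus_congr {F G : Vel → ℝ} (hFG : F =ᵐ[volume] G) (ne : ℝ → ℝ) :
    VMinus ne F = VMinus ne G := by
  ext t
  rw [VMinus, VMinus, rhoMinus_congr hFG]

lemma Compatible.congr {α φb : ℝ} {fb F G : Vel → ℝ} (h : Compatible α fb F φb)
    (hFG : F =ᵐ[volume] G) : Compatible α fb G φb := by
  have h' := measurePreserving_reflect.quasiMeasurePreserving.ae hFG
  constructor
  · filter_upwards [hFG, h', h.1] with ξ h1 h2 h3 hξ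
    rw [reflect_apply] at h2
    rw [← h1, ← h2, h3 hξ]
  · filter_upwards [hFG, h', h.2] with ξ h1 h2 h3 hξ
    rw [reflect_apply] at h2
    rw [← h1, ← h2, h3 hξ]

/-- The explicit form is insensitive to modifications of `f_∞` on null sets. -/
lemma ExplicitForm.congr {F G : Vel → ℝ} {f : ℝ → Vel → ℝ} {φ : ℝ → ℝ} (h : ExplicitForm F f φ)
    (hFG : F =ᵐ[volume] G) (hφ : ∀ x, 0 ≤ x → φ x ≤ 0) : ExplicitForm G f φ := by
  intro x hx
  have hc : 0 ≤ -2 * φ x := by linarith [hφ x hx]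
  filter_upwards [h x hx, ae_shiftVel' hc hFG, ae_fst_ne_zero] with ξ h1 h2 h0
  rw [h1]
  rw [shiftVel] at h2
  have e : ξ.1 ^ 2 - 2 * φ x = ξ.1 ^ 2 + -2 * φ x := by ring
  rcases lt_or_gt_of_ne h0 with h' | h'
  · rw [shift_of_neg h', ← e] at h2
    simp [chi, h', not_lt.2 h'.le, h2]
  · rw [shift_of_pos h', ← e] at h2
    simp [chi, h', not_lt.2 h'.le, h2]

end Sheath

theorem theorem2p4
    (ne : ℝ → ℝ) (hne : ContDiff ℝ 2 ne) (hne0 : ne 0 = 1) (hne1 : deriv ne 0 = -1)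
    (α : ℝ) (hα : α ∈ Set.Icc (0 : ℝ) 1)
    (φb : ℝ) (hφb : φb < 0)
    (fb finf : Vel → ℝ)
    (hfb : MeasureTheory.IntegrableOn fb {ξ : Vel | 0 < ξ.1})
    (hfb0 : ∀ᵐ ξ : Vel, 0 < ξ.1 → 0 ≤ fb ξ)
    (hfinf : MeasureTheory.Integrable finf)
    (hfinf0 : ∀ᵐ ξ : Vel, 0 ≤ finf ξ)
    (r : ℝ) (hr : 2 < r) (hLr : LrLoc r finf)
    (hmass : ∫ ξ, finf ξ = 1)
    (hcomp : Compatible α fb finf φb)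
    (hV : ContDiffOn ℝ 2 (VMinus ne finf) (Set.Icc φb 0)) :
    (0 < d2VMinus ne finf φb →
      (BMinus ne finf).Nonempty ∧
      (HasUniqueSolution ne α fb finf φb ↔ infB ne finf < (φb : EReal)) ∧
      (HasSolution ne α fb finf φb → infB ne finf < (φb : EReal)) ∧
      ∀ f φ, IsSolution ne α fb finf φb f φ → ExplicitForm finf f φ ∧ ExpDecay φ) ∧
    (d2VMinus ne finf φb = 0 → (BMinus ne finf).Nonempty →
      (HasUniqueSolution ne α fb finf φb ↔ infB ne finf < (φb : EReal)) ∧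
      (HasSolution ne α fb finf φb → infB ne finf < (φb : EReal)) ∧
      ∀ f φ, IsSolution ne α fb finf φb f φ → ExplicitForm finf f φ) ∧
    (d2VMinus ne finf φb = 0 → BMinus ne finf = ∅ → ¬ HasSolution ne α fb finf φb) ∧
    (d2VMinus ne finf φb < 0 → ¬ HasSolution ne α fb finf φb) := by
  obtain ⟨F, hF, hFf⟩ := exists_isProfile_ae_eq hr hfinf hfinf0 hLr
  have hnec := hne.continuous
  have eV : VMinus ne finf = VMinus ne F := (VMinus_congr hFf ne).symm
  have eB : BMinus ne finf = BMinus ne F := by simp only [BMinus, eV]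
  have eI : infB ne finf = infB ne F := by simp only [infB, eB]
  have ed : d2VMinus ne finf φb = d2VMinus ne F φb := by simp only [d2VMinus, eV]
  have eS : ∀ φb, IsSolution ne α fb finf φb = IsSolution ne α fb F φb := fun φb =>
    (isSolution_congr hFf).symm
  have hcF : Compatible α fb F φb := hcomp.congr hFf.symm
  -- Quasi-neutrality at infinity: the derivative of `V⁻` vanishes at `0`, which yields the
  -- quadratic bound on `V⁻`.
  have hrho0 : rhoMinus F 0 - ne 0 = 0 := by
    rw [hF.rhoMinus_zero, hne0, integral_congr_ae hFf, hmass, sub_self]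
  rw [eV] at hV
  have hVd := fun (t : ℝ) (ht : t ≤ 0) => hasDerivWithinAt_VMinus hF hnec ht
  have hgd := hasDerivWithinAt_rhoMinus_sub hF hnec hφb hV
  obtain ⟨C, hC, hg⟩ := exists_abs_rhoMinus_sub_le hF hnec hφb hV hrho0
  have hVC : ∀ t ∈ Icc φb 0, |VMinus ne F t| ≤ C * t ^ 2 := fun t ht =>
    abs_le_mul_sq hC (VMinus_zero ne F) hVd hg ht
  have hiff := infB_lt_iff hF hnec hφb
  have hS1 : HasSolution ne α fb finf φb → φb ∈ BMinus ne F := by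
    rintro ⟨f, φ, h⟩
    rw [eS] at h
    exact h.mem_BMinus hφb hF hnec
  have hS2 : φb ∈ BMinus ne F → HasUniqueSolution ne α fb finf φb := fun h => by
    have := (exists_isSolution hF hnec hφb hcF hC hVC h).hasUniqueSolution hF hnec hφb
    simpa only [HasUniqueSolution, eS] using this
  -- The criterion holds whatever the sign of the second derivative, and serves both of the first
  -- two cases.
  have hU : HasUniqueSolution ne α fb finf φb ↔ infB ne finf < (φb : EReal) := by
    rw [eI, hiff]
    exact ⟨fun h => hS1 h.hasSolution, hS2⟩
  have hS : HasSolution ne α fb finf φb → infB ne finf < (φb : EReal) := by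
    rw [eI, hiff]
    exact hS1
  have hE : ∀ f φ, IsSolution ne α fb finf φb f φ → ExplicitForm finf f φ := fun f φ h => by
    rw [eS] at h
    exact (h.explicitForm hφb hF).congr hFf fun x hx => (h.phi_neg hφb hx).le
  refine ⟨fun hd => ?_, fun _ _ => ⟨hU, hS, hE⟩, fun _ hB h => ?_, fun hd h => ?_⟩
  · rw [ed] at hd
    obtain ⟨ε, hε, hεb, hq⟩ := exists_quadratic_le hφb hd (VMinus_zero ne F) hVd hrho0 hgd
    refine ⟨⟨-ε, ?_⟩, hU, hS, fun f φ h => ⟨hE f φ h, ?_⟩⟩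
    · rw [eB]
      refine ⟨neg_neg_of_pos hε, fun t ht => lt_of_lt_of_le ?_ (hq t ⟨ht.1, ht.2.le⟩)⟩
      have : t ≠ 0 := ht.2.ne
      positivity
    · rw [eS] at h
      exact h.expDecay hφb hF hnec hC hg hVC (by positivity) hε hq
  · have := hS1 h
    rw [← eB, hB] at this
    exact this
  · rw [ed] at hd
    -- Applied to `-V⁻`, the quadratic bound gives `V⁻(-ε) ≤ 0`. As `ε ≤ -φ_b`, the point `-ε` lies
    -- in `[φ_b, 0)`, where a solution would force `V⁻ > 0`.
    obtain ⟨ε, hε, hεb, hq⟩ := exists_quadratic_le (V := fun t => -VMinus ne F t)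
      (g := fun t => -(rhoMinus F t - ne t)) hφb (neg_pos.2 hd) (by simp [VMinus_zero])
      (fun t ht => (hVd t ht).neg) (by simp only [hrho0, neg_zero]) hgd.neg
    have h1 := hq (-ε) ⟨le_rfl, by linarith⟩
    have h2 := (hS1 h).2 (-ε) ⟨by linarith, by linarith⟩
    have h3 : 0 ≤ -d2VMinus ne F φb / 4 * (-ε) ^ 2 := by
      have : 0 < -d2VMinus ne F φb := neg_pos.2 hd
      positivity
    linarith
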